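/- **Setting.** Let $\mu$ be a $\sigma$-finite positive measure on a set $X$, and let $M(X,\mu)$ be the space of a.e. classes of complex measurable functions. A *Banach function space* is a complex Banach space $L\subseteq M(X,\mu)$ such that $f\in L$, $g\in M(X,\mu)$, $|g|\le|f|$ imply $g\in L$ and $\|g\|\le\|f\|$; it is assumed that $X$ is the carrier of $L$ (there is no set of positive measure on which all $f\in L$ vanish a.e.). The norm of $L$ (or of the Banach dual $L^*$ with its usual order) is *order continuous* if $\|f_n\|\to0$ for every decreasing sequence with infimum $0$. A *positive kernel operator* is a linear operator $A$ on $L$ that maps nonnegative functions to nonnegative ones and for which there is a $\mu\times\mu$-measurable kernel $a$ such that for all $f\in L$ and a.e. $x$, $\int_X|a(x,y)f(y)|\,d\mu(y)<\infty$ and $(Af)(x)=\int_X a(x,y)f(y)\,d\mu(y)$; such operators are bounded and $a\ge0$ a.e. For $\alpha_1,\dots,\alpha_m\ge0$, $A_1^{(\alpha_1)}\circ\cdots\circ A_m^{(\alpha_m)}$ denotes the operator on $L$ with kernel $\prod_j a_j(x,y)^{\alpha_j}$ (with $t^0=1$ for all $t\ge 0$), where $a_j\ge 0$ is the kernel of $A_j$.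 For sets of operators, $\Psi_1^{(\alpha_1)}\circ\cdots\circ\Psi_m^{(\alpha_m)}=\{A_1^{(\alpha_1)}\circ\cdots\circ A_m^{(\alpha_m)}:A_j\in\Psi_j\}$, $\Psi\Sigma=\{AB:A\in\Psi,B\in\Sigma\}$ and $\Psi^n=\{A_1\cdots A_n:A_i\in\Psi\}$. For a bounded operator $A$ let $\rho(A)$ be its spectral radius, $\rho_{ess}(A)$ the spectral radius of its image in the Calkin algebra, and $\gamma(A)$ its Hausdorff measure of noncompactness. For a bounded set $\Psi$ of bounded operators put $$\rho(\Psi)=\limsup_{k\to\infty}\Big[\sup_{A\in\Psi^k}\rho(A)\Big]^{1/k},\qquad \hat\rho(\Psi)=\lim_{k\to\infty}\Big[\sup_{A\in\Psi^k}\|A\|\Big]^{1/k},$$ $$\rho_{ess}(\Psi)=\limsup_{k\to\infty}\Big[\sup_{A\in\Psi^k}\rho_{ess}(A)\Big]^{1/k},\qquad \hat\rho_{ess}(\Psi)=\lim_{k\to\infty}\Big[\sup_{A\in\Psi^k}\gamma(A)\Big]^{1/k},$$ where a supremum over the empty set is $0$; also $0^0=1$. **Theorem.** (i) Let $\Psi,\Sigma$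 be bounded sets of positive kernel operators on a Banach function space $L$, let $\alpha_1,\dots,\alpha_m\ge0$ with $\sum_{j=1}^m\alpha_j=1$, and let $\beta\in[0,1]$. Then all Hadamard means below are well defined operators on $L$, and for each $r\in\{\rho,\hat\rho\}$ $$r(\Psi)=r(\Psi^{(\alpha_1)}\circ\cdots\circ\Psi^{(\alpha_m)})$$ and $$r(\Psi\Sigma)=r\big((\Psi^{(\frac12)}\circ\Psi^{(\frac12)})(\Sigma^{(\frac12)}\circ\Sigma^{(\frac12)})\big)=r\big((\Psi\Sigma)^{(\frac12)}\circ(\Psi\Sigma)^{(\frac12)}\big)^{\beta}\,r\big((\Sigma\Psi)^{(\frac12)}\circ(\Sigma\Psi)^{(\frac12)}\big)^{1-\beta}.$$ If, in addition, $L$ and $L^*$ have order continuous norms, these equalities also hold for each $r\in\{\rho_{ess},\hat\rho_{ess}\}$. (ii) Let $R=\{1,\dots,N\}$ or $R=\mathbb N$, and let $L$ be a Banach sequence space over $R$ (that is, a Banach function space over $R$ with the counting measure) that contains $e_n=\chi_{\{n\}}$ with $\|e_n\|=1$ for all $n\in R$. Let $\Psi$ be a bounded set of operators on $L$ that are given by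 nonnegative matrices $(a_{ij})_{i,j\in R}$, let $m,n\ge1$ be integers and let $\alpha\ge1$ be real. Then all Hadamard powers and products below are well defined operators on $L$, and for each $r\in\{\rho,\hat\rho\}$ $$r(\Psi^{(m)})\le r(\Psi\circ\cdots\circ\Psi)\le r(\Psi^n\circ\cdots\circ\Psi^n)^{\frac1n}\le r(\Psi)^m$$ with $m$ factors in each Hadamard product, and $$r(\Psi^{(\alpha)})\le r(\Psi^{(\alpha-1)}\circ\Psi)\le r\big((\Psi^n)^{(\alpha-1)}\circ\Psi^n\big)^{\frac1n}\le r(\Psi)^\alpha.$$ -/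

import Mathlib

open MeasureTheory Filter Topology
open scoped ENNReal NNReal ComplexOrder Pointwise

/-- A Banach function space over `(X, μ)`: a complex Banach space `E`, identified through the
injective linear map `ι` with a linear subspace of the space `M(X, μ)` of a.e. classes of complex
measurable functions, such that `E` is an ideal with a monotone norm, and such that `X` is the
carrier of `E`. -/
structure BanachFunctionSpace {X : Type*} [MeasurableSpace X] (μ : Measure X)
    (E : Type*) [NormedAddCommGroup E] [NormedSpace ℂ E] [CompleteSpace E] where
  /-- the inclusion into `M(X, μ)` -/
  ι : E →ₗ[ℂ] (X →ₘ[μ] ℂ)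
  injective : Function.Injective ι
  /-- `f ∈ L`, `g ∈ M(X, μ)`, `|g| ≤ |f|` imply `g ∈ L` and `‖g‖ ≤ ‖f‖` -/
  solid : ∀ (f : E) (g : X →ₘ[μ] ℂ), (∀ᵐ x ∂μ, ‖g x‖ ≤ ‖ι f x‖) → ∃ h : E, ι h = g ∧ ‖h‖ ≤ ‖f‖
  /-- no set of positive measure on which all members of `L` vanish -/
  carrier : ∀ Y : Set X, MeasurableSet Y →
    (∀ f : E, ∀ᵐ x ∂μ, x ∈ Y → ι f x = 0) → μ Y = 0

namespace BanachFunctionSpace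

variable {X : Type*} [MeasurableSpace X] {μ : Measure X}
  {E : Type*} [NormedAddCommGroup E] [NormedSpace ℂ E] [CompleteSpace E]

/-- `0 ≤ f_n ↓ 0` implies `‖f_n‖ → 0`. The order of `M(X, μ)` is the a.e. pointwise one, with
`z ≤ w` in `ℂ` meaning that `w - z` is a nonnegative real number. -/
def HasOrderContinuousNorm (L : BanachFunctionSpace μ E) : Prop :=
  ∀ f : ℕ → E, Antitone (fun n => L.ι (f n)) → IsGLB (Set.range fun n => L.ι (f n)) 0 →
    Tendsto (fun n => ‖f n‖) atTop (𝓝 0)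

/-- The order of the Banach dual: `φ ≤ ψ` iff `φ f ≤ ψ f` for all `f ∈ L` with `f ≥ 0`. -/
def DualLE (L : BanachFunctionSpace μ E) (φ ψ : E →L[ℂ] ℂ) : Prop :=
  ∀ f : E, 0 ≤ L.ι f → φ f ≤ ψ f

/-- The Banach dual has an order continuous norm: a decreasing sequence of functionals with
infimum `0` in the dual converges to `0` in norm. -/
def DualHasOrderContinuousNorm (L : BanachFunctionSpace μ E) : Prop :=
  ∀ φ : ℕ → (E →L[ℂ] ℂ), (∀ n k, n ≤ k → L.DualLE (φ k) (φ n)) → (∀ n, L.DualLE 0 (φ n)) →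
    (∀ ψ : E →L[ℂ] ℂ, (∀ n, L.DualLE ψ (φ n)) → L.DualLE ψ 0) →
    Tendsto (fun n => ‖φ n‖) atTop (𝓝 0)

/-- `A` is the kernel operator with kernel `a`. (A function is measurable for the completed
product σ-algebra iff it is `AEMeasurable` for the product measure.) -/
def HasKernel (L : BanachFunctionSpace μ E) (A : E →L[ℂ] E) (a : X × X → ℂ) : Prop :=
  AEMeasurable a (μ.prod μ) ∧ ∀ f : E, ∀ᵐ x ∂μ,
    Integrable (fun y => a (x, y) * L.ι f y) μ ∧ L.ι (A f) x = ∫ y, a (x, y) * L.ι f y ∂μ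

/-- A positive kernel operator. (Positive operators are automatically bounded, so nothing is lost
by looking at bounded operators only.) -/
def IsPositiveKernelOperator (L : BanachFunctionSpace μ E) (A : E →L[ℂ] E) : Prop :=
  (∀ f : E, 0 ≤ L.ι f → 0 ≤ L.ι (A f)) ∧ ∃ a : X × X → ℂ, L.HasKernel A a

/-- `C` is the operator `A₁^(α₁) ∘ ⋯ ∘ A_m^(α_m)`, defined on all of `L`: its kernel is
`∏ j, a_j ^ α_j`, where `a_j ≥ 0` is the kernel of `A_j`. -/
def IsHadamard (L : BanachFunctionSpace μ E) {m : ℕ} (α : Fin m → ℝ) (A : Fin m → (E →L[ℂ] E))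
    (C : E →L[ℂ] E) : Prop :=
  ∃ a : Fin m → X × X → ℝ, (∀ j p, 0 ≤ a j p) ∧
    (∀ j, L.HasKernel (A j) (fun p => (a j p : ℂ))) ∧
    L.HasKernel C (fun p => ((∏ j, a j p ^ α j : ℝ) : ℂ))

/-- The set `Ψ₁^(α₁) ∘ ⋯ ∘ Ψ_m^(α_m) = {A₁^(α₁) ∘ ⋯ ∘ A_m^(α_m) : A_j ∈ Ψ_j}`. -/
def hadamard (L : BanachFunctionSpace μ E) {m : ℕ} (α : Fin m → ℝ) (Ψ : Fin m → Set (E →L[ℂ] E)) :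
    Set (E →L[ℂ] E) :=
  {C | ∃ A : Fin m → (E →L[ℂ] E), (∀ j, A j ∈ Ψ j) ∧ L.IsHadamard α A C}

/-- Every `A₁^(α₁) ∘ ⋯ ∘ A_m^(α_m)` with `A_j ∈ Ψ_j` is a well defined operator on all of `L`. -/
def HadamardDefined (L : BanachFunctionSpace μ E) {m : ℕ} (α : Fin m → ℝ)
    (Ψ : Fin m → Set (E →L[ℂ] E)) : Prop :=
  ∀ A : Fin m → (E →L[ℂ] E), (∀ j, A j ∈ Ψ j) → ∃! C : E →L[ℂ] E, L.IsHadamard α A C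

/-- `L ∈ 𝓛`: a Banach sequence space, i.e. a Banach function space over the counting measure on a
countable discrete index set, that contains every `e_n = χ_{n}` and has `‖e_n‖ = 1`. -/
def IsNormalizedSequenceSpace (L : BanachFunctionSpace μ E) : Prop :=
  Countable X ∧ MeasurableSingletonClass X ∧ μ = Measure.count ∧
    ∀ n : X, ∃ e : E, ⇑(L.ι e) =ᵐ[μ] Set.indicator {n} (fun _ => (1 : ℂ)) ∧ ‖e‖ = 1

/-- `A` is the operator `(A x)_i = ∑ j, a_{ij} x_j` on a sequence space that is defined by a
nonnegative matrix. -/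
def IsNonnegMatrixOperator (L : BanachFunctionSpace μ E) (A : E →L[ℂ] E) : Prop :=
  ∃ a : Matrix X X ℝ, (∀ i j, 0 ≤ a i j) ∧
    ∀ (f : E) (i : X), HasSum (fun j => (a i j : ℂ) * L.ι f j) (L.ι (A f) i)

end BanachFunctionSpace

section Radii

variable (E : Type*) [NormedAddCommGroup E] [NormedSpace ℂ E]

/-- The two-sided ideal of compact operators. -/
def compactOperatorIdeal : TwoSidedIdeal (E →L[ℂ] E) :=
  TwoSidedIdeal.mk' {T | IsCompactOperator T}
    isCompactOperator_zero
    (fun hx hy => IsCompactOperator.add hx hy)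
    (fun hx => IsCompactOperator.neg hx)
    (fun {x _} hy => IsCompactOperator.clm_comp hy x)
    (fun {_ y} hx => IsCompactOperator.comp_clm hx y)

/-- The Calkin algebra (as a complex algebra, which is all that the spectrum needs). -/
abbrev CalkinAlgebra : Type _ := (compactOperatorIdeal E).ringCon.Quotient

variable {E}

/-- The essential spectral radius: the spectral radius of the image in the Calkin algebra. -/
noncomputable def essSpectralRadius (A : E →L[ℂ] E) : ℝ≥0∞ :=
  spectralRadius ℂ (A : CalkinAlgebra E)

/-- The Hausdorff measure of noncompactness: the infimum of all `δ > 0` for which there is a finite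
set `M` with `A(D) ⊆ M + δ D`, where `D` is the closed unit ball. -/
noncomputable def hausdorffNoncompactness (A : E →L[ℂ] E) : ℝ≥0∞ :=
  ⨅ (δ : ℝ≥0) (_ : 0 < δ)
    (_ : ∃ M : Set E, M.Finite ∧ A '' Metric.closedBall 0 1 ⊆ M + Metric.closedBall 0 (δ : ℝ)),
    (δ : ℝ≥0∞)

/-- `limsup_{k → ∞} (sup_{A ∈ Ψ^k} q(A))^{1/k}`, with `Ψ^k = {A₁ ⋯ A_k : A_i ∈ Ψ}`. -/
noncomputable def radiusOf (q : (E →L[ℂ] E) → ℝ≥0∞) (Ψ : Set (E →L[ℂ] E)) : ℝ≥0∞ :=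
  limsup (fun k : ℕ => (⨆ A ∈ Ψ ^ k, q A) ^ (1 / (k : ℝ))) atTop

/-- The generalized spectral radius `ρ(Ψ)`. -/
noncomputable def genRadius (Ψ : Set (E →L[ℂ] E)) : ℝ≥0∞ := radiusOf (fun A => spectralRadius ℂ A) Ψ

/-- The joint spectral radius (the limsup is a limit since the norm is submultiplicative). -/
noncomputable def jointRadius (Ψ : Set (E →L[ℂ] E)) : ℝ≥0∞ := radiusOf (fun A => ‖A‖ₑ) Ψ

/-- The generalized essential spectral radius. -/
noncomputable def genEssRadius (Ψ : Set (E →L[ℂ] E)) : ℝ≥0∞ := radiusOf essSpectralRadius Ψ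

/-- The joint essential spectral radius (the limsup is a limit since the measure of noncompactness
is submultiplicative). -/
noncomputable def jointEssRadius (Ψ : Set (E →L[ℂ] E)) : ℝ≥0∞ := radiusOf hausdorffNoncompactness Ψ

end Radii

/-!
Let `C = A₁^(α₁) ∘ ⋯ ∘ A_m^(α_m)` be a Hadamard product of positive kernel operators. By Hölder's
inequality, `|g| ≤ ∏ fⱼ ^ αⱼ` implies `|C g| ≤ ∏ (Aⱼ fⱼ) ^ αⱼ`. This relation, `GeomDominated`, is
obviously stable under products, so that every product `C` of `k` operators from
`Ψ^(α₁) ∘ ⋯ ∘ Ψ^(α_m)` is dominated in this sense by operators `A₁, …, A_m ∈ Ψ ^ k`. Everything is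
then reduced to bounding one quantity `q` (the norm, the spectral radius, the measure of
noncompactness or the essential spectral radius) of a dominated operator, `MeanBounded`.

Suppose first that `∑ αⱼ = 1`. Then `|C g| ≤ (∑ αⱼ Aⱼ) |g|` by the inequality between the weighted
means, so that `‖C‖ ≤ max ‖Aⱼ‖`; applied to the powers of `C`, this bounds the spectral radius by
Gelfand's formula. The measure of noncompactness satisfies `γ(C) ≤ 4 max γ(Aⱼ)`, if the norms of `L`
and of its dual are order continuous. Indeed, let `B = ∑ αⱼ Aⱼ` map the unit ball into `M + δ D`
with `M` finite. There is `w` with `‖B (|f| - |w|)⁺‖ ≤ 3 δ` on the unit ball, for otherwise a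
disjoint sequence would contradict the order continuity of the dual norm (`exists_excess_le`), and
`C` maps `{f | |f| ≤ |w|}` to a totally bounded set, by order continuity of the norm of
`L` (`IsPositiveKernelOperator.totallyBounded`). The essential spectral radius is handled by
`ρ_ess(C) = lim γ(C ^ n) ^ (1 / n)`: the Calkin norm bounds `γ`, and if `γ(S) < 1`, then `1 - S` is
invertible modulo compact operators (`HasFiniteNet.isUnit_calkin`). The constant `4` disappears in
the radii of sets of operators. Since `Ψ ⊆ Ψ^(α₁) ∘ ⋯ ∘ Ψ^(α_m)`, the inequalities obtained in this
way are equalities. The last identity uses `r(ΨΣ) = r(ΣΨ)` in addition.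

On a sequence space, let `s = ∑ αⱼ ≥ 1`. Matrix entries are bounded by the norm of the operator, and
Hölder's inequality for sums holds for such exponents, too. The bound
`∏ xⱼ ^ αⱼ ≤ N ^ (s - 1) ∑ (αⱼ / s) xⱼ` for `0 ≤ xⱼ ≤ N` now gives `‖C‖ ≤ (max ‖Aⱼ‖) ^ s`, hence
`r(Ψ^(α₁) ∘ ⋯ ∘ Ψ^(α_m)) ≤ r(Ψ) ^ s`. The intermediate terms of the chains appear because products
of `n` Hadamard products of members of `Ψ` are entrywise dominated by Hadamard products of members
of `Ψ ^ n`.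
-/

namespace BanachFunctionSpace

/-! ### The lattice structure of a Banach function space -/

section Basic

variable {X : Type*} [MeasurableSpace X] {μ : Measure X}
  {E : Type*} [NormedAddCommGroup E] [NormedSpace ℂ E] [CompleteSpace E]
  (L : BanachFunctionSpace μ E)

lemma ι_add (f g : E) : ∀ᵐ x ∂μ, L.ι (f + g) x = L.ι f x + L.ι g x := by
  rw [map_add]; exact AEEqFun.coeFn_add _ _

lemma ι_sub (f g : E) : ∀ᵐ x ∂μ, L.ι (f - g) x = L.ι f x - L.ι g x := by
  rw [map_sub]; exact AEEqFun.coeFn_sub _ _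

lemma ι_neg (f : E) : ∀ᵐ x ∂μ, L.ι (-f) x = - L.ι f x := by
  rw [map_neg]; exact AEEqFun.coeFn_neg _

lemma ι_smul (c : ℂ) (f : E) : ∀ᵐ x ∂μ, L.ι (c • f) x = c * L.ι f x := by
  rw [map_smul]; exact AEEqFun.coeFn_smul _ _

lemma ι_zero : ∀ᵐ x ∂μ, L.ι (0 : E) x = 0 := by
  rw [map_zero]; exact AEEqFun.coeFn_zero

lemma ι_sum {κ : Type*} (s : Finset κ) (f : κ → E) :
    ∀ᵐ x ∂μ, L.ι (∑ i ∈ s, f i) x = ∑ i ∈ s, L.ι (f i) x := by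
  classical
  induction s using Finset.induction_on with
  | empty => simpa using L.ι_zero
  | insert a s ha ih =>
    filter_upwards [ih, L.ι_add (f a) (∑ i ∈ s, f i)] with x h1 h2
    rw [Finset.sum_insert ha, Finset.sum_insert ha, h2, h1]

lemma aesm (f : E) : AEStronglyMeasurable (L.ι f) μ := (L.ι f).aestronglyMeasurable

lemma ext_ae {f g : E} (h : ∀ᵐ x ∂μ, L.ι f x = L.ι g x) : f = g :=
  L.injective (AEEqFun.ext h)

lemma nonneg_iff (f : E) : 0 ≤ L.ι f ↔ ∀ᵐ x ∂μ, 0 ≤ L.ι f x := by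
  rw [← AEEqFun.coeFn_le]
  constructor
  · intro h
    filter_upwards [h, AEEqFun.coeFn_zero (α := X) (β := ℂ) (μ := μ)] with x hx h0
    rwa [h0] at hx
  · intro h
    filter_upwards [h, AEEqFun.coeFn_zero (α := X) (β := ℂ) (μ := μ)] with x hx h0
    rwa [h0]

lemma norm_le_of_ae_le {f g : E} (h : ∀ᵐ x ∂μ, ‖L.ι f x‖ ≤ ‖L.ι g x‖) : ‖f‖ ≤ ‖g‖ := by
  obtain ⟨k, hk, hn⟩ := L.solid g (L.ι f) h
  rwa [L.injective hk] at hn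

lemma exists_of_norm_le (f : E) {g : X → ℂ} (hg : AEStronglyMeasurable g μ)
    (h : ∀ᵐ x ∂μ, ‖g x‖ ≤ ‖L.ι f x‖) : ∃ k : E, (∀ᵐ x ∂μ, L.ι k x = g x) ∧ ‖k‖ ≤ ‖f‖ := by
  have hc := AEEqFun.coeFn_mk g hg
  obtain ⟨k, hk, hn⟩ := L.solid f (AEEqFun.mk g hg) (by
    filter_upwards [h, hc] with x hx hx'
    rwa [hx'])
  exact ⟨k, by rw [hk]; exact hc, hn⟩

lemma exists_abs (f : E) : ∃ k : E, (∀ᵐ x ∂μ, L.ι k x = (‖L.ι f x‖ : ℂ)) ∧ ‖k‖ ≤ ‖f‖ :=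
  L.exists_of_norm_le f (Complex.measurable_ofReal.comp_aemeasurable
    (L.aesm f).aemeasurable.norm).aestronglyMeasurable (by simp)

/-- The modulus of a member of a Banach function space. -/
noncomputable def abs (f : E) : E := (L.exists_abs f).choose

lemma ι_abs (f : E) : ∀ᵐ x ∂μ, L.ι (L.abs f) x = (‖L.ι f x‖ : ℂ) := (L.exists_abs f).choose_spec.1

lemma norm_abs_le (f : E) : ‖L.abs f‖ ≤ ‖f‖ := (L.exists_abs f).choose_spec.2

lemma norm_abs (f : E) : ‖L.abs f‖ = ‖f‖ :=
  le_antisymm (L.norm_abs_le f) (L.norm_le_of_ae_le (by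
    filter_upwards [L.ι_abs f] with x hx
    simp [hx]))

lemma abs_nonneg (f : E) : 0 ≤ L.ι (L.abs f) := by
  rw [nonneg_iff]
  filter_upwards [L.ι_abs f] with x hx
  rw [hx]; exact_mod_cast norm_nonneg _

lemma eq_norm_of_nonneg {z : ℂ} (h : 0 ≤ z) : z = (‖z‖ : ℂ) := by
  rw [Complex.norm_of_nonneg' h]

lemma ae_eq_norm {f : E} (h : 0 ≤ L.ι f) : ∀ᵐ x ∂μ, L.ι f x = (‖L.ι f x‖ : ℂ) := by
  rw [nonneg_iff] at h
  filter_upwards [h] with x hx using eq_norm_of_nonneg hx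

/-- The positive cone is norm closed: if `f ∈ L`, the distance of `f(x)` to `[0, ∞)` is at most
`|f(x) - g(x)|` for every `g ≥ 0`, and the norm is monotone. -/
lemma nonneg_of_tendsto {g : ℕ → E} {f : E} (hg : ∀ n, 0 ≤ L.ι (g n))
    (h : Tendsto g atTop (𝓝 f)) : 0 ≤ L.ι f := by
  let P : Set ℂ := {z | 0 ≤ z}
  have hP0 : (0 : ℂ) ∈ P := le_refl (0 : ℂ)
  have hPc : IsClosed P := isClosed_Ici
  obtain ⟨d, hd, -⟩ := L.exists_of_norm_le f
    (g := fun x => ((Metric.infDist (L.ι f x) P : ℝ) : ℂ))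
    (by
      refine (Complex.continuous_ofReal.comp
        (Metric.continuous_infDist_pt P)).comp_aestronglyMeasurable (L.aesm f))
    (by
      refine Eventually.of_forall fun x => ?_
      rw [Complex.norm_real, Real.norm_of_nonneg Metric.infDist_nonneg]
      simpa using Metric.infDist_le_dist_of_mem (x := L.ι f x) hP0)
  have hle : ∀ n, ‖d‖ ≤ ‖f - g n‖ := fun n => by
    refine L.norm_le_of_ae_le ?_
    filter_upwards [hd, L.ι_sub f (g n), (L.nonneg_iff _).1 (hg n)] with x h1 h2 h3
    rw [h1, h2, Complex.norm_real, Real.norm_of_nonneg Metric.infDist_nonneg, ← dist_eq_norm]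
    exact Metric.infDist_le_dist_of_mem h3
  have hd0 : ‖d‖ ≤ 0 := by
    refine ge_of_tendsto' (x := atTop) (f := fun n => ‖f - g n‖) ?_ hle
    have : Tendsto (fun n => ‖f - g n‖) atTop (𝓝 ‖f - f‖) := (tendsto_const_nhds.sub h).norm
    simpa using this
  have hd1 : d = 0 := norm_le_zero_iff.1 hd0
  rw [nonneg_iff]
  subst hd1
  filter_upwards [hd, L.ι_zero] with x h1 h2
  rw [h2] at h1
  have h3 : Metric.infDist (L.ι f x) P = 0 := by exact_mod_cast h1.symm
  exact (hPc.mem_iff_infDist_zero ⟨0, hP0⟩).2 h3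

/-- A series `∑ fₙ` of nonnegative terms that converges in norm dominates each of its terms. -/
lemma term_le_tsum {g : ℕ → E} (hg : ∀ n, 0 ≤ L.ι (g n)) (hs : Summable g) (k : ℕ) :
    ∀ᵐ x ∂μ, ‖L.ι (g k) x‖ ≤ ‖L.ι (∑' n, g n) x‖ := by
  have h1 : 0 ≤ L.ι (∑' n, g n - g k) := by
    refine L.nonneg_of_tendsto (g := fun N => ∑ n ∈ Finset.range (N + (k + 1)), g n - g k) ?_ ?_
    · intro N
      have h2 : ∑ n ∈ Finset.range (N + (k + 1)), g n - g k =
          ∑ n ∈ (Finset.range (N + (k + 1))).erase k, g n := by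
        rw [← Finset.add_sum_erase (Finset.range (N + (k + 1))) g (a := k)
          (Finset.mem_range.2 (by omega))]
        abel
      rw [h2, nonneg_iff]
      have h3 : ∀ᵐ x ∂μ, ∀ n, 0 ≤ L.ι (g n) x := ae_all_iff.2 fun n => (L.nonneg_iff _).1 (hg n)
      filter_upwards [L.ι_sum ((Finset.range (N + (k + 1))).erase k) g, h3] with x h4 h5
      rw [h4]
      exact Finset.sum_nonneg fun n _ => h5 n
    · exact (((tendsto_add_atTop_iff_nat (k + 1)).2 hs.hasSum.tendsto_sum_nat)).sub_const _
  rw [nonneg_iff] at h1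
  filter_upwards [h1, L.ι_sub (∑' n, g n) (g k), (L.nonneg_iff _).1 (hg k)] with x h2 h3 h4
  rw [h3, sub_nonneg] at h2
  exact CStarAlgebra.norm_le_norm_of_nonneg_of_le h4 h2

/-- A Banach function space over a `σ`-finite measure contains a function that is positive almost
everywhere, by exhaustion. -/
theorem exists_weakUnit [SigmaFinite μ] : ∃ u : E, ∀ᵐ x ∂μ, 0 < L.ι u x := by
  let η : Measure X := μ.toFinite
  have hη : ∀ {s : Set X}, η s = 0 ↔ μ s = 0 := fun {s} => by
    constructor
    · exact fun h => absolutelyContinuous_toFinite μ h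
    · exact fun h => toFinite_absolutelyContinuous μ h
  let S : E → Set X := fun f => {x | L.ι f x ≠ 0}
  have hS : ∀ f, MeasurableSet (S f) := fun f =>
    (L.ι f).measurable (measurableSet_singleton 0).compl
  let t : ℝ≥0∞ := ⨆ f : E, η (S f)
  have ht : ∀ f, η (S f) ≤ t := fun f => le_iSup (fun f => η (S f)) f
  obtain ⟨v, -, hv, hvt⟩ := exists_seq_tendsto_sSup (S := Set.range fun f : E => η (S f))
    (Set.range_nonempty _) (OrderTop.bddAbove _)
  choose f hf using hvt
  rw [sSup_range] at hv
  -- a summable series of nonnegative functions whose sum is supported on all supports `S (f n)`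
  let c : ℕ → ℝ := fun n => (1 / 2) ^ n / (1 + ‖f n‖)
  have hc : ∀ n, 0 < c n := fun n => by positivity
  let g : ℕ → E := fun n => (c n : ℂ) • L.abs (f n)
  have hg0 : ∀ n, ∀ᵐ x ∂μ, L.ι (g n) x = (c n * ‖L.ι (f n) x‖ : ℝ) := fun n => by
    filter_upwards [L.ι_smul (c n) (L.abs (f n)), L.ι_abs (f n)] with x h1 h2
    rw [h1, h2]; push_cast; rfl
  have hg : ∀ n, 0 ≤ L.ι (g n) := fun n => by
    rw [nonneg_iff]
    filter_upwards [hg0 n] with x h1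
    rw [h1]; exact_mod_cast mul_nonneg (hc n).le (norm_nonneg _)
  have hs : Summable g := by
    refine Summable.of_norm_bounded (g := fun n => (1 / 2 : ℝ) ^ n)
      (summable_geometric_of_lt_one (by norm_num) (by norm_num)) fun n => ?_
    rw [norm_smul, Complex.norm_real, Real.norm_of_nonneg (hc n).le, norm_abs]
    simp only [c]
    rw [div_mul_eq_mul_div, div_le_iff₀ (by positivity)]
    have : (0 : ℝ) ≤ (1 / 2) ^ n := by positivity
    nlinarith [norm_nonneg (f n)]
  let w : E := ∑' n, g n
  have hw : 0 ≤ L.ι w := L.nonneg_of_tendsto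
    (g := fun N => ∑ n ∈ Finset.range N, g n) (fun N => by
      rw [nonneg_iff]
      have h3 : ∀ᵐ x ∂μ, ∀ n, 0 ≤ L.ι (g n) x := ae_all_iff.2 fun n => (L.nonneg_iff _).1 (hg n)
      filter_upwards [L.ι_sum (Finset.range N) g, h3] with x h4 h5
      rw [h4]
      exact Finset.sum_nonneg fun n _ => h5 n) hs.hasSum.tendsto_sum_nat
  have hsub : ∀ n, ∀ᵐ x ∂μ, x ∈ S (f n) → x ∈ S w := fun n => by
    filter_upwards [L.term_le_tsum hg hs n, hg0 n] with x h1 h2 h3 h4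
    simp only [S, Set.mem_ofPred_eq] at h3
    change L.ι w x = 0 at h4
    rw [show L.ι (∑' n, g n) x = 0 from h4, h2, norm_zero, Complex.norm_real, Real.norm_eq_abs,
      abs_nonpos_iff] at h1
    exact (mul_pos (hc n) (norm_pos_iff.2 h3)).ne' h1
  have hηae : ∀ {p : X → Prop}, (∀ᵐ x ∂μ, p x) → ∀ᵐ x ∂η, p x := fun h =>
    (toFinite_absolutelyContinuous μ).ae_le h
  have hwt : η (S w) = t := by
    refine le_antisymm (ht w) (le_of_tendsto' hv fun n => ?_)
    rw [← hf n]
    exact measure_mono_ae (hηae (hsub n))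
  have htop : t ≠ ∞ := by rw [← hwt]; exact measure_ne_top _ _
  have hnull : μ (S w)ᶜ = 0 := by
    refine L.carrier _ (hS w).compl fun k => ?_
    -- otherwise `|k| + w` would have a larger support
    have h1 : ∀ᵐ x ∂μ, x ∈ S w ∪ S k → x ∈ S (w + L.abs k) := by
      filter_upwards [L.ι_add w (L.abs k), L.ι_abs k, L.ae_eq_norm hw] with x h1 h2 h3 h4 h5
      rw [h1, h2, h3] at h5
      have h6 : ‖L.ι w x‖ + ‖L.ι k x‖ = 0 := by exact_mod_cast h5
      have h7 : ‖L.ι w x‖ = 0 := by linarith [norm_nonneg (L.ι w x), norm_nonneg (L.ι k x)]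
      have h8 : ‖L.ι k x‖ = 0 := by linarith [norm_nonneg (L.ι w x), norm_nonneg (L.ι k x)]
      rcases h4 with h | h
      · exact h (norm_eq_zero.1 h7)
      · exact h (norm_eq_zero.1 h8)
    have h2 : η (S w ∪ (S k \ S w)) ≤ t := by
      rw [Set.union_sdiff_self]
      exact (measure_mono_ae (hηae h1)).trans (ht _)
    rw [measure_union Set.disjoint_sdiff_right ((hS k).diff (hS w)), hwt] at h2
    have h3 : η (S k \ S w) = 0 := by
      by_contra h
      exact absurd h2 (not_le.2 (ENNReal.lt_add_right htop h))
    rw [hη] at h3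
    have h4 : ∀ᵐ x ∂μ, x ∉ S k \ S w := measure_eq_zero_iff_ae_notMem.1 h3
    filter_upwards [h4] with x h5 h6
    by_contra h7
    exact h5 ⟨h7, h6⟩
  refine ⟨w, ?_⟩
  filter_upwards [(L.nonneg_iff w).1 hw, measure_eq_zero_iff_ae_notMem.1 hnull] with x h1 h2
  refine lt_of_le_of_ne h1 fun h => h2 ?_
  exact fun h3 => h3 h.symm

end Basic

end BanachFunctionSpace

/-! ### Functions on a product that are determined by measurable rectangles -/

section Rectangles

variable {X : Type*} [MeasurableSpace X]

/-- The sets `{(x, y) | (φ x, φ y) ∈ R}` with `φ` a simple function, that is, the finite unions of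
measurable rectangles. -/
def rectangleAlgebra (X : Type*) [MeasurableSpace X] : Set (Set (X × X)) :=
  {T | ∃ (φ : SimpleFunc X ℕ) (R : Set (ℕ × ℕ)), T = {p | (φ p.1, φ p.2) ∈ R}}

lemma isSetAlgebra_rectangleAlgebra : IsSetAlgebra (rectangleAlgebra X) where
  empty_mem := ⟨SimpleFunc.const X 0, ∅, by ext; simp⟩
  compl_mem := by
    rintro s ⟨φ, R, rfl⟩
    exact ⟨φ, Rᶜ, by ext; simp⟩
  union_mem := by
    rintro s t ⟨φ, R, rfl⟩ ⟨ψ, Q, rfl⟩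
    refine ⟨(φ.pair ψ).map fun q => Nat.pair q.1 q.2,
      {q | (q.1.unpair.1, q.2.unpair.1) ∈ R ∨ (q.1.unpair.2, q.2.unpair.2) ∈ Q}, ?_⟩
    ext p
    simp

lemma prod_mem_rectangleAlgebra {S B : Set X} (hS : MeasurableSet S) (hB : MeasurableSet B) :
    S ×ˢ B ∈ rectangleAlgebra X := by
  classical
  let φ : SimpleFunc X ℕ := SimpleFunc.piecewise S hS (SimpleFunc.const X 1) (SimpleFunc.const X 0)
  let ψ : SimpleFunc X ℕ := SimpleFunc.piecewise B hB (SimpleFunc.const X 1) (SimpleFunc.const X 0)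
  refine ⟨(φ.pair ψ).map fun q => Nat.pair q.1 q.2,
      {q | q.1.unpair.1 = 1 ∧ q.2.unpair.2 = 1}, ?_⟩
  ext p
  simp [φ, ψ, Set.piecewise]

lemma measurableSet_of_mem_rectangleAlgebra {T : Set (X × X)} (hT : T ∈ rectangleAlgebra X) :
    MeasurableSet T := by
  obtain ⟨φ, R, rfl⟩ := hT
  exact ((φ.measurable.comp measurable_fst).prodMk (φ.measurable.comp measurable_snd))
    (MeasurableSet.of_discrete (s := R))

lemma generateFrom_rectangleAlgebra :
    (inferInstance : MeasurableSpace (X × X)) =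
      MeasurableSpace.generateFrom (rectangleAlgebra X) := by
  apply le_antisymm
  · rw [← generateFrom_prod]
    refine MeasurableSpace.generateFrom_mono ?_
    rintro _ ⟨S, hS, B, hB, rfl⟩
    exact prod_mem_rectangleAlgebra hS hB
  · exact MeasurableSpace.generateFrom_le fun T hT => measurableSet_of_mem_rectangleAlgebra hT

/-- An integrable function on a product whose integrals over measurable rectangles are
nonnegative is nonnegative almost everywhere: finite unions of rectangles are dense for the finite
measure with density `|H|`. -/
theorem ae_nonneg_of_setIntegral_prod_nonneg {ν : Measure (X × X)} {H : X × X → ℂ}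
    (hH : Integrable H ν)
    (h : ∀ S B : Set X, MeasurableSet S → MeasurableSet B → 0 ≤ ∫ p in S ×ˢ B, H p ∂ν) :
    ∀ᵐ p ∂ν, 0 ≤ H p := by
  have h1 : ∀ T ∈ rectangleAlgebra X, 0 ≤ ∫ p in T, H p ∂ν := by
    classical
    rintro _ ⟨φ, R, rfl⟩
    have hT : {p : X × X | (φ p.1, φ p.2) ∈ R} =
        ⋃ q ∈ (φ.range ×ˢ φ.range).filter (· ∈ R), (φ ⁻¹' {q.1}) ×ˢ (φ ⁻¹' {q.2}) := by
      ext p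
      simp only [Set.mem_ofPred_eq, Set.mem_iUnion, Finset.mem_filter, Finset.mem_product,
        Set.mem_prod, Set.mem_preimage, Set.mem_singleton_iff, exists_prop]
      constructor
      · intro hp
        exact ⟨(φ p.1, φ p.2), ⟨⟨φ.mem_range_self _, φ.mem_range_self _⟩, hp⟩, rfl, rfl⟩
      · rintro ⟨⟨a, b⟩, ⟨-, h1⟩, h2, h3⟩
        simp only at h2 h3
        rwa [h2, h3]
    rw [hT, integral_biUnion_finset]
    · exact Finset.sum_nonneg fun q _ => h _ _ (φ.measurableSet_fiber _) (φ.measurableSet_fiber _)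
    · exact fun q _ => (φ.measurableSet_fiber _).prod (φ.measurableSet_fiber _)
    · intro q _ q' _ hq
      rw [Function.onFun, Set.disjoint_left]
      rintro p ⟨h1, h2⟩ ⟨h3, h4⟩
      simp only [Set.mem_preimage, Set.mem_singleton_iff] at h1 h2 h3 h4
      exact hq (Prod.ext (h1.symm.trans h3) (h2.symm.trans h4))
    · exact fun q _ => hH.integrableOn
  let κ : Measure (X × X) := ν.withDensity fun p => ‖H p‖ₑ
  have : IsFiniteMeasure κ := isFiniteMeasure_withDensity hH.2.ne
  have hd : κ.MeasureDense (rectangleAlgebra X) :=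
    Measure.MeasureDense.of_generateFrom_isSetAlgebra_finite κ isSetAlgebra_rectangleAlgebra
      generateFrom_rectangleAlgebra
  have h2 : ∀ T : Set (X × X), MeasurableSet T → 0 ≤ ∫ p in T, H p ∂ν := by
    intro T hT
    have hcl : IsClosed {z : ℂ | 0 ≤ z} := isClosed_Ici
    change _ ∈ {z : ℂ | 0 ≤ z}
    rw [← hcl.closure_eq, Metric.mem_closure_iff]
    intro ε hε
    obtain ⟨T', hT', hlt⟩ := hd.approx T hT (measure_ne_top _ _) ε hε
    have hT'm := measurableSet_of_mem_rectangleAlgebra hT'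
    refine ⟨_, h1 T' hT', ?_⟩
    rw [dist_eq_norm, ← integral_indicator hT, ← integral_indicator hT'm,
      ← integral_sub (hH.indicator hT) (hH.indicator hT'm)]
    refine (ENNReal.ofReal_lt_ofReal_iff hε).1 (lt_of_le_of_lt ?_ hlt)
    rw [ofReal_norm]
    refine (enorm_integral_le_lintegral_enorm _).trans ?_
    have hm : MeasurableSet (symmDiff T T') := hT.symmDiff hT'm
    rw [withDensity_apply _ hm, ← lintegral_indicator hm]
    refine lintegral_mono fun p => ?_
    by_cases hp : p ∈ T <;> by_cases hp' : p ∈ T' <;>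
      simp [hp, hp', Set.indicator, Set.mem_symmDiff]
  have h3 : ∀ᵐ p ∂ν, 0 ≤ (H p).re := by
    refine ae_nonneg_of_forall_setIntegral_nonneg hH.re fun T hT _ => ?_
    have := integral_re (𝕜 := ℂ) (hH.integrableOn (s := T))
    simp only [RCLike.re_to_complex] at this ⊢
    rw [this]
    exact (Complex.nonneg_iff.1 (h2 T hT)).1
  have h4 : (fun p => (H p).im) =ᵐ[ν] 0 := by
    refine Integrable.ae_eq_zero_of_forall_setIntegral_eq_zero hH.im fun T hT _ => ?_
    have := integral_im (𝕜 := ℂ) (hH.integrableOn (s := T))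
    simp only [RCLike.im_to_complex] at this ⊢
    rw [this]
    exact (Complex.nonneg_iff.1 (h2 T hT)).2.symm
  filter_upwards [h3, h4] with p h5 h6
  exact Complex.nonneg_iff.2 ⟨h5, h6.symm⟩

end Rectangles

namespace BanachFunctionSpace

/-! ### Positive kernel operators and their kernels -/

section Kernel

variable {X : Type*} [MeasurableSpace X] {μ : Measure X}
  {E : Type*} [NormedAddCommGroup E] [NormedSpace ℂ E] [CompleteSpace E]
  {L : BanachFunctionSpace μ E}

lemma HasKernel.congr [SigmaFinite μ] {A : E →L[ℂ] E} {a b : X × X → ℂ} (h : L.HasKernel A a)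
    (hab : a =ᵐ[μ.prod μ] b) : L.HasKernel A b := by
  refine ⟨h.1.congr hab, fun f => ?_⟩
  filter_upwards [h.2 f, Measure.ae_ae_of_ae_prod hab] with x hx hy
  have h1 : (fun y => a (x, y) * L.ι f y) =ᵐ[μ] fun y => b (x, y) * L.ι f y := by
    filter_upwards [hy] with y h2
    rw [h2]
  exact ⟨hx.1.congr h1, by rw [hx.2, integral_congr_ae h1]⟩

lemma HasKernel.add {A B : E →L[ℂ] E} {a b : X × X → ℂ} (hA : L.HasKernel A a)
    (hB : L.HasKernel B b) : L.HasKernel (A + B) (a + b) := by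
  refine ⟨hA.1.add hB.1, fun f => ?_⟩
  filter_upwards [hA.2 f, hB.2 f, L.ι_add (A f) (B f)] with x h1 h2 h3
  simp only [Pi.add_apply, add_mul]
  refine ⟨h1.1.add h2.1, ?_⟩
  rw [integral_add h1.1 h2.1, ← h1.2, ← h2.2, ← h3]
  rfl

lemma HasKernel.smul {A : E →L[ℂ] E} {a : X × X → ℂ} (hA : L.HasKernel A a) (c : ℂ) :
    L.HasKernel (c • A) (fun p => c * a p) := by
  refine ⟨hA.1.const_mul c, fun f => ?_⟩
  filter_upwards [hA.2 f, L.ι_smul c (A f)] with x h1 h3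
  simp only [mul_assoc]
  refine ⟨h1.1.const_mul c, ?_⟩
  rw [integral_const_mul, ← h1.2, ← h3]
  rfl

lemma HasKernel.zero : L.HasKernel (0 : E →L[ℂ] E) (fun _ => 0) := by
  refine ⟨aemeasurable_const, fun f => ?_⟩
  filter_upwards [L.ι_zero] with x h
  refine ⟨by simp, ?_⟩
  rw [show (0 : E →L[ℂ] E) f = 0 from rfl, h]
  simp

lemma HasKernel.sum {κ : Type*} (s : Finset κ) {A : κ → (E →L[ℂ] E)} {a : κ → X × X → ℂ}
    (h : ∀ i ∈ s, L.HasKernel (A i) (a i)) :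
    L.HasKernel (∑ i ∈ s, A i) (fun p => ∑ i ∈ s, a i p) := by
  classical
  induction s using Finset.induction_on with
  | empty => simpa using HasKernel.zero
  | insert i s hi ih =>
    simp only [Finset.sum_insert hi]
    exact (h i (by simp)).add (ih fun j hj => h j (by simp [hj]))

/-- A kernel determines its operator. -/
lemma HasKernel.unique {A B : E →L[ℂ] E} {a : X × X → ℂ} (hA : L.HasKernel A a)
    (hB : L.HasKernel B a) : A = B := by
  ext f
  refine L.ext_ae ?_
  filter_upwards [hA.2 f, hB.2 f] with x h1 h2
  rw [h1.2, h2.2]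

/-- The kernel of a positive operator is nonnegative almost everywhere. The integrals of
`b(x, y) u(y)`, with `u` a weak unit, over rectangles `S × B` are the integrals over `S` of
`A(χ_B u) ≥ 0`; a weight in `x` makes this function integrable on the product. -/
theorem HasKernel.ae_nonneg [SigmaFinite μ] {A : E →L[ℂ] E} {b : X × X → ℂ}
    (hA : L.HasKernel A b) (hpos : ∀ f : E, 0 ≤ L.ι f → 0 ≤ L.ι (A f)) :
    ∀ᵐ p ∂μ.prod μ, 0 ≤ b p := by
  wlog hb : Measurable b generalizing b
  · have h1 := this (hA.congr hA.1.ae_eq_mk) hA.1.measurable_mk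
    filter_upwards [h1, hA.1.ae_eq_mk] with p h2 h3
    rwa [h3]
  obtain ⟨u, hu⟩ := L.exists_weakUnit
  have hUm : Measurable (L.ι u) := (L.ι u).measurable
  obtain ⟨p, hp0, hpm, hpi⟩ := exists_pos_lintegral_lt_of_sigmaFinite μ (ε := 1) one_ne_zero
  let G : X × X → ℂ := fun q => b q * L.ι u q.2
  have hG : Measurable G := hb.mul (hUm.comp measurable_snd)
  let F : X → ℝ≥0∞ := fun x => ∫⁻ y, ‖G (x, y)‖ₑ ∂μ
  have hF : Measurable F := hG.enorm.lintegral_prod_right'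
  have hFfin : ∀ᵐ x ∂μ, F x < ∞ := by
    filter_upwards [hA.2 u] with x hx using hx.1.2
  let θ : X → ℝ≥0∞ := fun x => p x / (1 + F x)
  have hθm : Measurable θ := hpm.coe_nnreal_ennreal.div (measurable_const.add hF)
  have hθle : ∀ x, θ x ≤ p x := fun x =>
    ENNReal.div_le_of_le_mul (le_mul_of_one_le_right' le_self_add)
  have hθtop : ∀ x, θ x ≠ ∞ := fun x => ne_top_of_le_ne_top ENNReal.coe_ne_top (hθle x)
  have hθF : ∀ x, θ x * F x ≤ p x := fun x => by
    refine (mul_le_mul_right (le_add_self (a := F x) (b := 1)) (θ x)).trans ?_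
    rw [mul_comm]
    exact ENNReal.mul_div_le
  let H : X × X → ℂ := fun q => ((θ q.1).toReal : ℂ) * G q
  have hHm : Measurable H :=
    (Complex.measurable_ofReal.comp (hθm.ennreal_toReal.comp measurable_fst)).mul hG
  have hHi : Integrable H (μ.prod μ) := by
    refine ⟨hHm.aestronglyMeasurable, ?_⟩
    rw [HasFiniteIntegral, lintegral_prod _ hHm.enorm.aemeasurable]
    refine lt_of_le_of_lt (lintegral_mono fun x => ?_) (hpi.trans ENNReal.one_lt_top)
    refine le_trans (le_of_eq ?_) (hθF x)
    rw [← lintegral_const_mul' _ _ (hθtop x)]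
    refine lintegral_congr fun y => ?_
    simp only [H, enorm_mul]
    congr 1
    rw [← ofReal_norm, Complex.norm_real, Real.norm_of_nonneg ENNReal.toReal_nonneg,
      ENNReal.ofReal_toReal (hθtop x)]
  have hHpos : ∀ᵐ q ∂μ.prod μ, 0 ≤ H q := by
    refine ae_nonneg_of_setIntegral_prod_nonneg hHi fun S B hS hB => ?_
    rw [setIntegral_prod _ hHi.integrableOn]
    obtain ⟨v, hv, -⟩ := L.exists_of_norm_le u (g := B.indicator (L.ι u))
      ((L.aesm u).indicator hB) (Eventually.of_forall fun x => norm_indicator_le_norm_self _ _)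
    have hv0 : 0 ≤ L.ι v := by
      rw [nonneg_iff]
      filter_upwards [hv, hu] with x h1 h2
      rw [h1]
      by_cases hx : x ∈ B <;> simp [hx, h2.le]
    refine integral_nonneg_of_ae (ae_restrict_of_ae ?_)
    filter_upwards [hA.2 v, (L.nonneg_iff _).1 (hpos v hv0)] with x h1 h2
    rw [h1.2] at h2
    have h3 : ∫ y in B, H (x, y) ∂μ = ((θ x).toReal : ℂ) * ∫ y, b (x, y) * L.ι v y ∂μ := by
      rw [← integral_indicator hB, ← integral_const_mul]
      refine integral_congr_ae ?_
      filter_upwards [hv] with y hy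
      rw [hy]
      by_cases hx : y ∈ B <;> simp [hx, H, G]
    simp only [Pi.zero_apply]
    rw [h3]
    exact mul_nonneg (by exact_mod_cast ENNReal.toReal_nonneg) h2
  have h1 : ∀ᵐ q ∂μ.prod μ, F q.1 < ∞ := Measure.quasiMeasurePreserving_fst.ae hFfin
  have h2 : ∀ᵐ q ∂μ.prod μ, 0 < L.ι u q.2 := Measure.quasiMeasurePreserving_snd.ae hu
  filter_upwards [hHpos, h1, h2] with q h3 h4 h5
  have h6 : 0 < (θ q.1).toReal := by
    refine ENNReal.toReal_pos ?_ (hθtop _)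
    refine (ENNReal.div_pos ?_ ?_).ne'
    · exact_mod_cast (hp0 _).ne'
    · exact (ENNReal.add_lt_top.2 ⟨ENNReal.one_lt_top, h4⟩).ne
  have h7 : 0 < ((θ q.1).toReal : ℂ) * L.ι u q.2 := mul_pos (by exact_mod_cast h6) h5
  have h8 : b q = H q * (((θ q.1).toReal : ℂ) * L.ι u q.2)⁻¹ := by
    simp only [H, G]
    have := h7.ne'
    rw [mul_ne_zero_iff] at this
    field_simp [this.1, this.2]
  rw [h8]
  exact mul_nonneg h3 (by
    rw [eq_norm_of_nonneg h7.le, ← Complex.ofReal_inv]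
    exact_mod_cast inv_nonneg.2 (norm_nonneg _))

/-- The operator determines its kernel up to a null set. -/
theorem HasKernel.ae_eq [SigmaFinite μ] {A : E →L[ℂ] E} {a b : X × X → ℂ}
    (ha : L.HasKernel A a) (hb : L.HasKernel A b) : a =ᵐ[μ.prod μ] b := by
  have key : ∀ {a b : X × X → ℂ}, L.HasKernel A a → L.HasKernel A b →
      ∀ᵐ p ∂μ.prod μ, 0 ≤ a p - b p := by
    intro a b ha hb
    have h1 := ha.add (hb.smul (-1))
    have h2 : A + (-1 : ℂ) • A = 0 := by simp
    rw [h2] at h1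
    filter_upwards [h1.ae_nonneg fun f _ => by
      rw [nonneg_iff]
      filter_upwards [L.ι_zero] with x hx
      rw [show (0 : E →L[ℂ] E) f = 0 from rfl, hx]] with p hp
    simpa [sub_eq_add_neg] using hp
  filter_upwards [key ha hb, key hb ha] with p h1 h2
  exact le_antisymm (sub_nonneg.1 h2) (sub_nonneg.1 h1)

/-- A positive kernel operator has a measurable kernel with values in `[0, ∞)`. -/
theorem IsPositiveKernelOperator.exists_kernel [SigmaFinite μ] {A : E →L[ℂ] E}
    (hA : L.IsPositiveKernelOperator A) :
    ∃ a : X × X → ℝ, Measurable a ∧ (∀ p, 0 ≤ a p) ∧ L.HasKernel A (fun p => (a p : ℂ)) := by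
  obtain ⟨hpos, b, hb⟩ := hA
  refine ⟨fun p => ‖hb.1.mk b p‖, hb.1.measurable_mk.norm, fun p => norm_nonneg _,
    hb.congr ?_⟩
  filter_upwards [hb.ae_nonneg hpos, hb.1.ae_eq_mk] with p h1 h2
  rw [← h2]
  exact eq_norm_of_nonneg h1

lemma HasKernel.pos {A : E →L[ℂ] E} {a : X × X → ℝ} (ha0 : ∀ p, 0 ≤ a p)
    (ha : L.HasKernel A (fun p => (a p : ℂ))) : ∀ f : E, 0 ≤ L.ι f → 0 ≤ L.ι (A f) := by
  intro f hf
  rw [nonneg_iff] at hf ⊢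
  filter_upwards [ha.2 f] with x hx
  rw [hx.2]
  refine integral_nonneg_of_ae ?_
  filter_upwards [hf] with y hy
  exact mul_nonneg (by exact_mod_cast ha0 _) hy

lemma HasKernel.isPositiveKernelOperator {A : E →L[ℂ] E} {a : X × X → ℝ} (ha0 : ∀ p, 0 ≤ a p)
    (ha : L.HasKernel A (fun p => (a p : ℂ))) : L.IsPositiveKernelOperator A :=
  ⟨ha.pos ha0, _, ha⟩

/-- `A f = ∫ a(x, y) f(y) dy` in `[0, ∞]`, if `A` has the kernel `a ≥ 0` and `f ≥ 0`. -/
lemma HasKernel.lintegral_eq {A : E →L[ℂ] E} {a : X × X → ℝ} (ha0 : ∀ p, 0 ≤ a p)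
    (ha : L.HasKernel A (fun p => (a p : ℂ))) {f : E} (hf : 0 ≤ L.ι f) :
    ∀ᵐ x ∂μ, ∫⁻ y, ENNReal.ofReal (a (x, y) * ‖L.ι f y‖) ∂μ = ‖L.ι (A f) x‖ₑ := by
  filter_upwards [ha.2 f] with x hx
  have h1 : (fun y => (a (x, y) : ℂ) * L.ι f y) =ᵐ[μ]
      fun y => ((a (x, y) * ‖L.ι f y‖ : ℝ) : ℂ) := by
    filter_upwards [L.ae_eq_norm hf] with y hy
    push_cast
    rw [← hy]
  have h2 : Integrable (fun y => a (x, y) * ‖L.ι f y‖) μ := by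
    refine (hx.1.norm).congr ?_
    filter_upwards with y
    rw [norm_mul, Complex.norm_real, Real.norm_of_nonneg (ha0 _)]
  rw [hx.2, integral_congr_ae h1, integral_complex_ofReal, ← ofReal_norm, Complex.norm_real,
    Real.norm_of_nonneg (integral_nonneg fun y => mul_nonneg (ha0 _) (norm_nonneg _)),
    ofReal_integral_eq_lintegral_ofReal h2
      (Eventually.of_forall fun y => mul_nonneg (ha0 _) (norm_nonneg _))]

/-- `|∫ c(x, y) f(y) dy| ≤ (A |f|)(x)`, if `A` has the kernel `a` and `|c| ≤ a`. -/
lemma HasKernel.norm_apply_le {A : E →L[ℂ] E} {a : X × X → ℝ} {c : X × X → ℂ}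
    (ha0 : ∀ p, 0 ≤ a p)
    (ha : L.HasKernel A (fun p => (a p : ℂ))) {f : E} :
    ∀ᵐ x ∂μ, (∀ᵐ y ∂μ, ‖c (x, y)‖ ≤ a (x, y)) →
      ‖∫ y, c (x, y) * L.ι f y ∂μ‖ₑ ≤ ‖L.ι (A (L.abs f)) x‖ₑ := by
  filter_upwards [ha.lintegral_eq ha0 (L.abs_nonneg f)] with x hx hc
  rw [← hx]
  refine (enorm_integral_le_lintegral_enorm _).trans (lintegral_mono_ae ?_)
  filter_upwards [hc, L.ι_abs f] with y h1 h2
  rw [h2, ← ofReal_norm, norm_mul, Complex.norm_real, norm_norm]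
  gcongr

/-- A kernel that is dominated by the kernel of a positive operator `A` defines an operator on
all of `L`. -/
theorem exists_hasKernel_of_norm_le [SigmaFinite μ] {A : E →L[ℂ] E} {a : X × X → ℝ}
    (ha0 : ∀ p, 0 ≤ a p) (ha : L.HasKernel A (fun p => (a p : ℂ))) {c : X × X → ℂ}
    (hc : AEMeasurable c (μ.prod μ)) (hca : ∀ᵐ p ∂μ.prod μ, ‖c p‖ ≤ a p) :
    ∃ C : E →L[ℂ] E, L.HasKernel C c := by
  have hca' := Measure.ae_ae_of_ae_prod hca
  have hcm : ∀ f : E, AEStronglyMeasurable (fun p : X × X => c p * L.ι f p.2) (μ.prod μ) :=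
    fun f => (hc.mul ((L.ι f).measurable.comp measurable_snd).aemeasurable).aestronglyMeasurable
  have hint : ∀ f : E, ∀ᵐ x ∂μ, Integrable (fun y => c (x, y) * L.ι f y) μ := fun f => by
    filter_upwards [ha.2 f, hca', (hcm f).prodMk_left] with x h1 h2 h3
    refine h1.1.mono h3 ?_
    filter_upwards [h2] with y h4
    rw [norm_mul, norm_mul]
    gcongr
    exact h4.trans (by simp [le_abs_self])
  have hex : ∀ f : E, ∃ k : E, (∀ᵐ x ∂μ, L.ι k x = ∫ y, c (x, y) * L.ι f y ∂μ) ∧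
      ‖k‖ ≤ ‖A (L.abs f)‖ := fun f => by
    refine L.exists_of_norm_le _ (hcm f).integral_prod_right' ?_
    filter_upwards [ha.norm_apply_le (c := c) (f := f) ha0, hca'] with x h1 h2
    exact enorm_le_iff_norm_le.1 (h1 h2)
  choose T hT hTn using hex
  let C : E →ₗ[ℂ] E :=
    { toFun := T
      map_add' := fun f g => by
        refine L.ext_ae ?_
        filter_upwards [hT (f + g), hT f, hT g, hint f, hint g, L.ι_add (T f) (T g)]
          with x h1 h2 h3 h4 h5 h6
        rw [h1, h6, h2, h3, ← integral_add h4 h5]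
        refine integral_congr_ae ?_
        filter_upwards [L.ι_add f g] with y hy
        rw [hy, mul_add]
      map_smul' := fun z f => by
        refine L.ext_ae ?_
        filter_upwards [hT (z • f), hT f, L.ι_smul z (T f)] with x h1 h2 h3
        rw [h1, RingHom.id_apply, h3, h2, ← integral_const_mul]
        refine integral_congr_ae ?_
        filter_upwards [L.ι_smul z f] with y hy
        rw [hy]; ring }
  refine ⟨C.mkContinuous ‖A‖ fun f => ?_, hc, fun f => ?_⟩
  · calc ‖T f‖ ≤ ‖A (L.abs f)‖ := hTn f
      _ ≤ ‖A‖ * ‖L.abs f‖ := A.le_opNorm _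
      _ = ‖A‖ * ‖f‖ := by rw [norm_abs]
  · filter_upwards [hint f, hT f] with x h1 h2
    exact ⟨h1, h2⟩

/-- The product of two operators with nonnegative kernels `a`, `b` has the kernel
`∫ a(x, z) b(z, y) dz`, by Fubini's theorem. -/
theorem HasKernel.mul [SigmaFinite μ] {A B : E →L[ℂ] E} {a b : X × X → ℝ}
    (ham : Measurable a) (hbm : Measurable b) (ha0 : ∀ p, 0 ≤ a p) (hb0 : ∀ p, 0 ≤ b p)
    (ha : L.HasKernel A (fun p => (a p : ℂ))) (hb : L.HasKernel B (fun p => (b p : ℂ))) :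
    L.HasKernel (A * B) (fun p => ((∫ z, a (p.1, z) * b (z, p.2) ∂μ : ℝ) : ℂ)) := by
  have hm : Measurable fun q : (X × X) × X => a (q.1.1, q.2) * b (q.2, q.1.2) :=
    (ham.comp (measurable_fst.fst.prodMk measurable_snd)).mul
      (hbm.comp (measurable_snd.prodMk measurable_fst.snd))
  refine ⟨(Complex.measurable_ofReal.comp
    hm.stronglyMeasurable.integral_prod_right'.measurable).aemeasurable, fun f => ?_⟩
  filter_upwards [ha.2 (B f), ha.lintegral_eq ha0 (hb.pos hb0 _ (L.abs_nonneg f))] with x h1 h2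
  let K : X → X → ℂ := fun z y => (a (x, z) : ℂ) * ((b (z, y) : ℂ) * L.ι f y)
  have hKm : Measurable (Function.uncurry K) :=
    (Complex.measurable_ofReal.comp (ham.comp (measurable_const.prodMk measurable_fst))).mul
      ((Complex.measurable_ofReal.comp hbm).mul ((L.ι f).measurable.comp measurable_snd))
  have hKi : Integrable (Function.uncurry K) (μ.prod μ) := by
    refine ⟨hKm.aestronglyMeasurable, ?_⟩
    rw [HasFiniteIntegral, lintegral_prod _ hKm.enorm.aemeasurable]
    refine lt_of_le_of_lt (le_of_eq ?_) (h2.le.trans_lt enorm_lt_top)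
    refine lintegral_congr_ae ?_
    filter_upwards [hb.lintegral_eq hb0 (L.abs_nonneg f)] with z hz
    rw [ENNReal.ofReal_mul (ha0 _), ofReal_norm, ← hz, ← lintegral_const_mul'
      _ _ ENNReal.ofReal_ne_top]
    refine lintegral_congr_ae ?_
    filter_upwards [L.ι_abs f] with y hy
    rw [hy, ← ENNReal.ofReal_mul (ha0 _), ← ofReal_norm]
    simp [Function.uncurry, K, abs_of_nonneg (ha0 _), abs_of_nonneg (hb0 _)]
  have hin : ∀ y, ∫ z, K z y ∂μ = ((∫ z, a (x, z) * b (z, y) ∂μ : ℝ) : ℂ) * L.ι f y := by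
    intro y
    rw [← integral_complex_ofReal, ← integral_mul_const]
    refine integral_congr_ae (Eventually.of_forall fun z => ?_)
    simp only [K]; push_cast; ring
  have hout : ∫ z, ∫ y, K z y ∂μ ∂μ = L.ι ((A * B) f) x := by
    rw [mul_apply_eq_comp, h1.2]
    refine integral_congr_ae ?_
    filter_upwards [hb.2 f] with z hz
    rw [hz.2, ← integral_const_mul]
  simp only [← hin]
  exact ⟨hKi.integral_prod_right, by rw [← hout, integral_integral_swap hKi]⟩

theorem IsPositiveKernelOperator.mul [SigmaFinite μ] {A B : E →L[ℂ] E}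
    (hA : L.IsPositiveKernelOperator A) (hB : L.IsPositiveKernelOperator B) :
    L.IsPositiveKernelOperator (A * B) := by
  obtain ⟨a, ham, ha0, ha⟩ := hA.exists_kernel
  obtain ⟨b, hbm, hb0, hb⟩ := hB.exists_kernel
  exact HasKernel.isPositiveKernelOperator
    (fun p => integral_nonneg fun z => mul_nonneg (ha0 _) (hb0 _))
    (HasKernel.mul ham hbm ha0 hb0 ha hb)

lemma isPositiveKernelOperator_of_mem_pow [SigmaFinite μ] {Ψ : Set (E →L[ℂ] E)}
    (h : ∀ A ∈ Ψ, L.IsPositiveKernelOperator A) (n : ℕ) :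
    ∀ A ∈ Ψ ^ (n + 1), L.IsPositiveKernelOperator A := by
  induction n with
  | zero => simpa using h
  | succ n ih =>
    intro A hA
    rw [pow_succ] at hA
    obtain ⟨B, hB, C, hC, rfl⟩ := hA
    exact (ih B hB).mul (h C hC)

end Kernel

end BanachFunctionSpace

/-! ### Hölder's inequality -/

section Holder

variable {X : Type*} [MeasurableSpace X]

/-- Hölder's inequality `∫ ∏ vⱼ ^ αⱼ ≤ ∏ (∫ vⱼ) ^ αⱼ` holds for the measure `μ` and the exponents
`αⱼ ≥ 0`. This is the case if `∑ αⱼ = 1`, and for counting measures also if `∑ αⱼ ≥ 1`. -/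
def HolderExponents (μ : Measure X) {m : ℕ} (α : Fin m → ℝ) : Prop :=
  ∀ v : Fin m → X → ℝ≥0∞, (∀ j, AEMeasurable (v j) μ) →
    ∫⁻ x, ∏ j, v j x ^ α j ∂μ ≤ ∏ j, (∫⁻ x, v j x ∂μ) ^ α j

lemma holderExponents_of_sum_eq_one (μ : Measure X) {m : ℕ} {α : Fin m → ℝ} (h0 : ∀ j, 0 ≤ α j)
    (h1 : ∑ j, α j = 1) : HolderExponents μ α := fun _ hv =>
  ENNReal.lintegral_prod_norm_pow_le Finset.univ (fun j _ => hv j) h1 (fun j _ => h0 j)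

lemma holderExponents_count [Countable X] [MeasurableSingletonClass X] {m : ℕ} {α : Fin m → ℝ}
    (h0 : ∀ j, 0 ≤ α j) (h1 : 1 ≤ ∑ j, α j) :
    HolderExponents (Measure.count : Measure X) α := by
  intro v _
  have hs : 0 < ∑ j, α j := by linarith
  set s := ∑ j, α j with hsdef
  let p : Fin m → ℝ := fun j => α j / s
  have hp0 : ∀ j, 0 ≤ p j := fun j => div_nonneg (h0 j) hs.le
  have hpα : ∀ j, 0 ≤ α j - p j := fun j => sub_nonneg.2 (div_le_self (h0 j) h1)
  have hp1 : ∑ j, p j = 1 := by rw [← Finset.sum_div, div_self hs.ne']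
  have hsplit : ∀ (t : ℝ≥0∞) j, t ^ α j = t ^ p j * t ^ (α j - p j) := fun t j => by
    rw [← ENNReal.rpow_add_of_nonneg _ _ (hp0 j) (hpα j)]
    congr 1
    ring
  have hle : ∀ j x, v j x ≤ ∫⁻ x, v j x ∂Measure.count := fun j x => by
    rw [lintegral_count]
    exact ENNReal.le_tsum x
  calc ∫⁻ x, ∏ j, v j x ^ α j ∂Measure.count
      ≤ ∫⁻ x, (∏ j, v j x ^ p j) * ∏ j, (∫⁻ x, v j x ∂Measure.count) ^ (α j - p j)
          ∂Measure.count := by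
        refine lintegral_mono fun x => ?_
        simp only [hsplit]
        rw [Finset.prod_mul_distrib]
        gcongr with j
        · exact hpα j
        · exact hle j x
    _ = (∫⁻ x, (∏ j, v j x ^ p j) ∂Measure.count) *
          ∏ j, (∫⁻ x, v j x ∂Measure.count) ^ (α j - p j) :=
        lintegral_mul_const _ Measurable.of_discrete
    _ ≤ (∏ j, (∫⁻ x, v j x ∂Measure.count) ^ p j) *
          ∏ j, (∫⁻ x, v j x ∂Measure.count) ^ (α j - p j) := by
        gcongr
        exact holderExponents_of_sum_eq_one _ hp0 hp1 v fun j => Measurable.of_discrete.aemeasurable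
    _ = ∏ j, (∫⁻ x, v j x ∂Measure.count) ^ α j := by
        rw [← Finset.prod_mul_distrib]
        exact Finset.prod_congr rfl fun j _ => (hsplit _ _).symm

end Holder

namespace BanachFunctionSpace

/-! ### Operators dominated by a weighted geometric mean -/

section Dominated

variable {X : Type*} [MeasurableSpace X] {μ : Measure X}
  {E : Type*} [NormedAddCommGroup E] [NormedSpace ℂ E] [CompleteSpace E]
  {L : BanachFunctionSpace μ E}

/-- The operator `C` is dominated by the weighted geometric mean of the positive operators `Aⱼ`:
`|g| ≤ ∏ fⱼ ^ αⱼ` with `fⱼ ≥ 0` implies `|C g| ≤ ∏ (Aⱼ fⱼ) ^ αⱼ`. Unlike the pointwise inequality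
of kernels that it comes from, this relation is visibly stable under products. -/
structure GeomDominated (L : BanachFunctionSpace μ E) {m : ℕ} (α : Fin m → ℝ)
    (A : Fin m → (E →L[ℂ] E)) (C : E →L[ℂ] E) : Prop where
  pos : ∀ j f, 0 ≤ L.ι f → 0 ≤ L.ι (A j f)
  le : ∀ (g : E) (f : Fin m → E), (∀ j, 0 ≤ L.ι (f j)) →
    (∀ᵐ x ∂μ, ‖L.ι g x‖ ≤ ∏ j, ‖L.ι (f j) x‖ ^ α j) →
    ∀ᵐ x ∂μ, ‖L.ι (C g) x‖ ≤ ∏ j, ‖L.ι (A j (f j)) x‖ ^ α j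

variable {m : ℕ} {α : Fin m → ℝ}

lemma GeomDominated.mul {A B : Fin m → (E →L[ℂ] E)} {C D : E →L[ℂ] E}
    (h : L.GeomDominated α A C) (h' : L.GeomDominated α B D) :
    L.GeomDominated α (fun j => A j * B j) (C * D) where
  pos j f hf := h.pos j _ (h'.pos j f hf)
  le g f hf hg := h.le (D g) (fun j => B j (f j)) (fun j => h'.pos j _ (hf j)) (h'.le g f hf hg)

lemma GeomDominated.one : L.GeomDominated α (fun _ => 1) 1 where
  pos _ _ hf := hf
  le _ _ _ hg := hg

lemma GeomDominated.pow {A : Fin m → (E →L[ℂ] E)} {C : E →L[ℂ] E}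
    (h : L.GeomDominated α A C) (n : ℕ) : L.GeomDominated α (fun j => A j ^ n) (C ^ n) := by
  induction n with
  | zero => simpa using GeomDominated.one
  | succ n ih => simpa [pow_succ] using ih.mul h

lemma exists_geomDominated_of_mem_pow {𝒞 Ψ : Set (E →L[ℂ] E)}
    (h : ∀ C ∈ 𝒞, ∃ A : Fin m → (E →L[ℂ] E), (∀ j, A j ∈ Ψ) ∧ L.GeomDominated α A C) (n : ℕ) :
    ∀ C ∈ 𝒞 ^ n, ∃ A : Fin m → (E →L[ℂ] E), (∀ j, A j ∈ Ψ ^ n) ∧ L.GeomDominated α A C := by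
  induction n with
  | zero =>
    intro C hC
    obtain rfl : C = 1 := by simpa using hC
    exact ⟨fun _ => 1, by simp, GeomDominated.one⟩
  | succ n ih =>
    intro C hC
    rw [pow_succ] at hC
    obtain ⟨C₁, h1, C₂, h2, rfl⟩ := hC
    obtain ⟨A, hA, hAC⟩ := ih C₁ h1
    obtain ⟨B, hB, hBC⟩ := h C₂ h2
    exact ⟨fun j => A j * B j, fun j => by rw [pow_succ]; exact Set.mul_mem_mul (hA j) (hB j),
      hAC.mul hBC⟩

lemma aemeasurable_of_ofReal {Y : Type*} [MeasurableSpace Y] {ν : Measure Y} {a : Y → ℝ}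
    (h : AEMeasurable (fun p => (a p : ℂ)) ν) : AEMeasurable a ν := by
  exact Complex.measurable_re.comp_aemeasurable h

/-- Operators `A₁^(α₁) ∘ ⋯ ∘ A_m^(α_m)` are dominated by geometric means, by Hölder's
inequality. -/
theorem IsHadamard.geomDominated [SigmaFinite μ] (hα : ∀ j, 0 ≤ α j) (hH : HolderExponents μ α)
    {A : Fin m → (E →L[ℂ] E)} {C : E →L[ℂ] E} (h : L.IsHadamard α A C) :
    L.GeomDominated α A C := by
  obtain ⟨a, ha0, ha, hC⟩ := h
  refine ⟨fun j => (ha j).pos (ha0 j), fun g f hf hg => ?_⟩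
  have h1 : ∀ᵐ x ∂μ, ∀ j, ∫⁻ y, ENNReal.ofReal (a j (x, y) * ‖L.ι (f j) y‖) ∂μ =
      ‖L.ι (A j (f j)) x‖ₑ := ae_all_iff.2 fun j => (ha j).lintegral_eq (ha0 j) (hf j)
  have h2 : ∀ᵐ x ∂μ, ∀ j, AEMeasurable (fun y => a j (x, y)) μ := ae_all_iff.2 fun j => by
    filter_upwards [(aemeasurable_of_ofReal (ha j).1).aestronglyMeasurable.prodMk_left]
      with x hx using hx.aemeasurable
  filter_upwards [hC.2 g, h1, h2] with x h3 h4 h5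
  have h6 : ∀ j, 0 ≤ ‖L.ι (A j (f j)) x‖ ^ α j := fun j => Real.rpow_nonneg (norm_nonneg _) _
  rw [← ENNReal.ofReal_le_ofReal_iff (Finset.prod_nonneg fun j _ => h6 j), ofReal_norm, h3.2,
    ENNReal.ofReal_prod_of_nonneg fun j _ => h6 j]
  refine (enorm_integral_le_lintegral_enorm _).trans ?_
  have h7 := hH (fun j y => ENNReal.ofReal (a j (x, y) * ‖L.ι (f j) y‖))
    fun j => ((h5 j).mul (L.aesm (f j)).aemeasurable.norm).ennreal_ofReal
  simp only [h4] at h7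
  refine le_trans (lintegral_mono_ae ?_) (h7.trans (le_of_eq ?_))
  · filter_upwards [hg] with y hy
    have h8 : ∀ j, 0 ≤ a j (x, y) * ‖L.ι (f j) y‖ := fun j => mul_nonneg (ha0 _ _) (norm_nonneg _)
    simp only [ENNReal.ofReal_rpow_of_nonneg (h8 _) (hα _)]
    rw [← ENNReal.ofReal_prod_of_nonneg fun j _ => Real.rpow_nonneg (h8 j) _, ← ofReal_norm,
      norm_mul, Complex.norm_real, Real.norm_of_nonneg
        (Finset.prod_nonneg fun j _ => Real.rpow_nonneg (ha0 _ _) _)]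
    refine ENNReal.ofReal_le_ofReal ?_
    simp only [Real.mul_rpow (ha0 _ _) (norm_nonneg _)]
    rw [Finset.prod_mul_distrib]
    exact mul_le_mul_of_nonneg_left hy
      (Finset.prod_nonneg fun j _ => Real.rpow_nonneg (ha0 _ _) _)
  · refine Finset.prod_congr rfl fun j _ => ?_
    rw [← ENNReal.ofReal_rpow_of_nonneg (norm_nonneg _) (hα j), ofReal_norm]

/-- If `∑ αⱼ = 1`, the geometric mean of the `Aⱼ` is at most their arithmetic mean. -/
lemma GeomDominated.norm_apply_le (hα : ∀ j, 0 ≤ α j) (hs : ∑ j, α j = 1)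
    {A : Fin m → (E →L[ℂ] E)} {C : E →L[ℂ] E} (h : L.GeomDominated α A C) (g f : E)
    (hf : 0 ≤ L.ι f) (hgf : ∀ᵐ x ∂μ, ‖L.ι g x‖ ≤ ‖L.ι f x‖) :
    ∀ᵐ x ∂μ, ‖L.ι (C g) x‖ ≤ ‖L.ι ((∑ j, (α j : ℂ) • A j) f) x‖ := by
  have h1 := h.le g (fun _ => f) (fun _ => hf) (by
    filter_upwards [hgf] with x hx
    rwa [← Real.rpow_sum_of_nonneg (norm_nonneg _) (fun j _ => hα j), hs, Real.rpow_one])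
  have h2 : ∀ᵐ x ∂μ, ∀ j, L.ι (((α j : ℂ) • A j) f) x = (α j * ‖L.ι (A j f) x‖ : ℝ) :=
    ae_all_iff.2 fun j => by
      filter_upwards [L.ι_smul (α j) (A j f), L.ae_eq_norm (h.pos j f hf)] with x h3 h4
      change L.ι ((α j : ℂ) • A j f) x = _
      push_cast
      rw [h3, ← h4]
  filter_upwards [h1, h2, L.ι_sum Finset.univ fun j => ((α j : ℂ) • A j) f] with x h3 h4 h5
  rw [sum_apply, h5]
  simp only [h4]
  rw [← Complex.ofReal_sum, Complex.norm_real, Real.norm_of_nonneg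
    (Finset.sum_nonneg fun j _ => mul_nonneg (hα j) (norm_nonneg _))]
  exact h3.trans (Real.geom_mean_le_arith_mean_weighted _ _ _ (fun j _ => hα j) hs
    fun j _ => norm_nonneg _)

lemma norm_le_norm_ι_abs (f : E) : ∀ᵐ x ∂μ, ‖L.ι f x‖ ≤ ‖L.ι (L.abs f) x‖ := by
  filter_upwards [L.ι_abs f] with x hx
  rw [hx, Complex.norm_real, norm_norm]

lemma GeomDominated.opNorm_le (hα : ∀ j, 0 ≤ α j) (hs : ∑ j, α j = 1)
    {A : Fin m → (E →L[ℂ] E)} {C : E →L[ℂ] E} (h : L.GeomDominated α A C) {N : ℝ} (hN : 0 ≤ N)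
    (hAN : ∀ j, ‖A j‖ ≤ N) : ‖C‖ ≤ N := by
  refine C.opNorm_le_bound hN fun g => ?_
  have hB : ‖∑ j, (α j : ℂ) • A j‖ ≤ N := by
    calc ‖∑ j, (α j : ℂ) • A j‖ ≤ ∑ j, ‖(α j : ℂ) • A j‖ := norm_sum_le _ _
      _ ≤ ∑ j, α j * N := Finset.sum_le_sum fun j _ => by
          rw [norm_smul, Complex.norm_real, Real.norm_of_nonneg (hα j)]
          exact mul_le_mul_of_nonneg_left (hAN j) (hα j)
      _ = N := by rw [← Finset.sum_mul, hs, one_mul]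
  calc ‖C g‖ ≤ ‖(∑ j, (α j : ℂ) • A j) (L.abs g)‖ :=
        L.norm_le_of_ae_le (h.norm_apply_le hα hs g _ (L.abs_nonneg g) (norm_le_norm_ι_abs g))
    _ ≤ ‖∑ j, (α j : ℂ) • A j‖ * ‖L.abs g‖ := ContinuousLinearMap.le_opNorm _ _
    _ ≤ N * ‖g‖ := by rw [norm_abs]; gcongr

lemma IsHadamard.isPositiveKernelOperator {A : Fin m → (E →L[ℂ] E)} {C : E →L[ℂ] E}
    (hC : L.IsHadamard α A C) : L.IsPositiveKernelOperator C := by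
  obtain ⟨a, ha0, ha, haC⟩ := hC
  exact haC.isPositiveKernelOperator
    fun p => Finset.prod_nonneg fun j _ => Real.rpow_nonneg (ha0 _ _) _

end Dominated

/-! ### Hadamard products of positive kernel operators -/

section Hadamard

variable {X : Type*} [MeasurableSpace X] {μ : Measure X} [SigmaFinite μ]
  {E : Type*} [NormedAddCommGroup E] [NormedSpace ℂ E] [CompleteSpace E]
  {L : BanachFunctionSpace μ E} {m : ℕ} {α : Fin m → ℝ}

lemma IsHadamard.unique {A : Fin m → (E →L[ℂ] E)} {C D : E →L[ℂ] E}
    (hC : L.IsHadamard α A C) (hD : L.IsHadamard α A D) : C = D := by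
  obtain ⟨a, ha0, ha, haC⟩ := hC
  obtain ⟨b, hb0, hb, hbD⟩ := hD
  refine haC.unique (hbD.congr ?_)
  have h : ∀ᵐ p ∂μ.prod μ, ∀ j, (b j p : ℂ) = a j p :=
    ae_all_iff.2 fun j => (hb j).ae_eq (ha j)
  filter_upwards [h] with p hp
  have h1 : ∀ j, b j p = a j p := fun j => by exact_mod_cast hp j
  simp only [h1]

/-- Hadamard products are defined if the product kernels are dominated by linear combinations of
the factors. -/
lemma hadamardDefined_of_le {Ψ : Fin m → Set (E →L[ℂ] E)}
    (hΨ : ∀ j, ∀ A ∈ Ψ j, L.IsPositiveKernelOperator A)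
    (h : ∀ (A : Fin m → (E →L[ℂ] E)) (a : Fin m → X × X → ℝ), (∀ j, A j ∈ Ψ j) →
      (∀ j p, 0 ≤ a j p) → (∀ j, L.HasKernel (A j) (fun p => (a j p : ℂ))) →
      ∃ t : Fin m → ℝ, (∀ j, 0 ≤ t j) ∧
        ∀ᵐ p ∂μ.prod μ, ∏ j, a j p ^ α j ≤ ∑ j, t j * a j p) :
    L.HadamardDefined α Ψ := by
  intro A hA
  choose a ham ha0 ha using fun j => (hΨ j (A j) (hA j)).exists_kernel
  obtain ⟨t, ht0, ht⟩ := h A a hA ha0 ha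
  have hB : L.HasKernel (∑ j, (t j : ℂ) • A j) (fun p => ((∑ j, t j * a j p : ℝ) : ℂ)) := by
    push_cast
    exact HasKernel.sum _ fun j _ => (ha j).smul (t j)
  have hcm : Measurable fun p => ((∏ j, a j p ^ α j : ℝ) : ℂ) :=
    Complex.measurable_ofReal.comp
      (Finset.measurable_fun_prod _ fun j _ => (ham j).pow_const _)
  obtain ⟨C, hC⟩ := exists_hasKernel_of_norm_le
    (fun p => Finset.sum_nonneg fun j _ => mul_nonneg (ht0 j) (ha0 j p)) hB
    hcm.aemeasurable (by
      filter_upwards [ht] with p hp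
      rwa [Complex.norm_real, Real.norm_of_nonneg
        (Finset.prod_nonneg fun j _ => Real.rpow_nonneg (ha0 _ _) _)])
  exact ⟨C, ⟨a, ha0, ha, hC⟩, fun D hD => hD.unique ⟨a, ha0, ha, hC⟩⟩

lemma hadamardDefined_of_sum_eq_one (hα : ∀ j, 0 ≤ α j) (hs : ∑ j, α j = 1)
    {Ψ : Fin m → Set (E →L[ℂ] E)} (hΨ : ∀ j, ∀ A ∈ Ψ j, L.IsPositiveKernelOperator A) :
    L.HadamardDefined α Ψ :=
  hadamardDefined_of_le hΨ fun _ _ _ ha0 _ => ⟨α, hα, Eventually.of_forall fun p =>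
    Real.geom_mean_le_arith_mean_weighted _ _ _ (fun j _ => hα j) hs fun j _ => ha0 j p⟩

/-- `A^(α₁) ∘ ⋯ ∘ A^(α_m) = A` if `∑ αⱼ = 1`. -/
lemma subset_hadamard (hα : ∀ j, 0 ≤ α j) (hs : ∑ j, α j = 1)
    {Ψ : Set (E →L[ℂ] E)} (hΨ : ∀ A ∈ Ψ, L.IsPositiveKernelOperator A) :
    Ψ ⊆ L.hadamard α (fun _ => Ψ) := by
  intro A hA
  obtain ⟨a, -, ha0, ha⟩ := (hΨ A hA).exists_kernel
  refine ⟨fun _ => A, fun _ => hA, fun _ => a, fun _ => ha0, fun _ => ha, ?_⟩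
  have h1 : ∀ p, ∏ j, a p ^ α j = a p := fun p => by
    rw [← Real.rpow_sum_of_nonneg (ha0 p) (fun j _ => hα j), hs, Real.rpow_one]
  simpa only [h1] using ha

lemma exists_geomDominated_of_mem_hadamard (hα : ∀ j, 0 ≤ α j) (hH : HolderExponents μ α)
    {Ψ : Set (E →L[ℂ] E)} :
    ∀ C ∈ L.hadamard α (fun _ => Ψ), ∃ A : Fin m → (E →L[ℂ] E),
      (∀ j, A j ∈ Ψ) ∧ L.GeomDominated α A C := by
  rintro C ⟨A, hA, hAC⟩
  exact ⟨A, hA, hAC.geomDominated hα hH⟩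

end Hadamard

end BanachFunctionSpace

/-! ### Radii of sets of operators -/

section RadiusLemmas

/-- If `u k ≤ K * t ^ (s * d k)` for all `t > ℓ` and large `k`, where `s * d k / k → τ`, then
`limsup (u k) ^ (1 / k) ≤ ℓ ^ τ`. -/
lemma limsup_rpow_le {u : ℕ → ℝ≥0∞} {ℓ K : ℝ≥0∞} {s τ : ℝ} {d : ℕ → ℕ} (hK : K ≠ ∞) (hτ : 0 < τ)
    (hd : Tendsto (fun k : ℕ => (d k * s) * (1 / (k : ℝ))) atTop (𝓝 τ))
    (h : ∀ t, ℓ < t → t ≠ ∞ → ∀ᶠ k in atTop, u k ≤ K * (t ^ d k) ^ s) :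
    limsup (fun k : ℕ => u k ^ (1 / (k : ℝ))) atTop ≤ ℓ ^ τ := by
  rcases eq_or_ne ℓ ∞ with rfl | hℓ
  · rw [ENNReal.top_rpow_of_pos hτ]; exact le_top
  have key : ∀ t, ℓ < t → t ≠ ∞ →
      limsup (fun k : ℕ => u k ^ (1 / (k : ℝ))) atTop ≤ t ^ τ := by
    intro t ht httop
    have ht0 : t ≠ 0 := (bot_le.trans_lt ht).ne'
    -- the constant is replaced by a positive one
    have hK1 : K + 1 ≠ ∞ := ENNReal.add_ne_top.2 ⟨hK, ENNReal.one_ne_top⟩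
    have hK0 : K + 1 ≠ 0 := by simp
    have hlim : Tendsto (fun k : ℕ => (K + 1) ^ (1 / (k : ℝ)) * t ^ ((d k * s) * (1 / (k : ℝ))))
        atTop (𝓝 (1 * t ^ τ)) := by
      have hr : ∀ {c : ℝ≥0∞}, c ≠ 0 → c ≠ ∞ → ∀ {f : ℕ → ℝ} {y : ℝ}, Tendsto f atTop (𝓝 y) →
          Tendsto (fun k => c ^ f k) atTop (𝓝 (c ^ y)) := by
        intro c hc0 hc f y hf
        lift c to ℝ≥0 using hc
        have hc0' : c ≠ 0 := by exact_mod_cast hc0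
        simp only [← ENNReal.coe_rpow_of_ne_zero hc0']
        exact ENNReal.tendsto_coe.2 (tendsto_const_nhds.nnrpow hf (Or.inl hc0'))
      refine ENNReal.Tendsto.mul ?_ (Or.inl one_ne_zero) (hr ht0 httop hd)
        (Or.inr ENNReal.one_ne_top)
      simpa using hr hK0 hK1 tendsto_one_div_atTop_nhds_zero_nat
    rw [one_mul] at hlim
    rw [← hlim.limsup_eq]
    refine limsup_le_limsup ?_
    filter_upwards [h t ht httop] with k hk
    calc u k ^ (1 / (k : ℝ)) ≤ ((K + 1) * (t ^ d k) ^ s) ^ (1 / (k : ℝ)) := by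
          gcongr
          exact hk.trans (by gcongr; exact le_self_add)
      _ = (K + 1) ^ (1 / (k : ℝ)) * t ^ ((d k * s) * (1 / (k : ℝ))) := by
          rw [ENNReal.mul_rpow_of_nonneg _ _ (by positivity), ← ENNReal.rpow_natCast,
            ← ENNReal.rpow_mul, ← ENNReal.rpow_mul,
            mul_assoc]
  have : (𝓝[>] ℓ).NeBot := nhdsGT_neBot_of_exists_gt ⟨∞, hℓ.lt_top⟩
  have hcont : Tendsto (fun t : ℝ≥0∞ => t ^ τ) (𝓝[>] ℓ) (𝓝 (ℓ ^ τ)) :=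
    ((ENNReal.continuous_rpow_const (y := τ)).tendsto ℓ).mono_left nhdsWithin_le_nhds
  refine ge_of_tendsto hcont ?_
  filter_upwards [Ioo_mem_nhdsGT hℓ.lt_top] with t ht
  exact key t ht.1 ht.2.ne

lemma eventually_le_pow_of_limsup_lt {v : ℕ → ℝ≥0∞} {t : ℝ≥0∞}
    (h : limsup (fun k : ℕ => v k ^ (1 / (k : ℝ))) atTop < t) : ∀ᶠ k in atTop, v k ≤ t ^ k := by
  filter_upwards [eventually_lt_of_limsup_lt h, eventually_gt_atTop 0] with k hk hk0
  have hk0' : (k : ℝ) ≠ 0 := by positivity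
  calc v k = (v k ^ (1 / (k : ℝ))) ^ k := by
        rw [← ENNReal.rpow_natCast, ← ENNReal.rpow_mul, one_div_mul_cancel hk0', ENNReal.rpow_one]
    _ ≤ t ^ k := by gcongr

variable {E : Type*} [NormedAddCommGroup E] [NormedSpace ℂ E]
  {q q' : (E →L[ℂ] E) → ℝ≥0∞} {Ψ Θ : Set (E →L[ℂ] E)}

/-- Comparison of radii, where the terms with index `k` of one sequence are controlled by those
with index `d k` of the other one. -/
lemma radiusOf_le_of_index {K : ℝ≥0∞} {s τ : ℝ} {d : ℕ → ℕ} (hK : K ≠ ∞) (hs : 0 ≤ s) (hτ : 0 < τ)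
    (hd : Tendsto (fun k : ℕ => (d k * s) * (1 / (k : ℝ))) atTop (𝓝 τ))
    (hd' : Tendsto d atTop atTop)
    (h : ∀ᶠ k in atTop, ∀ A ∈ Ψ ^ k, q A ≤ K * (⨆ B ∈ Θ ^ d k, q' B) ^ s) :
    radiusOf q Ψ ≤ radiusOf q' Θ ^ τ := by
  refine limsup_rpow_le hK hτ hd fun t ht _ => ?_
  filter_upwards [h, hd'.eventually (eventually_le_pow_of_limsup_lt ht)] with k h1 h2
  refine iSup₂_le fun A hA => (h1 A hA).trans ?_
  gcongr

lemma radiusOf_le {K : ℝ≥0∞} {s : ℝ} (hK : K ≠ ∞) (hs : 0 < s)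
    (h : ∀ k, 1 ≤ k → ∀ A ∈ Ψ ^ k, q A ≤ K * (⨆ B ∈ Θ ^ k, q' B) ^ s) :
    radiusOf q Ψ ≤ radiusOf q' Θ ^ s := by
  refine radiusOf_le_of_index (d := id) hK hs.le hs ?_ tendsto_id ?_
  · refine tendsto_const_nhds.congr' ?_
    filter_upwards [eventually_gt_atTop 0] with k hk
    have hk0' : (k : ℝ) ≠ 0 := by positivity
    simp only [id]
    field_simp
  · filter_upwards [eventually_ge_atTop 1] with k hk using h k hk

lemma radiusOf_mono (q : (E →L[ℂ] E) → ℝ≥0∞) (h : Ψ ⊆ Θ) : radiusOf q Ψ ≤ radiusOf q Θ := by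
  have := radiusOf_le (q := q) (q' := q) (Ψ := Ψ) (Θ := Θ) (K := 1) (s := 1) ENNReal.one_ne_top
    one_pos fun k _ A hA => by
      rw [ENNReal.rpow_one, one_mul]
      exact le_iSup₂ (f := fun B _ => q B) A (Set.pow_subset_pow_left h hA)
  rwa [ENNReal.rpow_one] at this

/-- `r(Ψ^n) ≤ r(Ψ)^n`. -/
lemma radiusOf_pow_le (q : (E →L[ℂ] E) → ℝ≥0∞) (Ψ : Set (E →L[ℂ] E)) {n : ℕ} (hn : 1 ≤ n) :
    radiusOf q (Ψ ^ n) ≤ radiusOf q Ψ ^ (n : ℝ) := by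
  refine radiusOf_le_of_index (d := fun k => n * k) (K := 1) (s := 1) ENNReal.one_ne_top
    zero_le_one (by exact_mod_cast hn) ?_ (tendsto_id.const_mul_atTop' (by omega)) ?_
  · refine tendsto_const_nhds.congr' ?_
    filter_upwards [eventually_gt_atTop 0] with k hk
    have hk0' : (k : ℝ) ≠ 0 := by positivity
    push_cast
    field_simp
  · refine Eventually.of_forall fun k A hA => ?_
    rw [← pow_mul] at hA
    rw [ENNReal.rpow_one, one_mul]
    exact le_iSup₂ (f := fun B _ => q B) A hA

lemma mul_pow_succ_eq {M : Type*} [Monoid M] (a b : M) (k : ℕ) :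
    (a * b) ^ (k + 1) = a * (b * a) ^ k * b := by
  induction k with
  | zero => simp
  | succ k ih => rw [pow_succ, ih, pow_succ (b * a)]; simp only [mul_assoc]

/-- `r(ΨΘ) ≤ r(ΘΨ)` if `q (A B) = q (B A)`. -/
lemma radiusOf_mul_comm_le_of_cyclic (hq : ∀ A B, q (A * B) = q (B * A)) :
    radiusOf q (Ψ * Θ) ≤ radiusOf q (Θ * Ψ) := by
  have := radiusOf_le (q := q) (q' := q) (Ψ := Ψ * Θ) (Θ := Θ * Ψ) (K := 1) (s := 1)
    ENNReal.one_ne_top one_pos fun k hk A hA => by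
      rw [ENNReal.rpow_one, one_mul]
      obtain ⟨k, rfl⟩ := Nat.exists_eq_add_of_le' hk
      rw [mul_pow_succ_eq] at hA
      obtain ⟨D, ⟨A, hA, C, hC, rfl⟩, B, hB, rfl⟩ := hA
      simp only
      rw [hq, ← mul_assoc]
      exact le_iSup₂ (f := fun B _ => q B) _
        (by rw [pow_succ']; exact Set.mul_mem_mul (Set.mul_mem_mul hB hA) hC)
  rwa [ENNReal.rpow_one] at this

lemma exists_enorm_le_of_isBounded (h : Bornology.IsBounded Ψ) :
    ∃ N : ℝ≥0∞, N ≠ ∞ ∧ ∀ A ∈ Ψ, ‖A‖ₑ ≤ N := by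
  obtain ⟨R, hR⟩ := h.exists_norm_le
  refine ⟨ENNReal.ofReal R, ENNReal.ofReal_ne_top, fun A hA => ?_⟩
  rw [← ofReal_norm]
  exact ENNReal.ofReal_le_ofReal (hR A hA)

/-- `r(ΨΘ) ≤ r(ΘΨ)` if `q (A B C) ≤ ‖A‖ q(B) ‖C‖`. -/
lemma radiusOf_mul_comm_le_of_ideal (hq : ∀ A B C, q (A * B * C) ≤ ‖A‖ₑ * q B * ‖C‖ₑ)
    (hΨ : Bornology.IsBounded Ψ) (hΘ : Bornology.IsBounded Θ) :
    radiusOf q (Ψ * Θ) ≤ radiusOf q (Θ * Ψ) := by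
  obtain ⟨N, hN, hΨN⟩ := exists_enorm_le_of_isBounded hΨ
  obtain ⟨M, hM, hΘM⟩ := exists_enorm_le_of_isBounded hΘ
  have := radiusOf_le_of_index (q := q) (q' := q) (Ψ := Ψ * Θ) (Θ := Θ * Ψ) (K := N * M) (s := 1)
    (τ := 1) (d := fun k => k - 1) (ENNReal.mul_ne_top hN hM) zero_le_one one_pos ?_
    (tendsto_sub_atTop_nat 1) ?_
  · rwa [ENNReal.rpow_one] at this
  · have h1 : Tendsto (fun k : ℕ => 1 - 1 / (k : ℝ)) atTop (𝓝 (1 - 0)) :=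
      tendsto_const_nhds.sub tendsto_one_div_atTop_nhds_zero_nat
    rw [sub_zero] at h1
    refine h1.congr' ?_
    filter_upwards [eventually_ge_atTop 1] with k hk
    have hk0' : (k : ℝ) ≠ 0 := by positivity
    rw [Nat.cast_sub hk]
    push_cast
    field_simp
  · filter_upwards [eventually_ge_atTop 1] with k hk A hA
    obtain ⟨k, rfl⟩ := Nat.exists_eq_add_of_le' hk
    rw [mul_pow_succ_eq] at hA
    obtain ⟨D, ⟨A, hA, C, hC, rfl⟩, B, hB, rfl⟩ := hA
    simp only [ENNReal.rpow_one, Nat.add_sub_cancel]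
    calc q (A * C * B) ≤ ‖A‖ₑ * q C * ‖B‖ₑ := hq _ _ _
      _ ≤ N * (⨆ B ∈ (Θ * Ψ) ^ k, q B) * M := by
          gcongr
          · exact hΨN A hA
          · exact le_iSup₂ (f := fun B _ => q B) C hC
          · exact hΘM B hB
      _ = N * M * ⨆ B ∈ (Θ * Ψ) ^ k, q B := by ring

lemma enorm_opMul_le (A B : E →L[ℂ] E) : ‖A * B‖ₑ ≤ ‖A‖ₑ * ‖B‖ₑ := by
  simp only [← ofReal_norm]
  rw [← ENNReal.ofReal_mul (norm_nonneg _)]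
  exact ENNReal.ofReal_le_ofReal (norm_mul_le A B)

/-- `ρ̂(Ψ) ≤ ρ̂(Ψ^n)^(1/n)`: a product of `k` factors consists of `⌊k / n⌋` blocks of `n` factors
and fewer than `n` further factors. -/
lemma jointRadius_le_pow (hΨ : Bornology.IsBounded Ψ) {n : ℕ} (hn : 1 ≤ n) :
    jointRadius Ψ ≤ jointRadius (Ψ ^ n) ^ (1 / (n : ℝ)) := by
  obtain ⟨N, hN, hΨN⟩ := exists_enorm_le_of_isBounded hΨ
  have hn0 : (0 : ℝ) < n := by exact_mod_cast hn
  have hpow : ∀ r, ∀ A ∈ Ψ ^ r, ‖A‖ₑ ≤ (N + 1) ^ r := by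
    intro r
    induction r with
    | zero =>
      intro A hA
      obtain rfl : A = 1 := by simpa using hA
      rw [pow_zero, ← ofReal_norm, ← ENNReal.ofReal_one]
      exact ENNReal.ofReal_le_ofReal ContinuousLinearMap.norm_id_le
    | succ r ih =>
      intro A hA
      rw [pow_succ] at hA
      obtain ⟨B, hB, C, hC, rfl⟩ := hA
      rw [pow_succ]
      exact (enorm_opMul_le _ _).trans (mul_le_mul' (ih B hB) ((hΨN C hC).trans le_self_add))
  refine radiusOf_le_of_index (K := (N + 1) ^ n) (s := 1) (d := fun k => k / n)
    (ENNReal.pow_ne_top (ENNReal.add_ne_top.2 ⟨hN, ENNReal.one_ne_top⟩)) zero_le_one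
    (by positivity) ?_ (Nat.tendsto_div_const_atTop (by omega)) ?_
  · have h1 : Tendsto (fun k : ℕ => ((k / n : ℕ) : ℝ) / k) atTop (𝓝 (1 / n)) := by
      have h2 := (tendsto_nat_floor_mul_div_atTop (R := ℝ) (a := 1 / n) (by positivity)).comp
        tendsto_natCast_atTop_atTop
      refine h2.congr fun k => ?_
      simp only [Function.comp]
      rw [one_div_mul_eq_div, Nat.floor_div_natCast, Nat.floor_natCast]
    refine h1.congr fun k => ?_
    rw [mul_one, mul_one_div]
  · refine Eventually.of_forall fun k A hA => ?_
    rw [← Nat.div_add_mod k n, pow_add, pow_mul] at hA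
    obtain ⟨B, hB, C, hC, rfl⟩ := hA
    rw [ENNReal.rpow_one, mul_comm]
    refine (enorm_opMul_le _ _).trans (mul_le_mul' ?_ ?_)
    · exact le_iSup₂ (f := fun (B : E →L[ℂ] E) (_ : B ∈ (Ψ ^ n) ^ (k / n)) => ‖B‖ₑ) B hB
    · exact (hpow _ C hC).trans (pow_le_pow_right₀ le_add_self (Nat.mod_lt _ (by omega)).le)

/-- The spectral radius is insensitive to the order of the factors of a product. -/
lemma spectralRadius_mul_comm {𝒜 : Type*} [Ring 𝒜] [Algebra ℂ 𝒜] (a b : 𝒜) :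
    spectralRadius ℂ (a * b) = spectralRadius ℂ (b * a) := by
  have key : ∀ a b : 𝒜, spectralRadius ℂ (a * b) ≤ spectralRadius ℂ (b * a) := by
    intro a b
    refine iSup₂_le fun k hk => ?_
    rcases eq_or_ne k 0 with rfl | h0
    · simp
    · have h1 : k ∈ spectrum ℂ (b * a) \ {0} := by
        rw [← spectrum.nonzero_mul_comm]
        exact ⟨hk, h0⟩
      exact le_iSup₂ (f := fun (k : ℂ) (_ : k ∈ spectrum ℂ (b * a)) => (‖k‖₊ : ℝ≥0∞)) k h1.1
  exact le_antisymm (key a b) (key b a)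

lemma genRadius_le_pow {n : ℕ} (hn : 1 ≤ n) :
    genRadius Ψ ≤ genRadius (Ψ ^ n) ^ (1 / (n : ℝ)) := by
  have hn0 : (0 : ℝ) < n := by exact_mod_cast hn
  refine radiusOf_le (K := 1) ENNReal.one_ne_top (by positivity) fun k _ A hA => ?_
  have h1 : A ^ n ∈ (Ψ ^ n) ^ k := by
    rw [← pow_mul, mul_comm, pow_mul]
    exact Set.pow_mem_pow hA
  have h2 : spectralRadius ℂ A ^ n ≤ ⨆ B ∈ (Ψ ^ n) ^ k, spectralRadius ℂ B :=
    (spectrum.spectralRadius_pow_le A n (by omega)).trans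
      (le_iSup₂ (f := fun (B : E →L[ℂ] E) (_ : B ∈ (Ψ ^ n) ^ k) => spectralRadius ℂ B) _ h1)
  rw [one_mul]
  calc spectralRadius ℂ A = (spectralRadius ℂ A ^ n) ^ (1 / (n : ℝ)) := by
        rw [← ENNReal.rpow_natCast, ← ENNReal.rpow_mul, mul_one_div_cancel hn0.ne',
          ENNReal.rpow_one]
    _ ≤ _ := by gcongr

/-- Powers of `A` grow more slowly than `t ^ n` for `t > ρ(A)`. -/
lemma eventually_enorm_pow_le [CompleteSpace E] {A : E →L[ℂ] E} {t : ℝ≥0∞}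
    (h : spectralRadius ℂ A < t) : ∀ᶠ n : ℕ in atTop, ‖A ^ n‖ₑ ≤ t ^ n := by
  refine eventually_le_pow_of_limsup_lt (v := fun n => ‖A ^ n‖ₑ) ?_
  have := (spectrum.pow_nnnorm_pow_one_div_tendsto_nhds_spectralRadius A).limsup_eq
  simpa only [enorm_eq_nnnorm] using this.trans_lt h

/-- If `‖C ^ n‖ ≤ K t ^ (s n)` for all `t > ℓ` and large `n`, then `ρ(C) ≤ ℓ ^ s`. -/
lemma spectralRadius_le_of_eventually [CompleteSpace E] {C : E →L[ℂ] E} {ℓ : ℝ≥0∞} {s : ℝ}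
    (hs : 0 < s)
    (h : ∀ t, ℓ < t → t ≠ ∞ → ∀ᶠ n in atTop, ‖C ^ n‖ₑ ≤ (t ^ n) ^ s) :
    spectralRadius ℂ C ≤ ℓ ^ s := by
  rw [← (spectrum.pow_nnnorm_pow_one_div_tendsto_nhds_spectralRadius C).limsup_eq]
  simp only [← enorm_eq_nnnorm]
  refine limsup_rpow_le (K := 1) (d := id) (s := s) ENNReal.one_ne_top hs ?_
    (by simpa using h)
  refine tendsto_const_nhds.congr' ?_
  filter_upwards [eventually_gt_atTop 0] with k hk
  have hk0' : (k : ℝ) ≠ 0 := by positivity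
  simp only [id]
  field_simp

end RadiusLemmas

/-! ### Compactness of kernel operators on order intervals -/

section TotallyBounded

lemma totallyBounded_of_approx {M : Type*} [PseudoMetricSpace M] {S : Set M}
    (h : ∀ ε > 0, ∃ T : Set M, TotallyBounded T ∧ ∀ x ∈ S, ∃ y ∈ T, dist x y < ε) :
    TotallyBounded S := by
  rw [Metric.totallyBounded_iff]
  intro ε hε
  obtain ⟨T, hT, hST⟩ := h (ε / 2) (half_pos hε)
  obtain ⟨t, ht, htT⟩ := Metric.totallyBounded_iff.1 hT (ε / 2) (half_pos hε)
  refine ⟨t, ht, fun x hx => ?_⟩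
  obtain ⟨y, hy, hxy⟩ := hST x hx
  obtain ⟨z, hz, hyz⟩ := Set.mem_iUnion₂.1 (htT hy)
  refine Set.mem_iUnion₂.2 ⟨z, hz, ?_⟩
  calc dist x z ≤ dist x y + dist y z := dist_triangle _ _ _
    _ < ε / 2 + ε / 2 := add_lt_add hxy hyz
    _ = ε := add_halves ε

lemma totallyBounded_of_subset_image2 {M N P : Type*} [PseudoMetricSpace M] [CompleteSpace M]
    [PseudoMetricSpace N] [CompleteSpace N] [PseudoMetricSpace P] {f : M × N → P}
    (hf : Continuous f) {S : Set M} {T : Set N} {U : Set P} (hS : TotallyBounded S)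
    (hT : TotallyBounded T) (h : ∀ z ∈ U, ∃ x ∈ S, ∃ y ∈ T, f (x, y) = z) :
    TotallyBounded U := by
  have hc : IsCompact (closure S ×ˢ closure T) :=
    (hS.closure.isCompact_of_isClosed isClosed_closure).prod
      (hT.closure.isCompact_of_isClosed isClosed_closure)
  refine (hc.image hf).totallyBounded.subset ?_
  intro z hz
  obtain ⟨x, hx, y, hy, rfl⟩ := h z hz
  exact ⟨(x, y), ⟨subset_closure hx, subset_closure hy⟩, rfl⟩

end TotallyBounded

namespace BanachFunctionSpace

section AMCompact

variable {X : Type*} [MeasurableSpace X] {μ : Measure X}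
  {E : Type*} [NormedAddCommGroup E] [NormedSpace ℂ E] [CompleteSpace E]
  {L : BanachFunctionSpace μ E}

/-- A pointwise form of order continuity: nonnegative functions in `L` that decrease to `0` almost
everywhere tend to `0` in norm. -/
lemma HasOrderContinuousNorm.tendsto_norm (h : L.HasOrderContinuousNorm) {f : ℕ → E}
    (h0 : ∀ n, 0 ≤ L.ι (f n))
    (hanti : ∀ᵐ x ∂μ, Antitone fun n => ‖L.ι (f n) x‖)
    (hlim : ∀ᵐ x ∂μ, Tendsto (fun n => ‖L.ι (f n) x‖) atTop (𝓝 0)) :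
    Tendsto (fun n => ‖f n‖) atTop (𝓝 0) := by
  have hr : ∀ᵐ x ∂μ, ∀ n, L.ι (f n) x = (‖L.ι (f n) x‖ : ℂ) :=
    ae_all_iff.2 fun n => L.ae_eq_norm (h0 n)
  refine h f ?_ ⟨?_, ?_⟩
  · intro n k hnk
    rw [← AEEqFun.coeFn_le]
    filter_upwards [hr, hanti] with x h1 h2
    rw [h1 n, h1 k]
    exact_mod_cast h2 hnk
  · rintro _ ⟨n, rfl⟩
    exact h0 n
  · intro g hg
    have hg' : ∀ᵐ x ∂μ, ∀ n, g x ≤ L.ι (f n) x := ae_all_iff.2 fun n => by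
      have := hg ⟨n, rfl⟩
      exact AEEqFun.coeFn_le.2 this
    rw [← AEEqFun.coeFn_le]
    filter_upwards [hr, hlim, hg', AEEqFun.coeFn_zero (α := X) (β := ℂ) (μ := μ)] with x h1 h2 h3 h4
    rw [h4]
    have h5 : Tendsto (fun n => L.ι (f n) x) atTop (𝓝 0) := by
      rw [tendsto_zero_iff_norm_tendsto_zero]; exact h2
    exact ge_of_tendsto' h5 h3

/-- The kernel `k ≥ 0` is admissible if `∫ k(x, y) dy` is dominated by a member of `L`. -/
def Admissible (L : BanachFunctionSpace μ E) (k : X × X → ℝ≥0∞) : Prop :=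
  ∃ v : E, ∀ᵐ x ∂μ, ∫⁻ y, k (x, y) ∂μ ≤ ‖L.ι v x‖ₑ

/-- The set of all `∫ k(x, y) φ(y) dy` with `|φ| ≤ 1`. -/
def kernelImage (L : BanachFunctionSpace μ E) (k : X × X → ℝ≥0∞) : Set E :=
  {g | ∃ φ : X → ℂ, Measurable φ ∧ (∀ y, ‖φ y‖ ≤ 1) ∧
    ∀ᵐ x ∂μ, L.ι g x = ∫ y, ((k (x, y)).toReal : ℂ) * φ y ∂μ}

lemma Admissible.mono {k k' : X × X → ℝ≥0∞} (h : L.Admissible k') (hk : k ≤ k') :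
    L.Admissible k := by
  obtain ⟨v, hv⟩ := h
  refine ⟨v, ?_⟩
  filter_upwards [hv] with x hx
  exact (lintegral_mono fun y => hk _).trans hx

lemma Admissible.ae_lintegral_lt_top {k : X × X → ℝ≥0∞} (h : L.Admissible k) :
    ∀ᵐ x ∂μ, ∫⁻ y, k (x, y) ∂μ < ∞ := by
  obtain ⟨v, hv⟩ := h
  filter_upwards [hv] with x hx using hx.trans_lt enorm_lt_top

lemma enorm_toReal_mul_le {t : ℝ≥0∞} {z : ℂ} (hz : ‖z‖ ≤ 1) :
    ‖(t.toReal : ℂ) * z‖ₑ ≤ t := by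
  rw [enorm_mul, ← ofReal_norm (t.toReal : ℂ), Complex.norm_real,
    Real.norm_of_nonneg ENNReal.toReal_nonneg]
  calc ENNReal.ofReal t.toReal * ‖z‖ₑ ≤ t * 1 := by
        gcongr
        · exact ENNReal.ofReal_toReal_le
        · rw [← ofReal_norm, ← ENNReal.ofReal_one]
          exact ENNReal.ofReal_le_ofReal hz
    _ = t := mul_one t

lemma integrable_toReal_mul {k : X → ℝ≥0∞} (hk : Measurable k) (hfin : ∫⁻ y, k y ∂μ < ∞)
    {φ : X → ℂ} (hφ : Measurable φ) (h1 : ∀ y, ‖φ y‖ ≤ 1) :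
    Integrable (fun y => ((k y).toReal : ℂ) * φ y) μ := by
  refine ⟨((Complex.measurable_ofReal.comp hk.ennreal_toReal).mul hφ).aestronglyMeasurable, ?_⟩
  exact lt_of_le_of_lt (lintegral_mono fun y => enorm_toReal_mul_le (h1 y)) hfin

lemma Admissible.exists_mem [SFinite μ] {k : X × X → ℝ≥0∞} (hk : Measurable k) (h : L.Admissible k)
    {φ : X → ℂ} (hφ : Measurable φ) (h1 : ∀ y, ‖φ y‖ ≤ 1) :
    ∃ g : E, ∀ᵐ x ∂μ, L.ι g x = ∫ y, ((k (x, y)).toReal : ℂ) * φ y ∂μ := by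
  obtain ⟨v, hv⟩ := h
  have hm : Measurable fun p : X × X => ((k p).toReal : ℂ) * φ p.2 :=
    (Complex.measurable_ofReal.comp hk.ennreal_toReal).mul (hφ.comp measurable_snd)
  obtain ⟨g, hg, -⟩ := L.exists_of_norm_le v
    (hm.aestronglyMeasurable (μ := μ.prod μ)).integral_prod_right' (by
      filter_upwards [hv] with x hx
      rw [← enorm_le_iff_norm_le]
      exact (enorm_integral_le_lintegral_enorm _).trans
        ((lintegral_mono fun y => enorm_toReal_mul_le (h1 y)).trans hx))
  exact ⟨g, hg⟩

/-- Total boundedness is inherited by sums of kernels. -/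
lemma Admissible.totallyBounded_add [SFinite μ] {k k₁ k₂ : X × X → ℝ≥0∞} (h : L.Admissible k)
    (h₁ : Measurable k₁) (h₂ : Measurable k₂) (hk : ∀ p, k p = k₁ p + k₂ p)
    (hS₁ : TotallyBounded (L.kernelImage k₁)) (hS₂ : TotallyBounded (L.kernelImage k₂)) :
    TotallyBounded (L.kernelImage k) := by
  have ha₁ : L.Admissible k₁ := h.mono fun p => by rw [hk]; exact le_self_add
  have ha₂ : L.Admissible k₂ := h.mono fun p => by rw [hk]; exact le_add_self
  refine totallyBounded_of_subset_image2 (f := fun p : E × E => p.1 + p.2) continuous_add hS₁ hS₂ ?_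
  rintro g ⟨φ, hφ, h1, hg⟩
  obtain ⟨g₁, hg₁⟩ := ha₁.exists_mem h₁ hφ h1
  obtain ⟨g₂, hg₂⟩ := ha₂.exists_mem h₂ hφ h1
  refine ⟨g₁, ⟨φ, hφ, h1, hg₁⟩, g₂, ⟨φ, hφ, h1, hg₂⟩, L.ext_ae ?_⟩
  filter_upwards [hg, hg₁, hg₂, L.ι_add g₁ g₂, ha₁.ae_lintegral_lt_top, ha₂.ae_lintegral_lt_top]
    with x e e₁ e₂ e₃ f₁ f₂
  have m₁ : Measurable fun y => k₁ (x, y) := h₁.comp measurable_prodMk_left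
  have m₂ : Measurable fun y => k₂ (x, y) := h₂.comp measurable_prodMk_left
  rw [e₃, e₁, e₂, e, ← integral_add (integrable_toReal_mul m₁ f₁ hφ h1)
    (integrable_toReal_mul m₂ f₂ hφ h1)]
  refine integral_congr_ae ?_
  filter_upwards [ae_lt_top m₁ f₁.ne, ae_lt_top m₂ f₂.ne] with y l₁ l₂
  rw [hk, ENNReal.toReal_add l₁.ne l₂.ne]
  push_cast
  ring

/-- Total boundedness is inherited by differences of kernels. -/
lemma Admissible.totallyBounded_sub [SFinite μ] {k k₁ k₂ : X × X → ℝ≥0∞} (h : L.Admissible k)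
    (h₁ : Measurable k₁) (h₂ : Measurable k₂) (hk : ∀ p, k p = k₁ p + k₂ p)
    (hS : TotallyBounded (L.kernelImage k)) (hS₁ : TotallyBounded (L.kernelImage k₁)) :
    TotallyBounded (L.kernelImage k₂) := by
  have ha₁ : L.Admissible k₁ := h.mono fun p => by rw [hk]; exact le_self_add
  have ha₂ : L.Admissible k₂ := h.mono fun p => by rw [hk]; exact le_add_self
  have hm : Measurable k := by
    rw [show k = fun p => k₁ p + k₂ p from funext hk]; exact h₁.add h₂
  refine totallyBounded_of_subset_image2 (f := fun p : E × E => p.1 - p.2) continuous_sub hS hS₁ ?_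
  rintro g ⟨φ, hφ, h1, hg⟩
  obtain ⟨g₁, hg₁⟩ := ha₁.exists_mem h₁ hφ h1
  obtain ⟨g₀, hg₀⟩ := h.exists_mem hm hφ h1
  refine ⟨g₀, ⟨φ, hφ, h1, hg₀⟩, g₁, ⟨φ, hφ, h1, hg₁⟩, L.ext_ae ?_⟩
  filter_upwards [hg, hg₁, hg₀, L.ι_sub g₀ g₁, ha₁.ae_lintegral_lt_top, ha₂.ae_lintegral_lt_top]
    with x e e₁ e₂ e₃ f₁ f₂
  have m₁ : Measurable fun y => k₁ (x, y) := h₁.comp measurable_prodMk_left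
  have m₂ : Measurable fun y => k₂ (x, y) := h₂.comp measurable_prodMk_left
  rw [e₃, e₁, e₂, e, sub_eq_iff_eq_add', ← integral_add (integrable_toReal_mul m₁ f₁ hφ h1)
    (integrable_toReal_mul m₂ f₂ hφ h1)]
  refine integral_congr_ae ?_
  filter_upwards [ae_lt_top m₁ f₁.ne, ae_lt_top m₂ f₂.ne] with y l₁ l₂
  rw [hk, ENNReal.toReal_add l₁.ne l₂.ne]
  push_cast
  ring

/-- Total boundedness is inherited by suprema of increasing sequences of kernels, since the
norm of `L` is order continuous. -/
lemma Admissible.totallyBounded_iSup [SFinite μ] (hL : L.HasOrderContinuousNorm) {k : X × X → ℝ≥0∞}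
    (h : L.Admissible k) {κ : ℕ → X × X → ℝ≥0∞} (hκ : ∀ n, Measurable (κ n)) (hmono : Monotone κ)
    (hk : ∀ p, k p = ⨆ n, κ n p) (hS : ∀ n, TotallyBounded (L.kernelImage (κ n))) :
    TotallyBounded (L.kernelImage k) := by
  have hm : Measurable k := by
    rw [show k = fun p => ⨆ n, κ n p from funext hk]; exact Measurable.iSup hκ
  have hle : ∀ n, κ n ≤ k := fun n p => by rw [hk]; exact le_iSup (fun n => κ n p) n
  have ha : ∀ n, L.Admissible (κ n) := fun n => h.mono (hle n)
  let I : X → ℝ≥0∞ := fun x => ∫⁻ y, k (x, y) ∂μ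
  let J : ℕ → X → ℝ≥0∞ := fun n x => ∫⁻ y, κ n (x, y) ∂μ
  have hI : Measurable I := hm.lintegral_prod_right'
  have hJ : ∀ n, Measurable (J n) := fun n => (hκ n).lintegral_prod_right'
  have hJI : ∀ n x, J n x ≤ I x := fun n x => lintegral_mono fun y => hle n _
  have hlim : ∀ x, Tendsto (fun n => J n x) atTop (𝓝 (I x)) := fun x => by
    refine lintegral_tendsto_of_tendsto_of_monotone
      (fun n => ((hκ n).comp measurable_prodMk_left).aemeasurable)
      (Eventually.of_forall fun y n m hnm => hmono hnm _) (Eventually.of_forall fun y => ?_)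
    rw [hk]
    exact tendsto_atTop_iSup fun n m hnm => hmono hnm _
  obtain ⟨v, hv⟩ := id h
  have hd : ∀ n, ∃ w : E, ∀ᵐ x ∂μ, L.ι w x = (((I x - J n x).toReal : ℝ) : ℂ) := fun n => by
    obtain ⟨w, hw, -⟩ := L.exists_of_norm_le v (g := fun x => (((I x - J n x).toReal : ℝ) : ℂ))
      (Complex.measurable_ofReal.comp (hI.sub (hJ n)).ennreal_toReal).aestronglyMeasurable (by
        filter_upwards [hv] with x hx
        rw [Complex.norm_real, Real.norm_of_nonneg ENNReal.toReal_nonneg, ← toReal_enorm]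
        exact ENNReal.toReal_mono enorm_ne_top (tsub_le_self.trans hx))
    exact ⟨w, hw⟩
  choose w hw using hd
  have hw' : ∀ᵐ x ∂μ, ∀ n, L.ι (w n) x = (((I x - J n x).toReal : ℝ) : ℂ) := ae_all_iff.2 hw
  have hwn : ∀ᵐ x ∂μ, ∀ n, ‖L.ι (w n) x‖ = (I x - J n x).toReal := by
    filter_upwards [hw'] with x hx n
    rw [hx, Complex.norm_real, Real.norm_of_nonneg ENNReal.toReal_nonneg]
  have hw0 : Tendsto (fun n => ‖w n‖) atTop (𝓝 0) := by
    refine hL.tendsto_norm (fun n => ?_) ?_ ?_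
    · rw [nonneg_iff]
      filter_upwards [hw n] with x hx
      rw [hx]
      exact_mod_cast ENNReal.toReal_nonneg
    · filter_upwards [hwn, h.ae_lintegral_lt_top] with x hx hfin n m hnm
      simp only [hx]
      refine ENNReal.toReal_mono (ne_top_of_le_ne_top hfin.ne tsub_le_self) ?_
      exact tsub_le_tsub_left (lintegral_mono fun y => hmono hnm _) _
    · filter_upwards [hwn, h.ae_lintegral_lt_top] with x hx hfin
      simp only [hx]
      have h1 : Tendsto (fun n => I x - J n x) atTop (𝓝 (I x - I x)) :=
        ENNReal.Tendsto.sub tendsto_const_nhds (hlim x) (Or.inl hfin.ne)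
      rw [tsub_self] at h1
      exact (ENNReal.tendsto_toReal ENNReal.zero_ne_top).comp h1
  refine totallyBounded_of_approx fun ε hε => ?_
  obtain ⟨n, hn⟩ := (hw0.eventually (gt_mem_nhds hε)).exists
  refine ⟨_, hS n, ?_⟩
  rintro g ⟨φ, hφ, h1, hg⟩
  obtain ⟨g', hg'⟩ := (ha n).exists_mem (hκ n) hφ h1
  refine ⟨g', ⟨φ, hφ, h1, hg'⟩, ?_⟩
  rw [dist_eq_norm]
  refine lt_of_le_of_lt (L.norm_le_of_ae_le ?_) hn
  filter_upwards [hg, hg', L.ι_sub g g', hwn, h.ae_lintegral_lt_top] with x e₁ e₂ e₃ e₄ hfin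
  have m : Measurable fun y => k (x, y) := hm.comp measurable_prodMk_left
  have mn : Measurable fun y => κ n (x, y) := (hκ n).comp measurable_prodMk_left
  have hfinn : J n x < ∞ := (hJI n x).trans_lt hfin
  rw [e₃, e₁, e₂, e₄, ← integral_sub (integrable_toReal_mul m hfin hφ h1)
    (integrable_toReal_mul mn hfinn hφ h1), ← toReal_enorm]
  refine ENNReal.toReal_mono (ne_top_of_le_ne_top hfin.ne tsub_le_self) ?_
  have h2 : I x - J n x = ∫⁻ y, (k (x, y) - κ n (x, y)) ∂μ :=
    (lintegral_sub mn hfinn.ne (Eventually.of_forall fun y => hle n _)).symm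
  rw [h2]
  refine (enorm_integral_le_lintegral_enorm _).trans (lintegral_mono_ae ?_)
  filter_upwards [ae_lt_top m hfin.ne] with y hy
  rw [← sub_mul, ← Complex.ofReal_sub, ← ENNReal.toReal_sub_of_le (hle n _) hy.ne]
  exact enorm_toReal_mul_le (h1 y)

/-- Every admissible kernel has a totally bounded image of the unit ball of `L^∞`, if the norm of
`L` is order continuous: this is clear for the rectangles of a kernel `u(x) p(y)` with `u ∈ L` and
`p` integrable, and extends from there to all measurable kernels. -/
theorem Admissible.totallyBounded [SigmaFinite μ] (hL : L.HasOrderContinuousNorm) {k : X × X → ℝ≥0∞}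
    (hk : Measurable k) (h : L.Admissible k) : TotallyBounded (L.kernelImage k) := by
  classical
  obtain ⟨u, hu⟩ := L.exists_weakUnit
  obtain ⟨p, hp0, hpm, hpi⟩ := exists_pos_lintegral_lt_of_sigmaFinite μ (ε := 1) one_ne_zero
  have hUm : Measurable (L.ι u) := (L.ι u).measurable
  let U : X → ℝ≥0∞ := fun x => if L.ι u x = 0 then 1 else ‖L.ι u x‖ₑ
  have hUmeas : Measurable U :=
    Measurable.ite (hUm (measurableSet_singleton 0)) measurable_const hUm.enorm
  have hU0 : ∀ x, U x ≠ 0 := fun x => by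
    simp only [U]; split_ifs with hx
    · exact one_ne_zero
    · simpa using hx
  have hUtop : ∀ x, U x ≠ ∞ := fun x => by
    simp only [U]; split_ifs with hx
    · exact ENNReal.one_ne_top
    · exact enorm_ne_top
  have hUu : ∀ᵐ x ∂μ, (((U x).toReal : ℝ) : ℂ) = L.ι u x := by
    filter_upwards [hu] with x hx
    simp only [U, if_neg hx.ne', toReal_enorm]
    exact (eq_norm_of_nonneg hx.le).symm
  let k₀ : X × X → ℝ≥0∞ := fun q => U q.1 * p q.2
  have hk₀m : Measurable k₀ :=
    (hUmeas.comp measurable_fst).mul (hpm.coe_nnreal_ennreal.comp measurable_snd)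
  have hk₀0 : ∀ q, k₀ q ≠ 0 := fun q => mul_ne_zero (hU0 _) (by exact_mod_cast (hp0 _).ne')
  have hk₀top : ∀ q, k₀ q ≠ ∞ := fun q => ENNReal.mul_ne_top (hUtop _) ENNReal.coe_ne_top
  have hk₀a : L.Admissible k₀ := by
    refine ⟨u, ?_⟩
    filter_upwards [hu] with x hx
    simp only [k₀]
    rw [lintegral_const_mul' _ _ (hUtop x)]
    simp only [U, if_neg hx.ne']
    calc ‖L.ι u x‖ₑ * ∫⁻ y, p y ∂μ ≤ ‖L.ι u x‖ₑ * 1 := by gcongr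
      _ = _ := mul_one _
  have hadm : ∀ T : Set (X × X), L.Admissible (T.indicator k₀) := fun T =>
    hk₀a.mono (Set.indicator_le_self' fun _ _ => zero_le)
  -- rectangles give one-dimensional images
  have hrect : ∀ S B : Set X, MeasurableSet S → MeasurableSet B →
      TotallyBounded (L.kernelImage ((S ×ˢ B).indicator k₀)) := by
    intro S B hS hB
    obtain ⟨v, hv, -⟩ := L.exists_of_norm_le u (g := S.indicator (L.ι u))
      ((L.aesm u).indicator hS) (Eventually.of_forall fun x => norm_indicator_le_norm_self _ _)
    have hc : IsCompact ((fun z : ℂ => z • v) '' Metric.closedBall 0 1) :=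
      (isCompact_closedBall 0 1).image (by fun_prop)
    refine hc.totallyBounded.subset ?_
    rintro g ⟨φ, hφ, h1, hg⟩
    refine ⟨∫ y, B.indicator (fun y => ((p y : ℝ) : ℂ) * φ y) y ∂μ, ?_, L.ext_ae ?_⟩
    · rw [mem_closedBall_zero_iff]
      have h2 : ‖∫ y, B.indicator (fun y => ((p y : ℝ) : ℂ) * φ y) y ∂μ‖ₑ ≤ 1 := by
        refine (enorm_integral_le_lintegral_enorm _).trans
          ((lintegral_mono fun y => ?_).trans hpi.le)
        refine (enorm_indicator_le_enorm_self _ _).trans ?_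
        simpa using enorm_toReal_mul_le (t := (p y : ℝ≥0∞)) (h1 y)
      rw [← ofReal_norm, ENNReal.ofReal_le_one] at h2
      exact h2
    · filter_upwards [hg, hv, L.ι_smul (∫ y, B.indicator (fun y => ((p y : ℝ) : ℂ) * φ y) y ∂μ) v,
        hUu] with x e₁ e₂ e₃ e₄
      rw [e₁, e₃, e₂, ← integral_mul_const]
      refine integral_congr_ae (Eventually.of_forall fun y => ?_)
      by_cases hx : x ∈ S <;> by_cases hy : y ∈ B <;>
        simp [hx, hy, k₀, ← e₄]
      ring
  have hempty : TotallyBounded (L.kernelImage ((∅ : Set (X × X)).indicator k₀)) := by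
    simpa using hrect ∅ ∅ MeasurableSet.empty MeasurableSet.empty
  have hset : ∀ T : Set (X × X), MeasurableSet T →
      TotallyBounded (L.kernelImage (T.indicator k₀)) := by
    refine MeasurableSpace.induction_on_inter generateFrom_prod.symm isPiSystem_prod ?_ ?_ ?_ ?_
    · exact hempty
    · rintro _ ⟨S, hS, B, hB, rfl⟩
      exact hrect S B hS hB
    · intro T hT ih
      refine hk₀a.totallyBounded_sub (hk₀m.indicator hT) (hk₀m.indicator hT.compl)
        (fun q => ?_) ?_ ih
      · by_cases hq : q ∈ T <;> simp [hq]
      · simpa using hrect Set.univ Set.univ MeasurableSet.univ MeasurableSet.univ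
    · intro f hf hfm ih
      have hpart : ∀ n, TotallyBounded (L.kernelImage ((⋃ i < n, f i).indicator k₀)) := by
        intro n
        induction n with
        | zero => simpa using hempty
        | succ n ihn =>
          refine (hadm _).totallyBounded_add
            (hk₀m.indicator (MeasurableSet.biUnion (Set.to_countable {i | i < n})
              fun i _ => hfm i)) (hk₀m.indicator (hfm n)) (fun q => ?_) ihn (ih n)
          have hdis : Disjoint (⋃ i < n, f i) (f n) := by
            simp only [Set.disjoint_iUnion_left]
            exact fun i hi => hf hi.ne
          rw [Set.biUnion_lt_succ, Set.indicator_union_of_disjoint hdis]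
          rfl
      refine (hadm _).totallyBounded_iSup hL (κ := fun n => (⋃ i < n, f i).indicator k₀)
        (fun n => hk₀m.indicator (MeasurableSet.biUnion (Set.to_countable {i | i < n})
              fun i _ => hfm i)) ?_ (fun q => ?_) hpart
      · intro n m hnm
        exact Set.indicator_le_indicator_of_subset
          (Set.biUnion_subset_biUnion_left fun i (hi : i < n) => hi.trans_le hnm)
          (fun _ => zero_le)
      · have hU : (⋃ i, f i) = ⋃ n, ⋃ i < n, f i := by
          ext q
          simp only [Set.mem_iUnion, exists_prop]
          exact ⟨fun ⟨i, hi⟩ => ⟨i + 1, i, i.lt_succ_self, hi⟩, fun ⟨_, i, _, hi⟩ => ⟨i, hi⟩⟩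
        rw [hU, Set.indicator_iUnion_apply rfl]
  have hconst : ∀ (c : ℝ≥0∞) (T : Set (X × X)), MeasurableSet T → c ≠ ∞ →
      TotallyBounded (L.kernelImage fun q => T.indicator (fun _ => c) q * k₀ q) := by
    intro c T hT hc
    lift c to ℝ≥0 using hc
    refine totallyBounded_of_subset_image2 (f := fun q : ℂ × E => q.1 • q.2)
      continuous_smul (S := {((c : ℝ) : ℂ)}) isCompact_singleton.totallyBounded (hset T hT) ?_
    rintro g ⟨φ, hφ, h1, hg⟩
    obtain ⟨g', hg'⟩ := (hadm T).exists_mem (hk₀m.indicator hT) hφ h1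
    refine ⟨_, rfl, g', ⟨φ, hφ, h1, hg'⟩, L.ext_ae ?_⟩
    filter_upwards [hg, hg', L.ι_smul ((c : ℝ) : ℂ) g'] with x e₁ e₂ e₃
    rw [e₁, e₃, e₂, ← integral_const_mul]
    refine integral_congr_ae (Eventually.of_forall fun y => ?_)
    by_cases hq : (x, y) ∈ T <;> simp [hq, mul_assoc]
  have hfun : ∀ θ : X × X → ℝ≥0∞, Measurable θ → L.Admissible (fun q => θ q * k₀ q) →
      TotallyBounded (L.kernelImage fun q => θ q * k₀ q) := by
    intro θ hθ
    refine Measurable.ennreal_induction (motive := fun θ => L.Admissible (fun q => θ q * k₀ q) →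
      TotallyBounded (L.kernelImage fun q => θ q * k₀ q)) ?_ ?_ ?_ hθ
    · intro c T hT ha
      rcases eq_or_ne c ∞ with rfl | hc
      · refine ha.totallyBounded_iSup hL
          (κ := fun (n : ℕ) q => T.indicator (fun _ => (n : ℝ≥0∞)) q * k₀ q)
          (fun n => (measurable_const.indicator hT).mul hk₀m) ?_ (fun q => ?_)
          fun n => hconst n T hT (ENNReal.natCast_ne_top n)
        · intro n m hnm q
          simp only
          gcongr
        · rw [← ENNReal.iSup_mul]
          congr 1
          by_cases hq : q ∈ T <;> simp [hq, ENNReal.iSup_natCast]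
      · exact hconst c T hT hc
    · intro θ η _ hθ hη ihθ ihη ha
      refine ha.totallyBounded_add (hθ.mul hk₀m) (hη.mul hk₀m) (fun q => ?_)
        (ihθ (ha.mono fun q => ?_)) (ihη (ha.mono fun q => ?_))
      · simp [add_mul]
      · simp only [Pi.add_apply, add_mul]; exact le_self_add
      · simp only [Pi.add_apply, add_mul]; exact le_add_self
    · intro θ hθ hmono ih ha
      refine ha.totallyBounded_iSup hL (κ := fun n q => θ n q * k₀ q)
        (fun n => (hθ n).mul hk₀m) ?_ (fun q => ?_) fun n => ih n (ha.mono fun q => ?_)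
      · intro n m hnm q
        exact mul_le_mul_left (hmono hnm q) _
      · simp only [ENNReal.iSup_mul]
      · exact mul_le_mul_left (le_iSup (fun n => θ n q) n) _
  have hdiv : (fun q => k q / k₀ q * k₀ q) = k := funext fun q =>
    ENNReal.div_mul_cancel (hk₀0 q) (hk₀top q)
  have := hfun (fun q => k q / k₀ q) (hk.div hk₀m) (by rwa [hdiv])
  rwa [hdiv] at this

/-- A positive kernel operator on a space with order continuous norm maps order intervals to
totally bounded sets. -/
theorem IsPositiveKernelOperator.totallyBounded [SigmaFinite μ] (hL : L.HasOrderContinuousNorm)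
    {C : E →L[ℂ] E}
    (hC : L.IsPositiveKernelOperator C) (w : E) :
    TotallyBounded {g | ∃ f : E, (∀ᵐ x ∂μ, ‖L.ι f x‖ ≤ ‖L.ι w x‖) ∧ g = C f} := by
  classical
  obtain ⟨a, ham, ha0, ha⟩ := hC.exists_kernel
  have hwm : Measurable (L.ι w) := (L.ι w).measurable
  let k : X × X → ℝ≥0∞ := fun q => ENNReal.ofReal (a q * ‖L.ι w q.2‖)
  have hk : Measurable k := (ham.mul (hwm.comp measurable_snd).norm).ennreal_ofReal
  have hadm : L.Admissible k := by
    refine ⟨C (L.abs w), ?_⟩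
    filter_upwards [ha.lintegral_eq ha0 (L.abs_nonneg w)] with x hx
    rw [← hx]
    refine le_of_eq (lintegral_congr_ae ?_)
    filter_upwards [L.ι_abs w] with y hy
    simp only [k, hy, Complex.norm_real, norm_norm]
  refine (hadm.totallyBounded hL hk).subset ?_
  rintro _ ⟨f, hf, rfl⟩
  have hfm : Measurable (L.ι f) := (L.ι f).measurable
  let φ : X → ℂ := fun y => if ‖L.ι f y‖ ≤ ‖L.ι w y‖ then L.ι f y / (‖L.ι w y‖ : ℂ) else 0
  refine ⟨φ, ?_, fun y => ?_, ?_⟩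
  · exact Measurable.ite (measurableSet_le hfm.norm hwm.norm)
      (hfm.div (Complex.measurable_ofReal.comp hwm.norm)) measurable_const
  · simp only [φ]
    split_ifs with hy
    · rw [norm_div, Complex.norm_real, norm_norm]
      exact div_le_one_of_le₀ hy (norm_nonneg _)
    · simp
  · filter_upwards [ha.2 f] with x hx
    rw [hx.2]
    refine integral_congr_ae ?_
    filter_upwards [hf] with y hy
    simp only [k, φ, if_pos hy, ENNReal.toReal_ofReal (mul_nonneg (ha0 _) (norm_nonneg _))]
    rcases eq_or_ne (‖L.ι w y‖) 0 with h0 | h0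
    · have : L.ι f y = 0 := by
        rw [h0] at hy
        exact norm_le_zero_iff.1 hy
      simp [this]
    · have h0' : (‖L.ι w y‖ : ℂ) ≠ 0 := by exact_mod_cast h0
      push_cast
      field_simp

end AMCompact

end BanachFunctionSpace

namespace BanachFunctionSpace

/-! ### Positive functionals and disjoint sequences -/

section Functionals

variable {X : Type*} [MeasurableSpace X] {μ : Measure X}
  {E : Type*} [NormedAddCommGroup E] [NormedSpace ℂ E] [CompleteSpace E]
  (L : BanachFunctionSpace μ E)

lemma exists_posPart (f : E) :
    ∃ k : E, ∀ᵐ x ∂μ, L.ι k x = ((max (L.ι f x).re 0 : ℝ) : ℂ) := by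
  obtain ⟨k, hk, -⟩ := L.exists_of_norm_le f
    (g := fun x => ((max (L.ι f x).re 0 : ℝ) : ℂ))
    (Complex.measurable_ofReal.comp ((Complex.measurable_re.comp
      (L.ι f).measurable).max measurable_const)).aestronglyMeasurable
    (Eventually.of_forall fun x => by
      rw [Complex.norm_real, Real.norm_of_nonneg (le_max_right _ _)]
      exact max_le ((le_abs_self _).trans (Complex.abs_re_le_norm _)) (norm_nonneg _))
  exact ⟨k, hk⟩

/-- The positive part `(Re f)⁺`. -/
noncomputable def posPart (f : E) : E := (L.exists_posPart f).choose

lemma ι_posPart (f : E) : ∀ᵐ x ∂μ, L.ι (L.posPart f) x = ((max (L.ι f x).re 0 : ℝ) : ℂ) :=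
  (L.exists_posPart f).choose_spec

lemma norm_ι_posPart (f : E) : ∀ᵐ x ∂μ, ‖L.ι (L.posPart f) x‖ = max (L.ι f x).re 0 := by
  filter_upwards [L.ι_posPart f] with x hx
  rw [hx, Complex.norm_real, Real.norm_of_nonneg (le_max_right _ _)]

lemma norm_posPart_le (f : E) : ‖L.posPart f‖ ≤ ‖f‖ := by
  refine L.norm_le_of_ae_le ?_
  filter_upwards [L.norm_ι_posPart f] with x hx
  rw [hx]
  exact max_le ((le_abs_self _).trans (Complex.abs_re_le_norm _)) (norm_nonneg _)

/-- A function `f ≥ 0` in `L` is normed by a positive functional of norm one, by the Hahn-Banach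
theorem for the sublinear functional `f ↦ ‖(Re f)⁺‖`. -/
theorem exists_positive_functional {m : E} (hm : 0 ≤ L.ι m) :
    ∃ φ : E →L[ℂ] ℂ, (∀ f, 0 ≤ L.ι f → 0 ≤ φ f) ∧ φ m = ‖m‖ ∧ ∀ f, (φ f).re ≤ ‖f‖ := by
  rcases eq_or_ne m 0 with rfl | hm0
  · exact ⟨0, fun _ _ => le_refl _, by simp, fun f => by simp⟩
  have hN_hom : ∀ c : ℝ, 0 < c → ∀ x : E, ‖L.posPart (c • x)‖ = c * ‖L.posPart x‖ := by
    intro c hc f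
    have h1 : ∀ᵐ x ∂μ, ‖L.ι (L.posPart (c • f)) x‖ = ‖L.ι ((c : ℂ) • L.posPart f) x‖ := by
      filter_upwards [L.norm_ι_posPart (c • f), L.norm_ι_posPart f, L.ι_smul c (L.posPart f),
        L.ι_smul c f] with x e₁ e₂ e₃ e₄
      rw [e₁, e₃, norm_mul, e₂, Complex.norm_real, Real.norm_of_nonneg hc.le,
        ← Complex.coe_smul c f, e₄, Complex.re_ofReal_mul, mul_max_of_nonneg _ _ hc.le, mul_zero]
    have h2 := le_antisymm (L.norm_le_of_ae_le (h1.mono fun x hx => hx.le))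
      (L.norm_le_of_ae_le (h1.mono fun x hx => hx.ge))
    rw [h2, norm_smul, Complex.norm_real, Real.norm_of_nonneg hc.le]
  have hN_add : ∀ f g : E, ‖L.posPart (f + g)‖ ≤ ‖L.posPart f‖ + ‖L.posPart g‖ := by
    intro f g
    refine le_trans (L.norm_le_of_ae_le ?_) (norm_add_le _ _)
    filter_upwards [L.norm_ι_posPart (f + g), L.ι_posPart f, L.ι_posPart g,
      L.ι_add (L.posPart f) (L.posPart g), L.ι_add f g] with x e₁ e₂ e₃ e₄ e₅
    rw [e₁, e₄, e₂, e₃, e₅, ← Complex.ofReal_add, Complex.norm_real,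
      Real.norm_of_nonneg (add_nonneg (le_max_right _ _) (le_max_right _ _)), Complex.add_re]
    exact max_le (add_le_add (le_max_left _ _) (le_max_left _ _))
      (add_nonneg (le_max_right _ _) (le_max_right _ _))
  have hNm : ‖L.posPart m‖ = ‖m‖ := by
    refine le_antisymm (L.norm_posPart_le m) (L.norm_le_of_ae_le ?_)
    filter_upwards [L.norm_ι_posPart m, L.ae_eq_norm hm] with x e₁ e₂
    rw [e₁, e₂, Complex.ofReal_re, Complex.norm_real, norm_norm]
    exact le_max_left _ _
  have hdom : ∀ x : (LinearPMap.mkSpanSingleton m ‖m‖ hm0 : E →ₗ.[ℝ] ℝ).domain,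
      (LinearPMap.mkSpanSingleton m ‖m‖ hm0 : E →ₗ.[ℝ] ℝ) x ≤ ‖L.posPart x‖ := by
    rintro ⟨x, hx⟩
    obtain ⟨c, rfl⟩ := Submodule.mem_span_singleton.1 hx
    rw [LinearPMap.mkSpanSingleton'_apply]
    simp only [RingHom.id_apply, smul_eq_mul]
    rcases le_or_gt c 0 with hc | hc
    · exact (mul_nonpos_of_nonpos_of_nonneg hc (norm_nonneg _)).trans (norm_nonneg _)
    · rw [hN_hom c hc, hNm]
  obtain ⟨fr, hfr, hle⟩ := exists_extension_of_le_sublinear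
    (LinearPMap.mkSpanSingleton m ‖m‖ hm0) (fun x => ‖L.posPart x‖) hN_hom hN_add hdom
  have hfr_le : ∀ x, fr x ≤ ‖x‖ := fun x => (hle x).trans (L.norm_posPart_le x)
  have hfr_abs : ∀ x, |fr x| ≤ ‖x‖ := fun x => abs_le.2 ⟨by
    have := hfr_le (-x)
    rw [map_neg, norm_neg] at this
    linarith, hfr_le x⟩
  have hnull : ∀ f : E, (∀ᵐ x ∂μ, (L.ι f x).re ≤ 0) → fr f ≤ 0 := fun f hf => by
    refine (hle f).trans ?_
    rw [← norm_zero (E := E)]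
    refine L.norm_le_of_ae_le ?_
    filter_upwards [L.norm_ι_posPart f, hf] with x e₁ e₂
    rw [e₁, max_eq_right e₂]
    exact norm_nonneg _
  have hI : ∀ f : E, 0 ≤ L.ι f → fr (Complex.I • f) = 0 := fun f hf => by
    have h1 : ∀ᵐ x ∂μ, (L.ι (Complex.I • f) x).re = 0 := by
      filter_upwards [L.ι_smul Complex.I f, L.ae_eq_norm hf] with x e₁ e₂
      rw [e₁, e₂]
      simp
    refine le_antisymm (hnull _ (h1.mono fun x hx => hx.le)) ?_
    have h2 := hnull (-(Complex.I • f)) (by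
      filter_upwards [h1, L.ι_neg (Complex.I • f)] with x e₁ e₂
      rw [e₂, Complex.neg_re, e₁, neg_zero])
    rw [map_neg] at h2
    linarith
  let F : E →ₗ[ℂ] ℂ := Module.Dual.extendRCLike (𝕜 := ℂ) fr
  have hF : ∀ f, F f = (fr f : ℂ) - Complex.I * (fr (Complex.I • f) : ℂ) := fun f => rfl
  have hFpos : ∀ f, 0 ≤ L.ι f → F f = (fr f : ℂ) := fun f hf => by
    rw [hF, hI f hf]; simp
  refine ⟨F.mkContinuous 2 fun f => ?_, fun f hf => ?_, ?_, fun f => ?_⟩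
  · rw [hF]
    refine (norm_sub_le _ _).trans ?_
    rw [norm_mul, Complex.norm_I, one_mul, Complex.norm_real, Complex.norm_real, two_mul]
    refine add_le_add (hfr_abs f) ((hfr_abs _).trans ?_)
    rw [norm_smul, Complex.norm_I, one_mul]
  · rw [LinearMap.mkContinuous_apply, hFpos f hf]
    have h2 := hnull (-f) (by
      filter_upwards [L.ι_neg f, L.ae_eq_norm hf] with x e₁ e₂
      rw [e₁, e₂, Complex.neg_re, Complex.ofReal_re]
      exact neg_nonpos.2 (norm_nonneg _))
    rw [map_neg] at h2
    exact_mod_cast (by linarith : 0 ≤ fr f)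
  · rw [LinearMap.mkContinuous_apply, hFpos m hm]
    have := hfr ⟨m, Submodule.mem_span_singleton_self m⟩
    rw [LinearPMap.mkSpanSingleton_apply] at this
    exact_mod_cast this
  · rw [LinearMap.mkContinuous_apply, hF]
    simpa using hfr_le f

/-- Multiplication by the indicator function of `S`. -/
lemma exists_restrict {S : Set X} (hS : MeasurableSet S) :
    ∃ P : E →L[ℂ] E, ∀ f, ∀ᵐ x ∂μ, L.ι (P f) x = S.indicator (L.ι f) x := by
  have h := fun f => L.exists_of_norm_le f (g := S.indicator (L.ι f))
      ((L.aesm f).indicator hS) (Eventually.of_forall fun x => norm_indicator_le_norm_self _ _)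
  choose P hP hPn using h
  let P' : E →ₗ[ℂ] E :=
    { toFun := P
      map_add' := fun f g => by
        refine L.ext_ae ?_
        filter_upwards [hP (f + g), hP f, hP g, L.ι_add (P f) (P g), L.ι_add f g]
          with x e₁ e₂ e₃ e₄ e₅
        rw [e₁, e₄, e₂, e₃]
        by_cases hx : x ∈ S
        · simpa [hx] using e₅
        · simp [hx]
      map_smul' := fun c f => by
        refine L.ext_ae ?_
        filter_upwards [hP (c • f), hP f, L.ι_smul c (P f), L.ι_smul c f] with x e₁ e₂ e₃ e₄
        rw [e₁, RingHom.id_apply, e₃, e₂]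
        by_cases hx : x ∈ S
        · simpa [hx] using e₄
        · simp [hx] }
  exact ⟨P'.mkContinuous 1 fun f => by rw [one_mul]; exact hPn f, hP⟩

variable {L}

/-- Positive functionals tend to `0` along disjoint bounded sequences of nonnegative functions, if
the norms of `L` and `L*` are order continuous: the restrictions of the functional to the sets
`⋃ k ≥ n, supp (g k)` decrease to `0`. -/
theorem tendsto_functional_of_disjoint (hL : L.HasOrderContinuousNorm)
    (hL' : L.DualHasOrderContinuousNorm) {φ : E →L[ℂ] ℂ} (hφ : ∀ f, 0 ≤ L.ι f → 0 ≤ φ f)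
    {g : ℕ → E} (hg1 : ∀ n, ‖g n‖ ≤ 1)
    (hdis : ∀ᵐ x ∂μ, ∀ i j, i < j → L.ι (g i) x ≠ 0 → L.ι (g j) x = 0) :
    Tendsto (fun n => φ (g n)) atTop (𝓝 0) := by
  let S : ℕ → Set X := fun n => ⋃ k ≥ n, {x | L.ι (g k) x ≠ 0}
  have hS : ∀ n, MeasurableSet (S n) := fun n => MeasurableSet.biUnion (Set.to_countable _)
    fun k _ => (L.ι (g k)).measurable (measurableSet_singleton 0).compl
  have hSanti : Antitone S := fun n k hnk =>
    Set.biUnion_subset_biUnion_left fun i (hi : k ≤ i) => hnk.trans hi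
  have hSinter : ∀ᵐ x ∂μ, ∃ n, x ∉ S n := by
    filter_upwards [hdis] with x hx
    by_cases h : ∃ i, L.ι (g i) x ≠ 0
    · obtain ⟨i, hi⟩ := h
      refine ⟨i + 1, fun hmem => ?_⟩
      obtain ⟨k, hk, hk'⟩ := Set.mem_iUnion₂.1 hmem
      exact hk' (hx i k hk hi)
    · push Not at h
      refine ⟨0, fun hmem => ?_⟩
      obtain ⟨k, hk, hk'⟩ := Set.mem_iUnion₂.1 hmem
      exact hk' (h k)
  choose P hP using fun n => L.exists_restrict (hS n)
  have hPnorm : ∀ n f, ∀ᵐ x ∂μ, ‖L.ι (P n f) x‖ = (S n).indicator (fun x => ‖L.ι f x‖) x := by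
    intro n f
    filter_upwards [hP n f] with x hx
    rw [hx, norm_indicator_eq_indicator_norm]
  have hPpos : ∀ n f, 0 ≤ L.ι f → 0 ≤ L.ι (P n f) := fun n f hf => by
    rw [nonneg_iff] at hf ⊢
    filter_upwards [hP n f, hf] with x e₁ e₂
    rw [e₁]
    by_cases hx : x ∈ S n <;> simp [hx, e₂]
  have hPlim : ∀ f, 0 ≤ L.ι f → Tendsto (fun n => ‖P n f‖) atTop (𝓝 0) := by
    intro f hf
    have hall : ∀ᵐ x ∂μ, ∀ n, ‖L.ι (P n f) x‖ = (S n).indicator (fun x => ‖L.ι f x‖) x :=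
      ae_all_iff.2 fun n => hPnorm n f
    refine hL.tendsto_norm (fun n => hPpos n f hf) ?_ ?_
    · filter_upwards [hall] with x hx n k hnk
      simp only [hx]
      exact Set.indicator_le_indicator_of_subset (hSanti hnk) (fun _ => norm_nonneg _) x
    · filter_upwards [hall, hSinter] with x hx ⟨N, hN⟩
      refine tendsto_const_nhds.congr' ?_
      filter_upwards [eventually_ge_atTop N] with n hn
      rw [hx, Set.indicator_of_notMem fun h => hN (hSanti hn h)]
  have hmono : ∀ f h : E, 0 ≤ L.ι (h - f) → φ f ≤ φ h := fun f h hfh => by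
    have := hφ _ hfh
    rwa [map_sub, sub_nonneg] at this
  have hdual := hL' (fun n => φ.comp (P n)) (fun n k hnk f hf => by
      change φ (P k f) ≤ φ (P n f)
      refine hmono _ _ ?_
      rw [nonneg_iff] at hf ⊢
      filter_upwards [hP n f, hP k f, L.ι_sub (P n f) (P k f), hf] with x e₁ e₂ e₃ e₄
      rw [e₃, e₁, e₂, sub_nonneg]
      by_cases hx : x ∈ S k
      · simp [hx, hSanti hnk hx]
      · rw [Set.indicator_of_notMem hx]
        by_cases hx' : x ∈ S n <;> simp [hx', e₄])
    (fun n f hf => hφ _ (hPpos n f hf))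
    (fun ψ hψ f hf => by
      have h1 : Tendsto (fun n => φ (P n f)) atTop (𝓝 (φ 0)) :=
        (φ.continuous.tendsto 0).comp (tendsto_zero_iff_norm_tendsto_zero.2 (hPlim f hf))
      rw [map_zero] at h1
      exact ge_of_tendsto' h1 fun n => hψ n f hf)
  rw [tendsto_zero_iff_norm_tendsto_zero]
  refine squeeze_zero (fun n => norm_nonneg _) (fun n => ?_) hdual
  have h1 : P n (g n) = g n := by
    refine L.ext_ae ?_
    filter_upwards [hP n (g n)] with x hx
    rw [hx]
    by_cases h : L.ι (g n) x = 0
    · by_cases hxS : x ∈ S n <;> simp [hxS, h]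
    · rw [Set.indicator_of_mem]
      exact Set.mem_iUnion₂.2 ⟨n, le_refl n, h⟩
  calc ‖φ (g n)‖ = ‖φ.comp (P n) (g n)‖ := by rw [ContinuousLinearMap.comp_apply, h1]
    _ ≤ ‖φ.comp (P n)‖ * ‖g n‖ := ContinuousLinearMap.le_opNorm _ _
    _ ≤ ‖φ.comp (P n)‖ * 1 := by gcongr; exact hg1 n
    _ = _ := mul_one _

end Functionals

end BanachFunctionSpace

/-! ### The Hausdorff measure of noncompactness -/

section Noncompactness

variable {E : Type*} [NormedAddCommGroup E] [NormedSpace ℂ E]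

/-- The image of the closed unit ball under `A` has a finite `δ`-net. -/
def HasFiniteNet (A : E →L[ℂ] E) (δ : ℝ) : Prop :=
  ∃ M : Set E, M.Finite ∧ ∀ x, ‖x‖ ≤ 1 → ∃ m ∈ M, ‖A x - m‖ ≤ δ

lemma hasFiniteNet_iff {A : E →L[ℂ] E} {δ : ℝ} : HasFiniteNet A δ ↔
    ∃ M : Set E, M.Finite ∧ A '' Metric.closedBall 0 1 ⊆ M + Metric.closedBall 0 δ := by
  refine exists_congr fun M => and_congr_right fun _ => ⟨?_, ?_⟩
  · rintro h _ ⟨x, hx, rfl⟩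
    obtain ⟨m, hm, h1⟩ := h x (mem_closedBall_zero_iff.1 hx)
    exact ⟨m, hm, A x - m, mem_closedBall_zero_iff.2 h1, by simp⟩
  · intro h x hx
    obtain ⟨m, hm, z, hz, h1⟩ := h ⟨x, mem_closedBall_zero_iff.2 hx, rfl⟩
    refine ⟨m, hm, ?_⟩
    simp only at h1
    rw [← h1, add_sub_cancel_left]
    exact mem_closedBall_zero_iff.1 hz

lemma HasFiniteNet.mono {A : E →L[ℂ] E} {δ ε : ℝ} (h : HasFiniteNet A δ) (hδε : δ ≤ ε) :
    HasFiniteNet A ε := by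
  obtain ⟨M, hM, h⟩ := h
  refine ⟨M, hM, fun x hx => ?_⟩
  obtain ⟨m, hm, h1⟩ := h x hx
  exact ⟨m, hm, h1.trans hδε⟩

lemma HasFiniteNet.hausdorffNoncompactness_le {A : E →L[ℂ] E} {δ : ℝ≥0} (hδ : 0 < δ)
    (h : HasFiniteNet A δ) : hausdorffNoncompactness A ≤ δ :=
  iInf_le_of_le δ (iInf_le_of_le hδ (iInf_le_of_le (hasFiniteNet_iff.1 h) le_rfl))

lemma hasFiniteNet_of_lt {A : E →L[ℂ] E} {δ : ℝ≥0} (h : hausdorffNoncompactness A < δ) :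
    HasFiniteNet A δ := by
  simp only [hausdorffNoncompactness, iInf_lt_iff] at h
  obtain ⟨ε, hε, h1, h2⟩ := h
  exact (hasFiniteNet_iff.2 h1).mono (by exact_mod_cast h2.le)

lemma hausdorffNoncompactness_le_enorm (A : E →L[ℂ] E) :
    hausdorffNoncompactness A ≤ ‖A‖ₑ := by
  refine ENNReal.le_of_forall_pos_le_add fun ε hε _ => ?_
  rw [enorm_eq_nnnorm, ← ENNReal.coe_add]
  refine HasFiniteNet.hausdorffNoncompactness_le (by positivity)
    ⟨{0}, Set.finite_singleton 0, fun x hx => ⟨0, rfl, ?_⟩⟩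
  rw [sub_zero]
  push_cast
  calc ‖A x‖ ≤ ‖A‖ * 1 := A.le_opNorm_of_le hx
    _ ≤ ‖A‖ + ε := by rw [mul_one]; exact le_add_of_nonneg_right ε.2

/-- `γ(A B C) ≤ ‖A‖ γ(B) ‖C‖`. -/
lemma hausdorffNoncompactness_mul_mul_le (A B C : E →L[ℂ] E) :
    hausdorffNoncompactness (A * B * C) ≤ ‖A‖ₑ * hausdorffNoncompactness B * ‖C‖ₑ := by
  have hfin : hausdorffNoncompactness B ≠ ∞ :=
    ne_top_of_le_ne_top enorm_ne_top (hausdorffNoncompactness_le_enorm B)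
  have key : ∀ δ : ℝ≥0, hausdorffNoncompactness B < δ →
      hausdorffNoncompactness (A * B * C) ≤ ‖A‖ₑ * δ * ‖C‖ₑ := by
    intro δ hδ
    have hδ0 : 0 < δ := by
      have := (zero_le (a := hausdorffNoncompactness B)).trans_lt hδ
      exact_mod_cast this
    have h0 : ‖(0 : E →L[ℂ] E)‖ₑ = 0 := by rw [← ofReal_norm, norm_zero, ENNReal.ofReal_zero]
    rcases eq_or_ne A 0 with rfl | hA
    · rw [zero_mul, zero_mul, h0, zero_mul, zero_mul, ← h0]
      exact hausdorffNoncompactness_le_enorm 0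
    rcases eq_or_ne C 0 with rfl | hC
    · rw [mul_zero, h0, mul_zero, ← h0]
      exact hausdorffNoncompactness_le_enorm 0
    have hA' : 0 < ‖A‖₊ := by simpa [pos_iff_ne_zero] using hA
    have hC' : 0 < ‖C‖₊ := by simpa [pos_iff_ne_zero] using hC
    have hC'' : 0 < ‖C‖ := hC'
    rw [enorm_eq_nnnorm, enorm_eq_nnnorm, ← ENNReal.coe_mul, ← ENNReal.coe_mul]
    obtain ⟨M, hM, h⟩ := hasFiniteNet_of_lt hδ
    refine HasFiniteNet.hausdorffNoncompactness_le (by positivity)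
      ⟨(fun m => (‖C‖ : ℂ) • A m) '' M, hM.image _, fun x hx => ?_⟩
    obtain ⟨m, hm, h1⟩ := h ((‖C‖ : ℂ)⁻¹ • C x) (by
      rw [norm_smul, norm_inv, Complex.norm_real, norm_norm, inv_mul_le_iff₀ hC'', mul_one]
      simpa using C.le_opNorm_of_le hx)
    refine ⟨_, ⟨m, hm, rfl⟩, ?_⟩
    have h2 : (A * B * C) x - (‖C‖ : ℂ) • A m =
        (‖C‖ : ℂ) • A (B ((‖C‖ : ℂ)⁻¹ • C x) - m) := by
      have h0 : (‖C‖ : ℂ) ≠ 0 := by exact_mod_cast hC''.ne'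
      rw [map_sub, map_smul, map_smul, smul_sub, smul_smul, mul_inv_cancel₀ h0, one_smul]
      rfl
    simp only
    rw [h2, norm_smul, Complex.norm_real, norm_norm]
    push_cast
    calc ‖C‖ * ‖A (B ((‖C‖ : ℂ)⁻¹ • C x) - m)‖ ≤ ‖C‖ * (‖A‖ * δ) := by
          gcongr
          exact A.le_opNorm_of_le h1
      _ = _ := by ring
  have hcont : Tendsto (fun t : ℝ≥0∞ => ‖A‖ₑ * t * ‖C‖ₑ) (𝓝[>] hausdorffNoncompactness B)
      (𝓝 (‖A‖ₑ * hausdorffNoncompactness B * ‖C‖ₑ)) := by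
    refine Tendsto.mono_left ?_ nhdsWithin_le_nhds
    exact ((ENNReal.continuous_mul_const enorm_ne_top).comp
      (ENNReal.continuous_const_mul enorm_ne_top)).tendsto _
  have : (𝓝[>] hausdorffNoncompactness B).NeBot :=
    nhdsGT_neBot_of_exists_gt ⟨∞, hfin.lt_top⟩
  refine ge_of_tendsto hcont ?_
  filter_upwards [Ioo_mem_nhdsGT hfin.lt_top] with t ht
  lift t to ℝ≥0 using ht.2.ne
  exact key t ht.1

lemma HasFiniteNet.sum {m : ℕ} {α : Fin m → ℝ} (hα : ∀ j, 0 ≤ α j) (hs : ∑ j, α j = 1)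
    {A : Fin m → (E →L[ℂ] E)} {δ : ℝ} (h : ∀ j, HasFiniteNet (A j) δ) :
    HasFiniteNet (∑ j, (α j : ℂ) • A j) δ := by
  choose M hM h using h
  refine ⟨(fun v => ∑ j, (α j : ℂ) • v j) '' Set.univ.pi M, (Set.Finite.pi' hM).image _ |>.subset
    (Set.image_mono fun v hv j => hv j (Set.mem_univ j)), fun x hx => ?_⟩
  choose v hv h1 using fun j => h j x hx
  refine ⟨_, ⟨v, fun j _ => hv j, rfl⟩, ?_⟩
  simp only
  rw [sum_apply, ← Finset.sum_sub_distrib]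
  calc ‖∑ j, (((α j : ℂ) • A j) x - (α j : ℂ) • v j)‖
      ≤ ∑ j, ‖((α j : ℂ) • A j) x - (α j : ℂ) • v j‖ := norm_sum_le _ _
    _ ≤ ∑ j, α j * δ := Finset.sum_le_sum fun j _ => by
        rw [smul_apply, ← smul_sub, norm_smul, Complex.norm_real,
          Real.norm_of_nonneg (hα j)]
        exact mul_le_mul_of_nonneg_left (h1 j) (hα j)
    _ = δ := by rw [← Finset.sum_mul, hs, one_mul]

end Noncompactness

namespace BanachFunctionSpace

section Truncation

variable {X : Type*} [MeasurableSpace X] {μ : Measure X}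
  {E : Type*} [NormedAddCommGroup E] [NormedSpace ℂ E] [CompleteSpace E]
  {L : BanachFunctionSpace μ E}

lemma exists_excess (L : BanachFunctionSpace μ E) (f w : E) :
    ∃ k : E, ∀ᵐ x ∂μ, L.ι k x = ((max (‖L.ι f x‖ - ‖L.ι w x‖) 0 : ℝ) : ℂ) := by
  obtain ⟨k, hk, -⟩ := L.exists_of_norm_le f
    (g := fun x => ((max (‖L.ι f x‖ - ‖L.ι w x‖) 0 : ℝ) : ℂ))
    (Complex.measurable_ofReal.comp (((L.ι f).measurable.norm.sub
      (L.ι w).measurable.norm).max measurable_const)).aestronglyMeasurable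
    (Eventually.of_forall fun x => by
      rw [Complex.norm_real, Real.norm_of_nonneg (le_max_right _ _)]
      exact max_le (sub_le_self _ (norm_nonneg _)) (norm_nonneg _))
  exact ⟨k, hk⟩

/-- The function `(|f| - |w|)⁺`. -/
noncomputable def excess (L : BanachFunctionSpace μ E) (f w : E) : E := (L.exists_excess f w).choose

lemma ι_excess (f w : E) :
    ∀ᵐ x ∂μ, L.ι (L.excess f w) x = ((max (‖L.ι f x‖ - ‖L.ι w x‖) 0 : ℝ) : ℂ) :=
  (L.exists_excess f w).choose_spec

lemma excess_nonneg (f w : E) : 0 ≤ L.ι (L.excess f w) := by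
  rw [nonneg_iff]
  filter_upwards [L.ι_excess f w] with x hx
  rw [hx]
  exact_mod_cast le_max_right _ _

lemma norm_excess_le (f w : E) : ‖L.excess f w‖ ≤ ‖f‖ := by
  refine L.norm_le_of_ae_le ?_
  filter_upwards [L.ι_excess f w] with x hx
  rw [hx, Complex.norm_real, Real.norm_of_nonneg (le_max_right _ _)]
  exact max_le (sub_le_self _ (norm_nonneg _)) (norm_nonneg _)

lemma norm_apply_mono {B : E →L[ℂ] E} (hB : ∀ f, 0 ≤ L.ι f → 0 ≤ L.ι (B f)) {f g : E}
    (hf : 0 ≤ L.ι f) (hfg : 0 ≤ L.ι (g - f)) : ‖B f‖ ≤ ‖B g‖ := by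
  refine L.norm_le_of_ae_le ?_
  have h1 := hB _ hfg
  rw [map_sub] at h1
  filter_upwards [L.ι_sub (B g) (B f), (L.nonneg_iff _).1 h1, (L.nonneg_iff _).1 (hB f hf)]
    with x e₁ e₂ e₃
  rw [e₁, sub_nonneg] at e₂
  exact CStarAlgebra.norm_le_norm_of_nonneg_of_le e₃ e₂

/-- If the positive operator `B` maps the unit ball into `M + δ D`, with `M` finite and `D` the unit
ball, then `‖B (|f| - |w|)⁺‖ ≤ 3 δ` on the unit ball for some `w`. Otherwise there is a disjoint
sequence `gₙ ≥ 0` in the unit ball with `‖B gₙ‖ > 5 δ / 2`; but `B gₙ → 0` on positive functionals,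
so that an `m ∈ M` with `‖B gₙ - m‖ ≤ δ` for infinitely many `n` has norm at most `δ`. -/
theorem exists_excess_le (hL : L.HasOrderContinuousNorm)
    (hL' : L.DualHasOrderContinuousNorm) {B : E →L[ℂ] E}
    (hB : ∀ f, 0 ≤ L.ι f → 0 ≤ L.ι (B f)) {δ : ℝ} (hδ : 0 < δ) (hnet : HasFiniteNet B δ) :
    ∃ w : E, ∀ f : E, ‖f‖ ≤ 1 → ‖B (L.excess f w)‖ ≤ 3 * δ := by
  by_contra hcon
  push Not at hcon
  choose F hF1 hF2 using hcon
  let s : ℕ → E := fun n => Nat.rec 0 (fun n s => s + L.abs (F (((4 ^ n : ℝ) : ℂ) • s))) n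
  let f : ℕ → E := fun n => F (((4 ^ n : ℝ) : ℂ) • s n)
  have hs0 : s 0 = 0 := rfl
  have hsucc : ∀ n, s (n + 1) = s n + L.abs (f n) := fun n => rfl
  have hs : ∀ᵐ x ∂μ, ∀ n, L.ι (s n) x = ((∑ k ∈ Finset.range n, ‖L.ι (f k) x‖ : ℝ) : ℂ) := by
    refine ae_all_iff.2 fun n => ?_
    induction n with
    | zero => simpa [hs0] using L.ι_zero
    | succ n ih =>
      filter_upwards [ih, L.ι_add (s n) (L.abs (f n)), L.ι_abs (f n)] with x e₁ e₂ e₃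
      rw [hsucc, e₂, e₁, e₃, Finset.sum_range_succ]
      push_cast
      rfl
  -- the series of the geometrically weighted moduli
  let c : ℕ → E := fun k => (((1 / 2) ^ k : ℝ) : ℂ) • L.abs (f k)
  have hc : ∀ k, ∀ᵐ x ∂μ, L.ι (c k) x = (((1 / 2) ^ k * ‖L.ι (f k) x‖ : ℝ) : ℂ) := fun k => by
    filter_upwards [L.ι_smul (((1 / 2) ^ k : ℝ) : ℂ) (L.abs (f k)), L.ι_abs (f k)] with x e₁ e₂
    rw [e₁, e₂]
    push_cast
    rfl
  have hc0 : ∀ k, 0 ≤ L.ι (c k) := fun k => by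
    rw [nonneg_iff]
    filter_upwards [hc k] with x e₁
    rw [e₁]
    exact_mod_cast mul_nonneg (by positivity) (norm_nonneg _)
  have hcs : Summable c := by
    refine Summable.of_norm_bounded (g := fun n => (1 / 2 : ℝ) ^ n)
      (summable_geometric_of_lt_one (by norm_num) (by norm_num)) fun n => ?_
    rw [norm_smul, Complex.norm_real, Real.norm_of_nonneg (by positivity), norm_abs]
    exact mul_le_of_le_one_right (by positivity) (hF1 _)
  let y : E := L.abs (∑' k, c k)
  have hy : ∀ᵐ x ∂μ, L.ι y x = (‖L.ι (∑' k, c k) x‖ : ℂ) := L.ι_abs _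
  have hcy : ∀ᵐ x ∂μ, ∀ k, (1 / 2) ^ k * ‖L.ι (f k) x‖ ≤ ‖L.ι (∑' k, c k) x‖ := by
    refine ae_all_iff.2 fun k => ?_
    filter_upwards [L.term_le_tsum hc0 hcs k, hc k] with x e₁ e₂
    rwa [e₂, Complex.norm_real, Real.norm_of_nonneg (mul_nonneg (by positivity) (norm_nonneg _))]
      at e₁
  let b : ℕ → E := fun n => ((4 ^ n : ℝ) : ℂ) • s n + (((1 / 2) ^ n : ℝ) : ℂ) • y
  have hb : ∀ᵐ x ∂μ, ∀ n, ‖L.ι (b n) x‖ = 4 ^ n * (∑ k ∈ Finset.range n, ‖L.ι (f k) x‖) +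
      (1 / 2) ^ n * ‖L.ι (∑' k, c k) x‖ := by
    refine ae_all_iff.2 fun n => ?_
    filter_upwards [hs, hy, L.ι_add (((4 ^ n : ℝ) : ℂ) • s n) ((((1 / 2) ^ n : ℝ) : ℂ) • y),
      L.ι_smul ((4 ^ n : ℝ) : ℂ) (s n), L.ι_smul (((1 / 2) ^ n : ℝ) : ℂ) y] with x e₁ e₂ e₃ e₄ e₅
    rw [e₃, e₄, e₅, e₁, e₂, ← Complex.ofReal_mul, ← Complex.ofReal_mul, ← Complex.ofReal_add,
      Complex.norm_real, Real.norm_of_nonneg]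
    have : 0 ≤ ∑ k ∈ Finset.range n, ‖L.ι (f k) x‖ := Finset.sum_nonneg fun _ _ => norm_nonneg _
    positivity
  let g : ℕ → E := fun n => L.excess (f n) (b n)
  have hg1 : ∀ n, ‖g n‖ ≤ 1 := fun n => (norm_excess_le _ _).trans (hF1 _)
  have hgx : ∀ᵐ x ∂μ, ∀ n, L.ι (g n) x = ((max (‖L.ι (f n) x‖ - ‖L.ι (b n) x‖) 0 : ℝ) : ℂ) :=
    ae_all_iff.2 fun n => L.ι_excess _ _
  have hdis : ∀ᵐ x ∂μ, ∀ i j, i < j → L.ι (g i) x ≠ 0 → L.ι (g j) x = 0 := by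
    filter_upwards [hgx, hb, hcy] with x e₁ e₂ e₃ i j hij hi
    rw [e₁, Complex.ofReal_ne_zero] at hi
    rw [e₁, Complex.ofReal_eq_zero]
    have h1 : ‖L.ι (b i) x‖ < ‖L.ι (f i) x‖ := by
      by_contra h
      exact hi (max_eq_right (by linarith))
    refine max_eq_right (sub_nonpos.2 ?_)
    rw [e₂] at h1 ⊢
    set Y := ‖L.ι (∑' k, c k) x‖
    have hsum : ∀ n, 0 ≤ ∑ k ∈ Finset.range n, ‖L.ι (f k) x‖ :=
      fun n => Finset.sum_nonneg fun _ _ => norm_nonneg _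
    have h2 : ‖L.ι (f i) x‖ ≤ ∑ k ∈ Finset.range j, ‖L.ι (f k) x‖ :=
      Finset.single_le_sum (f := fun k => ‖L.ι (f k) x‖) (fun _ _ => norm_nonneg _)
        (Finset.mem_range.2 hij)
    have h3 : (1 / 2) ^ i * Y < ‖L.ι (f i) x‖ := by
      have : 0 ≤ (4 : ℝ) ^ i * ∑ k ∈ Finset.range i, ‖L.ι (f k) x‖ :=
        mul_nonneg (by positivity) (hsum i)
      linarith
    -- `f j ≤ 2 ^ j y ≤ 2 ^ (i + j) f i ≤ 4 ^ j f i`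
    have h4 : ‖L.ι (f j) x‖ ≤ 4 ^ j * ‖L.ι (f i) x‖ := by
      have h5 : ‖L.ι (f j) x‖ = 2 ^ j * ((1 / 2) ^ j * ‖L.ι (f j) x‖) := by
        rw [← mul_assoc, ← mul_pow]; norm_num
      have h6 : Y = 2 ^ i * ((1 / 2) ^ i * Y) := by
        rw [← mul_assoc, ← mul_pow]; norm_num
      have h7 : (2 : ℝ) ^ j * 2 ^ i ≤ 4 ^ j := by
        calc (2 : ℝ) ^ j * 2 ^ i ≤ 2 ^ j * 2 ^ j := by
              gcongr
              norm_num
          _ = 4 ^ j := by rw [← mul_pow]; norm_num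
      calc ‖L.ι (f j) x‖ = 2 ^ j * ((1 / 2) ^ j * ‖L.ι (f j) x‖) := h5
        _ ≤ 2 ^ j * Y := by gcongr; exact e₃ j
        _ = 2 ^ j * (2 ^ i * ((1 / 2) ^ i * Y)) := by rw [← h6]
        _ ≤ 2 ^ j * (2 ^ i * ‖L.ι (f i) x‖) := by gcongr
        _ = (2 ^ j * 2 ^ i) * ‖L.ι (f i) x‖ := by ring
        _ ≤ 4 ^ j * ‖L.ι (f i) x‖ := by gcongr
    calc ‖L.ι (f j) x‖ ≤ 4 ^ j * ‖L.ι (f i) x‖ := h4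
      _ ≤ 4 ^ j * ∑ k ∈ Finset.range j, ‖L.ι (f k) x‖ := by gcongr
      _ ≤ _ := le_add_of_nonneg_right (by positivity)
  have hlow : ∀ n, 3 * δ < ‖B (g n)‖ + (1 / 2) ^ n * ‖B y‖ := by
    intro n
    have h1 : ‖B (L.excess (f n) (((4 ^ n : ℝ) : ℂ) • s n))‖ ≤
        ‖B (g n + (((1 / 2) ^ n : ℝ) : ℂ) • y)‖ := by
      refine norm_apply_mono hB (excess_nonneg _ _) ?_
      rw [nonneg_iff]
      filter_upwards [hs, hy, hgx, hb, L.ι_smul ((4 ^ n : ℝ) : ℂ) (s n),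
        L.ι_smul (((1 / 2) ^ n : ℝ) : ℂ) y, L.ι_excess (f n) (((4 ^ n : ℝ) : ℂ) • s n),
        L.ι_add (g n) ((((1 / 2) ^ n : ℝ) : ℂ) • y),
        L.ι_sub (g n + (((1 / 2) ^ n : ℝ) : ℂ) • y) (L.excess (f n) (((4 ^ n : ℝ) : ℂ) • s n))]
        with x e₁ e₂ e₃ e₄ e₅ e₆ e₇ e₈ e₉
      have hsum : 0 ≤ ∑ k ∈ Finset.range n, ‖L.ι (f k) x‖ :=
        Finset.sum_nonneg fun _ _ => norm_nonneg _
      rw [e₉, e₈, e₃, e₆, e₂, e₇, e₅, e₁, e₄, norm_mul, Complex.norm_real, Complex.norm_real,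
        Real.norm_of_nonneg hsum, Real.norm_of_nonneg (by positivity)]
      set σ := ∑ k ∈ Finset.range n, ‖L.ι (f k) x‖
      set Y := ‖L.ι (∑' k, c k) x‖
      have hY : 0 ≤ (1 / 2 : ℝ) ^ n * Y := by positivity
      have : max (‖L.ι (f n) x‖ - 4 ^ n * σ) 0 ≤
          max (‖L.ι (f n) x‖ - (4 ^ n * σ + (1 / 2) ^ n * Y)) 0 + (1 / 2) ^ n * Y := by
        refine max_le ?_ (add_nonneg (le_max_right _ _) hY)
        have := le_max_left (‖L.ι (f n) x‖ - (4 ^ n * σ + (1 / 2) ^ n * Y)) 0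
        linarith
      rw [← Complex.ofReal_mul, ← Complex.ofReal_add, ← Complex.ofReal_sub]
      exact_mod_cast sub_nonneg.2 this
    refine (hF2 _).trans_le (h1.trans ?_)
    rw [map_add, map_smul]
    refine (norm_add_le _ _).trans ?_
    rw [norm_smul, Complex.norm_real, Real.norm_of_nonneg (by positivity)]
  have hev : ∀ᶠ n in atTop, 5 / 2 * δ < ‖B (g n)‖ := by
    have h1 : Tendsto (fun n : ℕ => (1 / 2 : ℝ) ^ n * ‖B y‖) atTop (𝓝 (0 * ‖B y‖)) :=
      (tendsto_pow_atTop_nhds_zero_of_lt_one (by norm_num) (by norm_num)).mul_const _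
    rw [zero_mul] at h1
    filter_upwards [h1.eventually (gt_mem_nhds (half_pos hδ))] with n hn
    have := hlow n
    linarith
  obtain ⟨M, hM, hMn⟩ := hnet
  obtain ⟨m, -, hm⟩ : ∃ m ∈ M, ∃ᶠ n in atTop, ‖B (g n) - m‖ ≤ δ := by
    by_contra h
    simp only [not_exists, not_and, not_frequently] at h
    have h2 := (eventually_all_finite hM).2 h
    obtain ⟨n, hn⟩ := h2.exists
    obtain ⟨m, hm, hm'⟩ := hMn (g n) (hg1 n)
    exact hn m hm hm'
  obtain ⟨φ, hφ, hφm, hφle⟩ := L.exists_positive_functional (L.abs_nonneg m)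
  have hlim := tendsto_functional_of_disjoint hL hL' (φ := φ.comp B)
    (fun f hf => hφ _ (hB f hf)) hg1 hdis
  rw [tendsto_zero_iff_norm_tendsto_zero] at hlim
  obtain ⟨n, hn1, hn2, hn3⟩ :=
    (hm.and_eventually ((hlim.eventually (gt_mem_nhds (by positivity : 0 < δ / 2))).and hev)).exists
  have hBg : 0 ≤ L.ι (B (g n)) := hB _ (excess_nonneg _ _)
  have h1 : ‖L.abs m - B (g n)‖ ≤ δ := by
    refine le_trans (L.norm_le_of_ae_le ?_) hn1
    filter_upwards [L.ι_sub (L.abs m) (B (g n)), L.ι_sub (B (g n)) m, L.ι_abs m,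
      L.ae_eq_norm hBg] with x e₁ e₂ e₃ e₄
    rw [e₁, e₂, e₃, e₄, ← Complex.ofReal_sub, Complex.norm_real, Real.norm_eq_abs, abs_sub_comm]
    refine (abs_norm_sub_norm_le _ _).trans_eq' ?_
    rw [Complex.norm_real, norm_norm]
  have h2 : ‖m‖ ≤ δ + ‖φ.comp B (g n)‖ := by
    have h3 := hφle (L.abs m - B (g n))
    rw [map_sub, Complex.sub_re, hφm, Complex.ofReal_re, norm_abs] at h3
    have h4 : (φ (B (g n))).re ≤ ‖φ.comp B (g n)‖ := Complex.re_le_norm _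
    linarith
  have h3 : ‖B (g n)‖ ≤ ‖B (g n) - m‖ + ‖m‖ := by
    simpa using norm_add_le (B (g n) - m) m
  linarith

/-- The part of `f` below `|w|`. -/
lemma exists_truncation (L : BanachFunctionSpace μ E) (f w : E) : ∃ k : E,
    (∀ᵐ x ∂μ, ‖L.ι k x‖ ≤ ‖L.ι w x‖) ∧
    ∀ᵐ x ∂μ, ‖L.ι (f - k) x‖ ≤ ‖L.ι (L.excess f w) x‖ := by
  classical
  have hfm : Measurable (L.ι f) := (L.ι f).measurable
  have hwm : Measurable (L.ι w) := (L.ι w).measurable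
  let k : X → ℂ := fun x => if ‖L.ι f x‖ ≤ ‖L.ι w x‖ then L.ι f x else
    ((‖L.ι w x‖ / ‖L.ι f x‖ : ℝ) : ℂ) * L.ι f x
  have hk : ∀ x, ¬ ‖L.ι f x‖ ≤ ‖L.ι w x‖ → 0 < ‖L.ι f x‖ := fun x hx =>
    (norm_nonneg _).trans_lt (not_le.1 hx)
  have hkw : ∀ x, ‖k x‖ ≤ ‖L.ι w x‖ := fun x => by
    simp only [k]
    split_ifs with hx
    · exact hx
    · rw [norm_mul, Complex.norm_real, Real.norm_of_nonneg (by positivity),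
        div_mul_cancel₀ _ (hk x hx).ne']
  have hkm : Measurable k := Measurable.ite (measurableSet_le hfm.norm hwm.norm) hfm
    ((Complex.measurable_ofReal.comp (hwm.norm.div hfm.norm)).mul hfm)
  obtain ⟨h, hh, -⟩ := L.exists_of_norm_le w hkm.aestronglyMeasurable (Eventually.of_forall hkw)
  refine ⟨h, ?_, ?_⟩
  · filter_upwards [hh] with x hx
    rw [hx]; exact hkw x
  · filter_upwards [hh, L.ι_sub f h, L.ι_excess f w] with x e₁ e₂ e₃
    rw [e₂, e₁, e₃, Complex.norm_real, Real.norm_of_nonneg (le_max_right _ _)]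
    simp only [k]
    split_ifs with hx
    · simp
    · have h1 : L.ι f x - ((‖L.ι w x‖ / ‖L.ι f x‖ : ℝ) : ℂ) * L.ι f x =
          ((1 - ‖L.ι w x‖ / ‖L.ι f x‖ : ℝ) : ℂ) * L.ι f x := by push_cast; ring
      rw [h1, norm_mul, Complex.norm_real, Real.norm_of_nonneg
        (sub_nonneg.2 (div_le_one_of_le₀ (not_le.1 hx).le (norm_nonneg _))), sub_mul, one_mul,
        div_mul_cancel₀ _ (hk x hx).ne']
      exact le_max_left _ _

/-- A quantitative form of the Dodds–Fremlin theorem: if `|C f| ≤ B |f|` and `C` maps order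
intervals to totally bounded sets, then `γ(C) ≤ 4 γ(B)`. -/
theorem HasFiniteNet.of_dominated (hL : L.HasOrderContinuousNorm)
    (hL' : L.DualHasOrderContinuousNorm) {B C : E →L[ℂ] E}
    (hB : ∀ f, 0 ≤ L.ι f → 0 ≤ L.ι (B f))
    (hBC : ∀ g f : E, 0 ≤ L.ι f → (∀ᵐ x ∂μ, ‖L.ι g x‖ ≤ ‖L.ι f x‖) →
      ∀ᵐ x ∂μ, ‖L.ι (C g) x‖ ≤ ‖L.ι (B f) x‖)
    (hC : ∀ w : E,
      TotallyBounded {g | ∃ f : E, (∀ᵐ x ∂μ, ‖L.ι f x‖ ≤ ‖L.ι w x‖) ∧ g = C f})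
    {δ : ℝ} (hδ : 0 < δ) (hnet : HasFiniteNet B δ) : HasFiniteNet C (4 * δ) := by
  obtain ⟨w, hw⟩ := exists_excess_le hL hL' hB hδ hnet
  obtain ⟨M, hM, hMC⟩ := Metric.totallyBounded_iff.1 (hC w) δ hδ
  refine ⟨M, hM, fun f hf => ?_⟩
  obtain ⟨k, hk1, hk2⟩ := L.exists_truncation f w
  obtain ⟨m, hm, hm'⟩ := Set.mem_iUnion₂.1 (hMC ⟨k, hk1, rfl⟩)
  refine ⟨m, hm, ?_⟩
  have h1 : ‖C (f - k)‖ ≤ 3 * δ :=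
    (L.norm_le_of_ae_le (hBC _ _ (excess_nonneg f w) hk2)).trans (hw f hf)
  have h2 : ‖C k - m‖ < δ := by rwa [Metric.mem_ball, dist_eq_norm] at hm'
  have h3 : C f - m = C (f - k) + (C k - m) := by rw [map_sub]; abel
  rw [h3]
  refine (norm_add_le _ _).trans ?_
  linarith

/-- `γ(C) ≤ 4 max γ(Aⱼ)` for a positive kernel operator `C` that is dominated by a weighted
geometric mean of the `Aⱼ`. -/
theorem GeomDominated.hausdorffNoncompactness_le [SigmaFinite μ] (hL : L.HasOrderContinuousNorm)
    (hL' : L.DualHasOrderContinuousNorm) {m : ℕ} {α : Fin m → ℝ} (hα : ∀ j, 0 ≤ α j)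
    (hs : ∑ j, α j = 1) {A : Fin m → (E →L[ℂ] E)} {C : E →L[ℂ] E}
    (h : L.GeomDominated α A C) (hC : L.IsPositiveKernelOperator C) {t : ℝ≥0∞}
    (ht : ∀ j, hausdorffNoncompactness (A j) ≤ t) : hausdorffNoncompactness C ≤ 4 * t := by
  rcases eq_or_ne t ∞ with rfl | httop
  · simp
  lift t to ℝ≥0 using httop
  refine ENNReal.le_of_forall_pos_le_add fun ε hε _ => ?_
  have hδ : 0 < t + ε / 4 := by positivity
  have h1 : ∀ j, HasFiniteNet (A j) (t + ε / 4 : ℝ≥0) := fun j => by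
    refine hasFiniteNet_of_lt ((ht j).trans_lt ?_)
    exact_mod_cast lt_add_of_pos_right t (by positivity)
  have hB : ∀ f, 0 ≤ L.ι f → 0 ≤ L.ι ((∑ j, (α j : ℂ) • A j) f) := fun f hf => by
    rw [sum_apply, nonneg_iff]
    have h2 : ∀ᵐ x ∂μ, ∀ j, 0 ≤ L.ι (((α j : ℂ) • A j) f) x := ae_all_iff.2 fun j => by
      filter_upwards [L.ι_smul (α j) (A j f), (L.nonneg_iff _).1 (h.pos j f hf)] with x e₁ e₂
      rw [smul_apply, e₁]
      exact mul_nonneg (by exact_mod_cast hα j) e₂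
    filter_upwards [L.ι_sum Finset.univ fun j => ((α j : ℂ) • A j) f, h2] with x e₁ e₂
    rw [e₁]
    exact Finset.sum_nonneg fun j _ => e₂ j
  have h2 := HasFiniteNet.of_dominated hL hL' hB (h.norm_apply_le hα hs)
    (hC.totallyBounded hL) (δ := (t + ε / 4 : ℝ≥0)) (by exact_mod_cast hδ)
    (HasFiniteNet.sum hα hs h1)
  have h3 : (4 * ((t + ε / 4 : ℝ≥0) : ℝ)) = ((4 * t + ε : ℝ≥0) : ℝ) := by push_cast; ring
  rw [h3] at h2
  have := h2.hausdorffNoncompactness_le (by positivity)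
  exact_mod_cast this

end Truncation

end BanachFunctionSpace

/-! ### The Calkin algebra -/

section Calkin

variable {E : Type*} [NormedAddCommGroup E] [NormedSpace ℂ E]

lemma mem_compactOperatorIdeal {A : E →L[ℂ] E} :
    A ∈ compactOperatorIdeal E ↔ IsCompactOperator A := by
  rw [TwoSidedIdeal.mem_iff]
  change IsCompactOperator (A - 0 : E →L[ℂ] E) ↔ _
  rw [sub_zero]

lemma calkin_eq_iff {A B : E →L[ℂ] E} :
    (A : CalkinAlgebra E) = (B : CalkinAlgebra E) ↔ IsCompactOperator (A - B : E →L[ℂ] E) := by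
  rw [RingCon.eq, TwoSidedIdeal.rel_iff, mem_compactOperatorIdeal]

lemma HasFiniteNet.mul {A B : E →L[ℂ] E} {δ ε : ℝ} (hε : 0 < ε) (hA : HasFiniteNet A δ)
    (hB : HasFiniteNet B ε) : HasFiniteNet (A * B) (ε * δ) := by
  obtain ⟨M, hM, hA⟩ := hA
  obtain ⟨N, hN, hB⟩ := hB
  refine ⟨(fun p : E × E => A p.1 + (ε : ℂ) • p.2) '' (N ×ˢ M), (hN.prod hM).image _,
    fun x hx => ?_⟩
  have hε' : (ε : ℂ) ≠ 0 := by exact_mod_cast hε.ne'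
  obtain ⟨n, hn, h1⟩ := hB x hx
  obtain ⟨m, hm, h2⟩ := hA ((ε : ℂ)⁻¹ • (B x - n)) (by
    rw [norm_smul, norm_inv, Complex.norm_real, Real.norm_of_nonneg hε.le, inv_mul_le_iff₀ hε,
      mul_one]
    exact h1)
  refine ⟨_, ⟨(n, m), ⟨hn, hm⟩, rfl⟩, ?_⟩
  have h3 : (A * B) x - (A n + (ε : ℂ) • m) = (ε : ℂ) • (A ((ε : ℂ)⁻¹ • (B x - n)) - m) := by
    rw [map_smul, smul_sub, smul_smul, mul_inv_cancel₀ hε', one_smul, map_sub]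
    change A (B x) - _ = _
    abel
  simp only
  rw [h3, norm_smul, Complex.norm_real, Real.norm_of_nonneg hε.le]
  gcongr

lemma HasFiniteNet.pow {A : E →L[ℂ] E} {δ : ℝ} (hδ : 0 < δ) (h : HasFiniteNet A δ) (k : ℕ) :
    HasFiniteNet (A ^ (k + 1)) (δ ^ (k + 1)) := by
  induction k with
  | zero => simpa using h
  | succ k ih =>
    rw [pow_succ A, pow_succ' δ]
    exact ih.mul hδ h

/-- The kernel of `1 - S` is finite dimensional if `S` contracts noncompactness: its unit
ball has finite nets as fine as those of the powers of `S`. -/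
lemma HasFiniteNet.finiteDimensional_ker {S : E →L[ℂ] E} {δ : ℝ} (hδ0 : 0 < δ) (hδ : δ < 1)
    (h : HasFiniteNet S δ) : FiniteDimensional ℂ (1 - S : E →L[ℂ] E).ker := by
  set K := (1 - S : E →L[ℂ] E).ker
  have hK : ∀ x ∈ K, ∀ k : ℕ, (S ^ k) x = x := by
    intro x hx k
    have h1 : S x = x := by
      have : x - S x = 0 := hx
      exact (sub_eq_zero.1 this).symm
    induction k with
    | zero => simp
    | succ k ih => rw [pow_succ, mul_apply_eq_comp, h1, ih]
  have htb : TotallyBounded ((↑) ⁻¹' ((K : Set E) ∩ Metric.closedBall 0 1) : Set K) := by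
    refine totallyBounded_preimage isUniformEmbedding_subtype_val.isUniformInducing
      (Metric.totallyBounded_iff.2 fun ε hε => ?_)
    obtain ⟨k, hk⟩ := exists_pow_lt_of_lt_one hε hδ
    obtain ⟨M, hM, hnet⟩ := h.pow hδ0 k
    refine ⟨M, hM, fun x hx => ?_⟩
    obtain ⟨m, hm, h1⟩ := hnet x (mem_closedBall_zero_iff.1 hx.2)
    rw [hK x hx.1] at h1
    refine Set.mem_iUnion₂.2 ⟨m, hm, ?_⟩
    rw [Metric.mem_ball, dist_eq_norm]
    refine h1.trans_lt (lt_of_le_of_lt ?_ hk)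
    exact pow_le_pow_of_le_one hδ0.le hδ.le (Nat.le_succ k)
  refine FiniteDimensional.of_totallyBounded_nhds_zero ℂ
    (Metric.closedBall_mem_nhds (0 : K) one_pos) (htb.subset ?_)
  exact fun x hx => ⟨x.2, by simpa using hx⟩

/-- The range of `1 - S` has finite codimension if `S` contracts noncompactness: modulo the span of
the net, `S` is a contraction. -/
lemma HasFiniteNet.exists_sup_range_eq_top [CompleteSpace E] {S : E →L[ℂ] E} {δ : ℝ}
    (hδ0 : 0 < δ) (hδ : δ < 1) (h : HasFiniteNet S δ) :
    ∃ V : Submodule ℂ E, FiniteDimensional ℂ V ∧ V ⊔ (1 - S : E →L[ℂ] E).range = ⊤ := by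
  obtain ⟨M, hM, h⟩ := h
  have hVfin : FiniteDimensional ℂ (Submodule.span ℂ M) := FiniteDimensional.span_of_finite ℂ hM
  refine ⟨Submodule.span ℂ M, hVfin, ?_⟩
  have hMV : M ⊆ Submodule.span ℂ M := Submodule.subset_span
  set V := Submodule.span ℂ M
  have hVc : IsClosed (V : Set E) := V.closed_of_finiteDimensional
  set π : E →L[ℂ] E ⧸ V := V.mkQL
  have hπ : ∀ x, ‖π (S x)‖ ≤ δ * ‖x‖ := by
    intro x
    rcases eq_or_ne x 0 with rfl | hx
    · simp
    have hx' : 0 < ‖x‖ := norm_pos_iff.2 hx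
    have hx0 : (‖x‖ : ℂ) ≠ 0 := by exact_mod_cast hx'.ne'
    obtain ⟨m, hm, h1⟩ := h ((‖x‖ : ℂ)⁻¹ • x) (by simp [norm_smul, hx'.ne'])
    have h2 : π (S x) = π ((‖x‖ : ℂ) • (S ((‖x‖ : ℂ)⁻¹ • x) - m)) := by
      rw [smul_sub, ← map_smul S, smul_smul, mul_inv_cancel₀ hx0, one_smul, map_sub, eq_comm,
        sub_eq_self]
      exact (Submodule.Quotient.mk_eq_zero V).2 (V.smul_mem _ (hMV hm))
    rw [h2]
    refine (Submodule.Quotient.norm_mk_le V _).trans ?_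
    rw [norm_smul, Complex.norm_real, norm_norm, mul_comm]
    gcongr
  obtain ⟨r, hr, hrδ⟩ : ∃ r : ℝ, 1 < r ∧ r * δ < 1 := by
    obtain ⟨r, h1, h2⟩ := exists_between ((one_lt_inv₀ hδ0).2 hδ)
    exact ⟨r, h1, by rwa [← lt_div_iff₀ hδ0, one_div]⟩
  have hr0 : 0 < r := one_pos.trans hr
  have hlift : ∀ y : E ⧸ V, ∃ x, ‖x‖ ≤ (⟨r, hr0.le⟩ : ℝ≥0) * ‖y‖ ∧ π x = y := by
    intro y
    rcases eq_or_ne y 0 with rfl | hy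
    · exact ⟨0, by simp, by simp⟩
    have hy' : 0 < ‖y‖ := norm_pos_iff.2 hy
    obtain ⟨x, h1, h2⟩ := Submodule.Quotient.norm_mk_lt y (mul_pos (sub_pos.2 hr) hy')
    refine ⟨x, ?_, h1⟩
    change ‖x‖ ≤ r * ‖y‖
    linarith
  choose g hg1 hg2 using hlift
  let R : π.NonlinearRightInverse := ⟨g, _, hg1, hg2⟩
  have happ : ApproximatesLinearOn (π ∘L (1 - S)) π Set.univ ⟨δ, hδ0.le⟩ := by
    intro x _ y _
    have : (π ∘L (1 - S)) x - (π ∘L (1 - S)) y - π (x - y) = - π (S (x - y)) := by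
      simp
      abel
    rw [this, norm_neg]
    exact hπ _
  have hpos : 0 < r⁻¹ - δ := by
    rw [sub_pos, ← one_div, lt_div_iff₀ hr0, mul_comm]
    exact hrδ
  rw [eq_top_iff]
  intro y _
  obtain ⟨x, -, hx⟩ := happ.surjOn_closedBall_of_nonlinearRightInverse R (b := 0)
    (ε := ‖π y‖ / (r⁻¹ - δ)) (by positivity) (Set.subset_univ _) (by
      change π y ∈ Metric.closedBall _ ((r⁻¹ - δ) * _)
      rw [mul_div_cancel₀ _ hpos.ne']
      simp)
  refine Submodule.mem_sup.2 ⟨y - (1 - S) x, ?_, (1 - S) x, ⟨x, rfl⟩, sub_add_cancel _ _⟩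
  exact (Submodule.Quotient.eq V).1 hx.symm

/-- If `S` contracts noncompactness, then `1 - S` is invertible modulo compact operators. -/
theorem HasFiniteNet.isUnit_calkin [CompleteSpace E] {S : E →L[ℂ] E} {δ : ℝ} (hδ0 : 0 < δ)
    (hδ : δ < 1) (h : HasFiniteNet S δ) : IsUnit ((1 - S : E →L[ℂ] E) : CalkinAlgebra E) := by
  have hker := h.finiteDimensional_ker hδ0 hδ
  obtain ⟨V, hV, hVT⟩ := h.exists_sup_range_eq_top hδ0 hδ
  set T : E →L[ℂ] E := 1 - S
  -- a finite-dimensional complement of the range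
  obtain ⟨F, hF⟩ := T.range.exists_isCompl
  have hFfin : FiniteDimensional ℂ F := by
    have hq : FiniteDimensional ℂ (E ⧸ T.range) := by
      refine Module.Finite.of_surjective (T.range.mkQ ∘ₗ V.subtype) ?_
      rw [← LinearMap.range_eq_top, LinearMap.range_comp, Submodule.range_subtype,
        Submodule.map_mkQ_eq_top, sup_comm]
      exact hVT
    exact (T.range.quotientEquivOfIsCompl F hF).finiteDimensional
  obtain ⟨N, hN⟩ := (Submodule.ClosedComplemented.of_finiteDimensional T.ker).exists_isTopCompl
  have hNc : IsClosed (N : Set E) := hN.symm.isClosed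
  have : CompleteSpace N := hNc.completeSpace_coe
  have : CompleteSpace F := FiniteDimensional.complete ℂ F
  let Φ : (N × F) →L[ℂ] E := (T ∘L N.subtypeL).coprod F.subtypeL
  have hΦ : ∀ x : N × F, Φ x = T x.1 + x.2 := fun x => rfl
  have hinj : Φ.ker = ⊥ := by
    refine (Submodule.eq_bot_iff _).2 fun x hx => ?_
    have h0 : T x.1 + x.2 = 0 := hx
    have h1 : (x.2 : E) ∈ T.range := by
      rw [← neg_eq_of_add_eq_zero_right h0]
      exact T.range.neg_mem ⟨_, rfl⟩
    have h2 : (x.2 : E) = 0 := Submodule.disjoint_def.1 hF.disjoint _ h1 x.2.2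
    rw [h2, add_zero] at h0
    have h3 : (x.1 : E) = 0 := Submodule.disjoint_def.1 hN.isCompl.disjoint _ h0 x.1.2
    exact Prod.ext (Subtype.ext h3) (Subtype.ext h2)
  have hsurj : Φ.range = ⊤ := by
    refine eq_top_iff.2 fun y _ => ?_
    obtain ⟨_, ⟨x, rfl⟩, f, hf, rfl⟩ := Submodule.mem_sup.1
      (hF.codisjoint.eq_top ▸ Submodule.mem_top : y ∈ T.range ⊔ F)
    obtain ⟨k, hk, n, hn, rfl⟩ := Submodule.mem_sup.1
      (hN.isCompl.codisjoint.eq_top ▸ Submodule.mem_top : x ∈ T.ker ⊔ N)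
    refine ⟨(⟨n, hn⟩, ⟨f, hf⟩), ?_⟩
    have hk' : T k = 0 := hk
    change T n + f = T (k + n) + f
    rw [map_add, hk', zero_add]
  let e := ContinuousLinearEquiv.ofBijective Φ hinj hsurj
  let U : E →L[ℂ] E := N.subtypeL ∘L (ContinuousLinearMap.fst ℂ N F) ∘L (e.symm : E →L[ℂ] N × F)
  have he : ∀ y, T (e.symm y).1 + (e.symm y).2 = y := fun y => e.apply_symm_apply y
  have hFp : LocallyCompactSpace F := by
    have := FiniteDimensional.proper ℂ F
    infer_instance
  have hKp : LocallyCompactSpace T.ker := by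
    have := FiniteDimensional.proper ℂ T.ker
    infer_instance
  have h1 : IsCompactOperator (T * U - 1 : E →L[ℂ] E) := by
    have h2 : T * U - 1 =
        (-F.subtypeL) ∘L ((ContinuousLinearMap.snd ℂ N F) ∘L (e.symm : E →L[ℂ] N × F)) := by
      ext y
      change T (e.symm y).1 - y = -((e.symm y).2 : E)
      rw [sub_eq_iff_eq_add, ← sub_eq_neg_add, eq_sub_iff_add_eq]
      exact he y
    rw [h2]
    exact (isCompactOperator_of_locallyCompactSpace_rng (-F.subtypeL)).comp_clm _
  have h2 : IsCompactOperator (U * T - 1 : E →L[ℂ] E) := by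
    have h3 : ∀ x, (U * T - 1 : E →L[ℂ] E) x ∈ T.ker := by
      intro x
      have h4 : T x - T (e.symm (T x)).1 = (e.symm (T x)).2 := by
        rw [sub_eq_iff_eq_add, add_comm]
        exact (he (T x)).symm
      have h5 : ((e.symm (T x)).2 : E) = 0 := by
        refine Submodule.disjoint_def.1 hF.disjoint _ ?_ (e.symm (T x)).2.2
        rw [← h4]
        exact T.range.sub_mem ⟨_, rfl⟩ ⟨_, rfl⟩
      change T ((e.symm (T x)).1 - x) = 0
      rw [map_sub, ← neg_sub, h4, h5, neg_zero]
    have h4 : (U * T - 1 : E →L[ℂ] E) = T.ker.subtypeL ∘L (U * T - 1).codRestrict T.ker h3 := rfl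
    rw [h4]
    exact (isCompactOperator_of_locallyCompactSpace_rng T.ker.subtypeL).comp_clm
      ((U * T - 1).codRestrict T.ker h3)
  refine ⟨⟨(T : CalkinAlgebra E), (U : CalkinAlgebra E), ?_, ?_⟩, rfl⟩
  · exact calkin_eq_iff.2 h1
  · exact calkin_eq_iff.2 h2

/-- `ρ_ess(A) ≤ γ(A)`. -/
theorem essSpectralRadius_le_hausdorffNoncompactness [CompleteSpace E] (A : E →L[ℂ] E) :
    essSpectralRadius A ≤ hausdorffNoncompactness A := by
  refine iSup₂_le fun k hk => ?_
  by_contra hlt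
  rw [not_le] at hlt
  refine hk ?_
  have hk0 : k ≠ 0 := by
    rintro rfl
    simp at hlt
  have hnk : 0 < ‖k‖ := norm_pos_iff.2 hk0
  obtain ⟨δ, h1, h2⟩ := ENNReal.lt_iff_exists_nnreal_btwn.1 hlt
  have hδ : 0 < δ := by exact_mod_cast zero_le.trans_lt h1
  obtain ⟨M, hM, h3⟩ := hasFiniteNet_of_lt h1
  have hnet : HasFiniteNet (k⁻¹ • A) (‖k‖⁻¹ * δ) := by
    refine ⟨(fun m => k⁻¹ • m) '' M, hM.image _, fun x hx => ?_⟩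
    obtain ⟨m, hm, h4⟩ := h3 x hx
    refine ⟨_, ⟨m, hm, rfl⟩, ?_⟩
    simp only
    rw [smul_apply, ← smul_sub, norm_smul, norm_inv]
    gcongr
  have h5 := hnet.isUnit_calkin (by positivity) (by
    rw [inv_mul_lt_iff₀ hnk, mul_one]
    exact_mod_cast h2)
  have h6 : algebraMap ℂ (CalkinAlgebra E) k - (A : CalkinAlgebra E) =
      Units.mk0 k hk0 • ((1 - k⁻¹ • A : E →L[ℂ] E) : CalkinAlgebra E) := by
    have : algebraMap ℂ (E →L[ℂ] E) k - A = k • (1 - k⁻¹ • A) := by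
      rw [smul_sub, smul_smul, mul_inv_cancel₀ hk0, one_smul, Algebra.algebraMap_eq_smul_one]
    exact congrArg (fun B : E →L[ℂ] E => (B : CalkinAlgebra E)) this
  change IsUnit (_ - _)
  rw [h6]
  exact h5.smul _

end Calkin

/-! ### The quotient norm on the Calkin algebra -/

section CalkinNorm

variable {E : Type*} [NormedAddCommGroup E] [NormedSpace ℂ E]

variable (E) in
/-- The additive group of compact operators, used for the quotient norm on the Calkin algebra. -/
def compactAddSubgroup : AddSubgroup (E →L[ℂ] E) where
  carrier := {T | IsCompactOperator T}
  zero_mem' := isCompactOperator_zero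
  add_mem' hx hy := IsCompactOperator.add hx hy
  neg_mem' hx := IsCompactOperator.neg hx

instance [CompleteSpace E] : IsClosed (compactAddSubgroup E : Set (E →L[ℂ] E)) :=
  isClosed_setOfPred_isCompactOperator

variable (E) in
/-- The Calkin algebra as the quotient of a normed group. -/
def calkinToQuotient : CalkinAlgebra E →+ (E →L[ℂ] E) ⧸ compactAddSubgroup E where
  toFun := Quotient.lift (fun A => QuotientAddGroup.mk A) fun A B h => by
    rw [eq_comm, QuotientAddGroup.eq, neg_add_eq_sub]
    exact h
  map_zero' := rfl
  map_add' a b := Quotient.inductionOn₂ a b fun _ _ => rfl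

lemma calkinToQuotient_injective : Function.Injective (calkinToQuotient E) := by
  intro a b
  refine Quotient.inductionOn₂ a b fun A B h => ?_
  have h1 := QuotientAddGroup.eq.1 h.symm
  rw [neg_add_eq_sub] at h1
  exact calkin_eq_iff.2 h1

lemma calkinToQuotient_surjective : Function.Surjective (calkinToQuotient E) := by
  intro a
  obtain ⟨A, rfl⟩ := QuotientAddGroup.mk_surjective a
  exact ⟨(A : CalkinAlgebra E), rfl⟩

lemma exists_lift_norm_lt (a : CalkinAlgebra E) {ε : ℝ} (hε : 0 < ε) :
    ∃ A : E →L[ℂ] E, (A : CalkinAlgebra E) = a ∧ ‖A‖ < ‖calkinToQuotient E a‖ + ε := by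
  obtain ⟨A, h1, h2⟩ := QuotientAddGroup.exists_norm_mk_lt (calkinToQuotient E a) hε
  exact ⟨A, calkinToQuotient_injective h1, h2⟩

lemma norm_calkinToQuotient_le (A : E →L[ℂ] E) : ‖calkinToQuotient E A‖ ≤ ‖A‖ :=
  QuotientAddGroup.norm_mk_le_norm

lemma norm_calkinToQuotient_mul_le (a b : CalkinAlgebra E) :
    ‖calkinToQuotient E (a * b)‖ ≤ ‖calkinToQuotient E a‖ * ‖calkinToQuotient E b‖ := by
  have hlim : Tendsto (fun ε : ℝ => (‖calkinToQuotient E a‖ + ε) * (‖calkinToQuotient E b‖ + ε))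
      (𝓝[>] 0) (𝓝 ((‖calkinToQuotient E a‖ + 0) * (‖calkinToQuotient E b‖ + 0))) := by
    refine Tendsto.mono_left (Continuous.tendsto ?_ _) nhdsWithin_le_nhds
    fun_prop
  rw [add_zero, add_zero] at hlim
  refine ge_of_tendsto hlim ?_
  filter_upwards [self_mem_nhdsWithin] with ε hε
  obtain ⟨A, rfl, hA⟩ := exists_lift_norm_lt a hε
  obtain ⟨B, rfl, hB⟩ := exists_lift_norm_lt b hε
  calc ‖calkinToQuotient E ((A * B : E →L[ℂ] E) : CalkinAlgebra E)‖ ≤ ‖A * B‖ :=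
        norm_calkinToQuotient_le _
    _ ≤ ‖A‖ * ‖B‖ := norm_mul_le _ _
    _ ≤ _ := mul_le_mul hA.le hB.le (norm_nonneg _) ((norm_nonneg _).trans hA.le)

lemma norm_calkinToQuotient_smul_le (c : ℂ) (a : CalkinAlgebra E) :
    ‖calkinToQuotient E (c • a)‖ ≤ ‖c‖ * ‖calkinToQuotient E a‖ := by
  have hlim : Tendsto (fun ε : ℝ => ‖c‖ * (‖calkinToQuotient E a‖ + ε))
      (𝓝[>] 0) (𝓝 (‖c‖ * (‖calkinToQuotient E a‖ + 0))) := by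
    refine Tendsto.mono_left (Continuous.tendsto ?_ _) nhdsWithin_le_nhds
    fun_prop
  rw [add_zero] at hlim
  refine ge_of_tendsto hlim ?_
  filter_upwards [self_mem_nhdsWithin] with ε hε
  obtain ⟨A, rfl, hA⟩ := exists_lift_norm_lt a hε
  calc ‖calkinToQuotient E ((c • A : E →L[ℂ] E) : CalkinAlgebra E)‖ ≤ ‖c • A‖ :=
        norm_calkinToQuotient_le _
    _ = ‖c‖ * ‖A‖ := norm_smul _ _
    _ ≤ _ := by gcongr

variable (E) in
/-- The Calkin algebra with the quotient norm. -/
noncomputable abbrev calkinNormedRing [CompleteSpace E] : NormedRing (CalkinAlgebra E) :=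
  { NormedAddCommGroup.induced (CalkinAlgebra E) _ (calkinToQuotient E) calkinToQuotient_injective,
    (inferInstance : Ring (CalkinAlgebra E)) with
    norm_mul_le := norm_calkinToQuotient_mul_le }

variable (E) in
/-- The Calkin algebra is a normed algebra for the quotient norm. -/
noncomputable abbrev calkinNormedAlgebra [CompleteSpace E] :
    @NormedAlgebra ℂ (CalkinAlgebra E) _ (calkinNormedRing E).toSeminormedRing :=
  letI := calkinNormedRing E
  { (inferInstance : Algebra ℂ (CalkinAlgebra E)) with
    norm_smul_le := norm_calkinToQuotient_smul_le }

lemma calkin_completeSpace [CompleteSpace E] :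
    @CompleteSpace (CalkinAlgebra E) (calkinNormedRing E).toUniformSpace := by
  let _ := calkinNormedRing E
  have h : Isometry (calkinToQuotient E) :=
    AddMonoidHomClass.isometry_of_norm (calkinToQuotient E) fun _ => rfl
  exact (h.isUniformInducing.completeSpace_congr calkinToQuotient_surjective).2 inferInstance

lemma IsCompactOperator.hasFiniteNet {A : E →L[ℂ] E} (hA : IsCompactOperator A) {ε : ℝ}
    (hε : 0 < ε) : HasFiniteNet A ε := by
  have h1 : TotallyBounded (A '' Metric.closedBall 0 1) :=
    (hA.isCompact_closure_image_closedBall (f := A.toLinearMap) 1).totallyBounded.subset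
      subset_closure
  obtain ⟨M, hM, h2⟩ := Metric.totallyBounded_iff.1 h1 ε hε
  refine ⟨M, hM, fun x hx => ?_⟩
  obtain ⟨m, hm, h3⟩ := Set.mem_iUnion₂.1 (h2 ⟨x, mem_closedBall_zero_iff.2 hx, rfl⟩)
  exact ⟨m, hm, by rw [← dist_eq_norm]; exact (Metric.mem_ball.1 h3).le⟩

/-- The measure of noncompactness is at most the norm in the Calkin algebra. -/
lemma hausdorffNoncompactness_le_norm_calkin (A : E →L[ℂ] E) :
    hausdorffNoncompactness A ≤ ENNReal.ofReal ‖calkinToQuotient E A‖ := by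
  refine ENNReal.le_of_forall_pos_le_add fun ε hε _ => ?_
  have hε2 : (0 : ℝ) < ε / 2 := by positivity
  obtain ⟨B, h1, h2⟩ := exists_lift_norm_lt (A : CalkinAlgebra E) hε2
  obtain ⟨M, hM, h3⟩ := (calkin_eq_iff.1 h1.symm).hasFiniteNet hε2
  set s := ‖calkinToQuotient E A‖
  have hs : 0 ≤ s := norm_nonneg (calkinToQuotient E A)
  have h4 : ENNReal.ofReal s + ε = ((⟨s, hs⟩ + ε : ℝ≥0) : ℝ≥0∞) := by
    rw [ENNReal.ofReal_eq_coe_nnreal hs]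
    exact (ENNReal.coe_add _ _).symm
  rw [h4]
  refine HasFiniteNet.hausdorffNoncompactness_le (by positivity) ⟨M, hM, fun x hx => ?_⟩
  obtain ⟨m, hm, h5⟩ := h3 x hx
  refine ⟨m, hm, ?_⟩
  calc ‖A x - m‖ = ‖B x + ((A - B) x - m)‖ := by
        congr 1
        rw [sub_apply]
        abel
    _ ≤ ‖B x‖ + ‖(A - B) x - m‖ := norm_add_le _ _
    _ ≤ ‖B‖ * 1 + ε / 2 := add_le_add (B.le_opNorm_of_le hx) h5
    _ ≤ s + ε := by linarith

lemma eventually_hausdorffNoncompactness_pow_le [CompleteSpace E] {A : E →L[ℂ] E} {t : ℝ≥0∞}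
    (h : essSpectralRadius A < t) : ∀ᶠ n : ℕ in atTop, hausdorffNoncompactness (A ^ n) ≤ t ^ n := by
  let _ := calkinNormedRing E
  let _ := calkinNormedAlgebra E
  have := calkin_completeSpace (E := E)
  have h1 := (spectrum.pow_nnnorm_pow_one_div_tendsto_nhds_spectralRadius
    (A : CalkinAlgebra E)).limsup_eq
  have h2 := eventually_le_pow_of_limsup_lt (v := fun n => (‖(A : CalkinAlgebra E) ^ n‖₊ : ℝ≥0∞))
    (h1.trans_lt h)
  filter_upwards [h2] with n hn
  refine le_trans ?_ hn
  refine (hausdorffNoncompactness_le_norm_calkin (A ^ n)).trans_eq ?_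
  exact ofReal_norm ((A : CalkinAlgebra E) ^ n)

/-- If `γ(C ^ n) ≤ K t ^ n` for all `t > ℓ` and large `n`, then `ρ_ess(C) ≤ ℓ`. -/
lemma essSpectralRadius_le_of_eventually [CompleteSpace E] {C : E →L[ℂ] E} {ℓ K : ℝ≥0∞}
    (hK : K ≠ ∞) (h : ∀ t, ℓ < t → t ≠ ∞ →
      ∀ᶠ n in atTop, hausdorffNoncompactness (C ^ n) ≤ K * t ^ n) :
    essSpectralRadius C ≤ ℓ := by
  have h1 := limsup_rpow_le (u := fun n => essSpectralRadius C ^ n) (d := id) (s := 1) (τ := 1)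
    (ℓ := ℓ) hK one_pos ?_ fun t ht htop => ?_
  · rw [ENNReal.rpow_one] at h1
    refine le_trans (le_of_eq ?_) h1
    refine (Tendsto.limsup_eq (tendsto_const_nhds.congr' ?_)).symm
    filter_upwards [eventually_gt_atTop 0] with n hn
    have hn0 : (n : ℝ) ≠ 0 := by positivity
    rw [← ENNReal.rpow_natCast, ← ENNReal.rpow_mul, mul_one_div_cancel hn0, ENNReal.rpow_one]
  · refine tendsto_const_nhds.congr' ?_
    filter_upwards [eventually_gt_atTop 0] with k hk
    have hk0' : (k : ℝ) ≠ 0 := by positivity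
    simp only [id]
    field_simp
  · filter_upwards [h t ht htop, eventually_gt_atTop 0] with n hn hn0
    rw [ENNReal.rpow_one]
    refine le_trans ?_ ((essSpectralRadius_le_hausdorffNoncompactness (C ^ n)).trans hn)
    exact spectrum.spectralRadius_pow_le (𝕜 := ℂ) (C : CalkinAlgebra E) n hn0.ne'

end CalkinNorm

namespace BanachFunctionSpace

/-! ### Radii of sets of dominated operators -/

section DominatedRadii

variable {X : Type*} [MeasurableSpace X] {μ : Measure X} [SigmaFinite μ]
  {E : Type*} [NormedAddCommGroup E] [NormedSpace ℂ E] [CompleteSpace E]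
  {L : BanachFunctionSpace μ E} {m : ℕ} {α : Fin m → ℝ} {s : ℝ}

/-- The quantity `q` of a positive kernel operator that is dominated by the geometric mean with
weights `αⱼ` of positive kernel operators `Aⱼ` is at most `K * (max q(Aⱼ)) ^ s`. -/
def MeanBounded (L : BanachFunctionSpace μ E) {m : ℕ} (α : Fin m → ℝ) (s : ℝ) (K : ℝ≥0∞)
    (q : (E →L[ℂ] E) → ℝ≥0∞) : Prop :=
  ∀ (A : Fin m → (E →L[ℂ] E)) (C : E →L[ℂ] E), L.GeomDominated α A C →
    L.IsPositiveKernelOperator C → (∀ j, L.IsPositiveKernelOperator (A j)) →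
    ∀ t : ℝ≥0∞, (∀ j, q (A j) ≤ t) → q C ≤ K * t ^ s

lemma MeanBounded.radiusOf_le {K : ℝ≥0∞} {q : (E →L[ℂ] E) → ℝ≥0∞} (hq : L.MeanBounded α s K q)
    (hK : K ≠ ∞) (hs : 0 < s) {𝒞 Ψ : Set (E →L[ℂ] E)}
    (h𝒞 : ∀ C ∈ 𝒞, L.IsPositiveKernelOperator C) (hΨ : ∀ A ∈ Ψ, L.IsPositiveKernelOperator A)
    (h : ∀ C ∈ 𝒞, ∃ A : Fin m → (E →L[ℂ] E), (∀ j, A j ∈ Ψ) ∧ L.GeomDominated α A C) :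
    radiusOf q 𝒞 ≤ radiusOf q Ψ ^ s := by
  refine _root_.radiusOf_le hK hs fun k hk C hC => ?_
  obtain ⟨A, hA, hAC⟩ := exists_geomDominated_of_mem_pow h k C hC
  obtain ⟨k, rfl⟩ := Nat.exists_eq_succ_of_ne_zero (by omega : k ≠ 0)
  exact hq A C hAC (isPositiveKernelOperator_of_mem_pow h𝒞 k C hC)
    (fun j => isPositiveKernelOperator_of_mem_pow hΨ k _ (hA j)) _
    fun j => le_iSup₂ (f := fun (B : E →L[ℂ] E) (_ : B ∈ Ψ ^ (k + 1)) => q B) (A j) (hA j)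

lemma IsPositiveKernelOperator.pow {A : E →L[ℂ] E} (hA : L.IsPositiveKernelOperator A) {n : ℕ}
    (hn : 1 ≤ n) : L.IsPositiveKernelOperator (A ^ n) := by
  obtain ⟨n, rfl⟩ := Nat.exists_eq_succ_of_ne_zero (by omega : n ≠ 0)
  exact isPositiveKernelOperator_of_mem_pow (Ψ := {A}) (by simpa using hA) n _ (by simp)

omit [SigmaFinite μ] in
lemma meanBounded_enorm (hα : ∀ j, 0 ≤ α j) (hs : ∑ j, α j = 1) :
    L.MeanBounded α 1 1 (fun A => ‖A‖ₑ) := by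
  intro A C h _ _ t ht
  rw [one_mul, ENNReal.rpow_one]
  rcases eq_or_ne t ∞ with rfl | htop
  · exact le_top
  lift t to ℝ≥0 using htop
  have h1 := h.opNorm_le hα hs t.2 fun j => by
    have h2 : (‖A j‖₊ : ℝ≥0∞) ≤ t := ht j
    exact_mod_cast h2
  change (‖C‖₊ : ℝ≥0∞) ≤ t
  exact_mod_cast h1

lemma MeanBounded.spectralRadius (h : L.MeanBounded α s 1 (fun A => ‖A‖ₑ)) (hs : 0 < s) :
    L.MeanBounded α s 1 (fun A => spectralRadius ℂ A) := by
  intro A C hAC hC hA t ht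
  rw [one_mul]
  refine spectralRadius_le_of_eventually hs fun u hu _ => ?_
  filter_upwards [eventually_all.2 fun j => eventually_enorm_pow_le ((ht j).trans_lt hu),
    eventually_ge_atTop 1] with n hn hn1
  simpa only [one_mul] using
    h _ _ (hAC.pow n) (hC.pow hn1) (fun j => (hA j).pow hn1) (u ^ n) hn

lemma meanBounded_hausdorffNoncompactness (hL : L.HasOrderContinuousNorm)
    (hL' : L.DualHasOrderContinuousNorm) (hα : ∀ j, 0 ≤ α j) (hs : ∑ j, α j = 1) :
    L.MeanBounded α 1 4 hausdorffNoncompactness := by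
  intro A C hAC hC _ t ht
  rw [ENNReal.rpow_one]
  exact hAC.hausdorffNoncompactness_le hL hL' hα hs hC ht

lemma meanBounded_essSpectralRadius (hL : L.HasOrderContinuousNorm)
    (hL' : L.DualHasOrderContinuousNorm) (hα : ∀ j, 0 ≤ α j) (hs : ∑ j, α j = 1) :
    L.MeanBounded α 1 1 essSpectralRadius := by
  intro A C hAC hC _ t ht
  rw [ENNReal.rpow_one, one_mul]
  refine essSpectralRadius_le_of_eventually (K := 4) (by simp) fun u hu _ => ?_
  filter_upwards [eventually_all.2 fun j =>
    eventually_hausdorffNoncompactness_pow_le ((ht j).trans_lt hu),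
    eventually_ge_atTop 1] with n hn hn1
  exact (hAC.pow n).hausdorffNoncompactness_le hL hL' hα hs (hC.pow hn1) hn

lemma isPositiveKernelOperator_of_mem_mul {Ψ Θ : Set (E →L[ℂ] E)}
    (hΨ : ∀ A ∈ Ψ, L.IsPositiveKernelOperator A) (hΘ : ∀ A ∈ Θ, L.IsPositiveKernelOperator A) :
    ∀ A ∈ Ψ * Θ, L.IsPositiveKernelOperator A := by
  rintro _ ⟨A, hA, B, hB, rfl⟩
  exact (hΨ A hA).mul (hΘ B hB)

omit [SigmaFinite μ] in
lemma isPositiveKernelOperator_of_mem_hadamard {Ψ : Fin m → Set (E →L[ℂ] E)} :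
    ∀ C ∈ L.hadamard α Ψ, L.IsPositiveKernelOperator C := by
  rintro C ⟨A, -, hAC⟩
  exact hAC.isPositiveKernelOperator

/-- `r(Ψ) = r(Ψ^(α₁) ∘ ⋯ ∘ Ψ^(α_m))` if `∑ αⱼ = 1`. -/
lemma MeanBounded.radiusOf_hadamard {K : ℝ≥0∞} {q : (E →L[ℂ] E) → ℝ≥0∞}
    (hq : L.MeanBounded α 1 K q) (hK : K ≠ ∞) (hα : ∀ j, 0 ≤ α j) (hs : ∑ j, α j = 1)
    {Ψ : Set (E →L[ℂ] E)} (hΨ : ∀ A ∈ Ψ, L.IsPositiveKernelOperator A) :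
    radiusOf q (L.hadamard α (fun _ => Ψ)) = radiusOf q Ψ := by
  refine le_antisymm ?_ (radiusOf_mono q (subset_hadamard hα hs hΨ))
  simpa only [ENNReal.rpow_one] using
    hq.radiusOf_le hK one_pos isPositiveKernelOperator_of_mem_hadamard hΨ
      (exists_geomDominated_of_mem_hadamard hα (holderExponents_of_sum_eq_one μ hα hs))

lemma MeanBounded.radiusOf_hadamard_mul_hadamard {K : ℝ≥0∞} {q : (E →L[ℂ] E) → ℝ≥0∞}
    (hq : L.MeanBounded α 1 K q) (hK : K ≠ ∞) (hα : ∀ j, 0 ≤ α j) (hs : ∑ j, α j = 1)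
    {Ψ Θ : Set (E →L[ℂ] E)} (hΨ : ∀ A ∈ Ψ, L.IsPositiveKernelOperator A)
    (hΘ : ∀ A ∈ Θ, L.IsPositiveKernelOperator A) :
    radiusOf q (L.hadamard α (fun _ => Ψ) * L.hadamard α (fun _ => Θ)) = radiusOf q (Ψ * Θ) := by
  refine le_antisymm ?_
    (radiusOf_mono q (Set.mul_subset_mul (subset_hadamard hα hs hΨ) (subset_hadamard hα hs hΘ)))
  have h := fun Ψ => exists_geomDominated_of_mem_hadamard (L := L) (Ψ := Ψ) hα
    (holderExponents_of_sum_eq_one μ hα hs)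
  simpa only [ENNReal.rpow_one] using
    hq.radiusOf_le hK one_pos (𝒞 := L.hadamard α (fun _ => Ψ) * L.hadamard α (fun _ => Θ))
      (isPositiveKernelOperator_of_mem_mul isPositiveKernelOperator_of_mem_hadamard
        isPositiveKernelOperator_of_mem_hadamard)
      (isPositiveKernelOperator_of_mem_mul hΨ hΘ) (by
        rintro _ ⟨C, hC, D, hD, rfl⟩
        obtain ⟨A, hA, hAC⟩ := h Ψ C hC
        obtain ⟨B, hB, hBD⟩ := h Θ D hD
        exact ⟨fun j => A j * B j, fun j => Set.mul_mem_mul (hA j) (hB j), hAC.mul hBD⟩)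

/-- If `r(Ψ Θ) = r(Θ Ψ)`, then `r(Ψ Θ)` is every weighted geometric mean of the two radii. -/
lemma MeanBounded.radiusOf_mul_eq {K : ℝ≥0∞} {q : (E →L[ℂ] E) → ℝ≥0∞}
    (hq : L.MeanBounded α 1 K q) (hK : K ≠ ∞) (hα : ∀ j, 0 ≤ α j) (hs : ∑ j, α j = 1)
    {Ψ Θ : Set (E →L[ℂ] E)} (hΨ : ∀ A ∈ Ψ, L.IsPositiveKernelOperator A)
    (hΘ : ∀ A ∈ Θ, L.IsPositiveKernelOperator A)
    (hcomm : radiusOf q (Ψ * Θ) = radiusOf q (Θ * Ψ)) {β : ℝ} (hβ : β ∈ Set.Icc (0 : ℝ) 1) :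
    radiusOf q (Ψ * Θ) = radiusOf q (L.hadamard α (fun _ => Ψ * Θ)) ^ β *
      radiusOf q (L.hadamard α (fun _ => Θ * Ψ)) ^ (1 - β) := by
  rw [hq.radiusOf_hadamard hK hα hs (isPositiveKernelOperator_of_mem_mul hΨ hΘ),
    hq.radiusOf_hadamard hK hα hs (isPositiveKernelOperator_of_mem_mul hΘ hΨ), ← hcomm,
    ← ENNReal.rpow_add_of_nonneg _ _ hβ.1 (sub_nonneg.2 hβ.2), add_sub_cancel, ENNReal.rpow_one]

end DominatedRadii

end BanachFunctionSpace

/-! ### Exponents with sum at least one on sequence spaces -/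

/-- If `0 ≤ xⱼ ≤ N` and `s = ∑ αⱼ ≥ 1`, then `∏ xⱼ ^ αⱼ = (∏ xⱼ ^ (αⱼ / s)) ^ s` is at most
`N ^ (s - 1) ∑ (αⱼ / s) xⱼ`. -/
lemma prod_rpow_le_of_le {m : ℕ} {α x : Fin m → ℝ} {N : ℝ} (hα : ∀ j, 0 ≤ α j)
    (hs : 1 ≤ ∑ j, α j) (hx0 : ∀ j, 0 ≤ x j) (hxN : ∀ j, x j ≤ N) :
    ∏ j, x j ^ α j ≤ N ^ (∑ j, α j - 1) * ∑ j, (α j / ∑ i, α i) * x j := by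
  set s := ∑ j, α j
  have hs0 : 0 < s := by linarith
  have hp0 : ∀ j, 0 ≤ α j / s := fun j => div_nonneg (hα j) hs0.le
  have hp1 : ∑ j, α j / s = 1 := by rw [← Finset.sum_div, div_self hs0.ne']
  set M := ∑ j, (α j / s) * x j
  have hM0 : 0 ≤ M := Finset.sum_nonneg fun j _ => mul_nonneg (hp0 j) (hx0 j)
  have hMN : M ≤ N := by
    calc M ≤ ∑ j, (α j / s) * N :=
          Finset.sum_le_sum fun j _ => mul_le_mul_of_nonneg_left (hxN j) (hp0 j)
      _ = N := by rw [← Finset.sum_mul, hp1, one_mul]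
  calc ∏ j, x j ^ α j = (∏ j, x j ^ (α j / s)) ^ s := by
        rw [← Real.finsetProd_rpow _ _ fun j _ => Real.rpow_nonneg (hx0 j) _]
        refine Finset.prod_congr rfl fun j _ => ?_
        rw [← Real.rpow_mul (hx0 j), div_mul_cancel₀ _ hs0.ne']
    _ ≤ M ^ s := Real.rpow_le_rpow (Finset.prod_nonneg fun j _ => Real.rpow_nonneg (hx0 j) _)
        (Real.geom_mean_le_arith_mean_weighted _ _ _ (fun j _ => hp0 j) hp1 fun j _ => hx0 j) hs0.le
    _ = M ^ (s - 1) * M := by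
        conv_lhs => rw [← sub_add_cancel s 1]
        rw [Real.rpow_add_of_nonneg hM0 (sub_nonneg.2 hs) zero_le_one, Real.rpow_one]
    _ ≤ N ^ (s - 1) * M := by
        have := sub_nonneg.2 hs
        gcongr

namespace BanachFunctionSpace

section SequenceSpace

variable {X : Type*} [MeasurableSpace X] [Countable X] [MeasurableSingletonClass X]
  {E : Type*} [NormedAddCommGroup E] [NormedSpace ℂ E] [CompleteSpace E]
  {L : BanachFunctionSpace (Measure.count : Measure X) E} {m : ℕ} {α : Fin m → ℝ}

lemma IsNonnegMatrixOperator.isPositiveKernelOperator {A : E →L[ℂ] E}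
    (hA : L.IsNonnegMatrixOperator A) : L.IsPositiveKernelOperator A := by
  obtain ⟨a, ha0, ha⟩ := hA
  refine HasKernel.isPositiveKernelOperator (a := fun p => a p.1 p.2) (fun p => ha0 _ _)
    ⟨Measurable.of_discrete.aemeasurable, fun f => ?_⟩
  refine ae_of_all _ fun x => ?_
  have h1 : Integrable (fun y => (a x y : ℂ) * L.ι f y) (Measure.count : Measure X) :=
    integrable_count_iff.2 (ha f x).summable.norm
  refine ⟨h1, ?_⟩
  rw [integral_countable h1, (ha f x).tsum_eq.symm]
  simp

/-- The space contains the unit vectors, and they have norm `1`. -/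
def HasUnitVectors (L : BanachFunctionSpace (Measure.count : Measure X) E) : Prop :=
  ∀ n : X, ∃ e : E, ⇑(L.ι e) =ᵐ[Measure.count] Set.indicator {n} (fun _ => (1 : ℂ)) ∧ ‖e‖ = 1

omit [Countable X] [MeasurableSingletonClass X] in
lemma norm_ι_apply_le (hL : L.HasUnitVectors) (f : E) (x : X) : ‖L.ι f x‖ ≤ ‖f‖ := by
  obtain ⟨e, he, he1⟩ := hL x
  have h1 : ‖(‖L.ι f x‖ : ℂ) • e‖ ≤ ‖f‖ := by
    refine L.norm_le_of_ae_le ?_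
    filter_upwards [he, L.ι_smul (‖L.ι f x‖ : ℂ) e] with y h2 h3
    rw [h3, h2, norm_mul, Complex.norm_real, norm_norm]
    by_cases hy : y = x
    · subst hy
      simp
    · simp [hy]
  rwa [norm_smul, Complex.norm_real, norm_norm, he1, mul_one] at h1

/-- The columns of the matrix are the images of the unit vectors. -/
lemma HasKernel.apply_unitVector {A : E →L[ℂ] E} {a : X × X → ℂ} (ha : L.HasKernel A a) {y : X}
    {e : E} (he : ⇑(L.ι e) =ᵐ[Measure.count] Set.indicator {y} (fun _ => (1 : ℂ))) (x : X) :
    L.ι (A e) x = a (x, y) := by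
  have h1 := Measure.ae_count_iff.1 he
  have h2 := (Measure.ae_count_iff.1 (ha.2 e) x)
  rw [h2.2, integral_countable h2.1, tsum_eq_single y]
  · simp [h1]
  · intro z hz
    simp [h1, hz]

lemma HasKernel.le_opNorm (hL : L.HasUnitVectors) {A : E →L[ℂ] E} {a : X × X → ℝ}
    (ha : L.HasKernel A (fun p => (a p : ℂ))) (p : X × X) : a p ≤ ‖A‖ := by
  obtain ⟨e, he, he1⟩ := hL p.2
  have h1 := norm_ι_apply_le hL (A e) p.1
  rw [ha.apply_unitVector he, Complex.norm_real] at h1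
  calc a p ≤ ‖a p‖ := le_abs_self _
    _ ≤ ‖A e‖ := h1
    _ ≤ ‖A‖ * ‖e‖ := A.le_opNorm e
    _ = ‖A‖ := by rw [he1, mul_one]

/-- Domination, tested on the unit vectors, is an entrywise inequality of matrices. -/
lemma GeomDominated.kernel_le (hL : L.HasUnitVectors) {A : Fin m → (E →L[ℂ] E)}
    {C : E →L[ℂ] E} (h : L.GeomDominated α A C) {a : Fin m → X × X → ℝ} {c : X × X → ℂ}
    (ha0 : ∀ j p, 0 ≤ a j p) (ha : ∀ j, L.HasKernel (A j) (fun p => (a j p : ℂ)))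
    (hc : L.HasKernel C c) (p : X × X) : ‖c p‖ ≤ ∏ j, a j p ^ α j := by
  obtain ⟨e, he, -⟩ := hL p.2
  have he' := Measure.ae_count_iff.1 he
  have h1 := Measure.ae_count_iff.1 (h.le e (fun _ => e)
    (fun _ => (L.nonneg_iff _).2 (ae_of_all _ fun x => by
      rw [he']
      exact Set.indicator_nonneg (fun _ _ => zero_le_one) x))
    (ae_of_all _ fun x => by
      rw [he']
      by_cases hx : x = p.2
      · simp [hx]
      · simp only [Set.mem_singleton_iff, hx, not_false_eq_true, Set.indicator_of_notMem, norm_zero]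
        exact Finset.prod_nonneg fun j _ => Real.rpow_nonneg le_rfl _)) p.1
  rw [hc.apply_unitVector he] at h1
  refine h1.trans_eq (Finset.prod_congr rfl fun j _ => ?_)
  rw [(ha j).apply_unitVector he, Complex.norm_real, Real.norm_of_nonneg (ha0 _ _)]

lemma hadamardDefined_of_one_le_sum (hL : L.HasUnitVectors) (hα : ∀ j, 0 ≤ α j)
    (hs : 1 ≤ ∑ j, α j) {Ψ : Fin m → Set (E →L[ℂ] E)}
    (hΨ : ∀ j, ∀ A ∈ Ψ j, L.IsPositiveKernelOperator A) : L.HadamardDefined α Ψ := by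
  refine hadamardDefined_of_le hΨ fun A a _ ha0 ha => ?_
  have hN : ∀ j, ‖A j‖ ≤ ∑ i, ‖A i‖ := fun j =>
    Finset.single_le_sum (f := fun i => ‖A i‖) (fun _ _ => norm_nonneg _) (Finset.mem_univ j)
  have hN0 : 0 ≤ ∑ i, ‖A i‖ := Finset.sum_nonneg fun _ _ => norm_nonneg _
  refine ⟨fun j => (∑ i, ‖A i‖) ^ (∑ j, α j - 1) * (α j / ∑ i, α i), fun j =>
    mul_nonneg (Real.rpow_nonneg hN0 _) (div_nonneg (hα j) (by linarith)), ae_of_all _ fun p => ?_⟩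
  refine (prod_rpow_le_of_le hα hs (fun j => ha0 j p)
    fun j => ((ha j).le_opNorm hL p).trans (hN j)).trans_eq ?_
  rw [Finset.mul_sum]
  exact Finset.sum_congr rfl fun j _ => (mul_assoc _ _ _).symm

lemma GeomDominated.opNorm_le_rpow (hL : L.HasUnitVectors) (hα : ∀ j, 0 ≤ α j)
    (hs : 1 ≤ ∑ j, α j) {A : Fin m → (E →L[ℂ] E)} {C : E →L[ℂ] E} (h : L.GeomDominated α A C)
    (hC : L.IsPositiveKernelOperator C) (hA : ∀ j, L.IsPositiveKernelOperator (A j)) {N : ℝ}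
    (hN : 0 ≤ N) (hAN : ∀ j, ‖A j‖ ≤ N) : ‖C‖ ≤ N ^ ∑ j, α j := by
  choose a _ ha0 ha using fun j => (hA j).exists_kernel
  obtain ⟨c, _, _, hc⟩ := hC.exists_kernel
  set s := ∑ j, α j
  have hs0 : 0 < s := by linarith
  let t : Fin m → ℝ := fun j => N ^ (s - 1) * (α j / s)
  have ht0 : ∀ j, 0 ≤ t j := fun j =>
    mul_nonneg (Real.rpow_nonneg hN _) (div_nonneg (hα j) hs0.le)
  have ht : ∑ j, t j * N = N ^ s := by
    rw [← Finset.sum_mul, ← Finset.mul_sum, ← Finset.sum_div, div_self hs0.ne', mul_one]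
    conv_rhs => rw [← sub_add_cancel s 1]
    rw [Real.rpow_add_of_nonneg hN (sub_nonneg.2 hs) zero_le_one, Real.rpow_one]
  have hB : L.HasKernel (∑ j, (t j : ℂ) • A j) (fun p => ((∑ j, t j * a j p : ℝ) : ℂ)) := by
    push_cast
    exact HasKernel.sum _ fun j _ => (ha j).smul (t j)
  have hle : ∀ p, ‖(c p : ℂ)‖ ≤ ∑ j, t j * a j p := fun p => by
    refine (h.kernel_le hL ha0 ha hc p).trans ((prod_rpow_le_of_le hα hs (fun j => ha0 j p)
      fun j => ((ha j).le_opNorm hL p).trans (hAN j)).trans_eq ?_)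
    rw [Finset.mul_sum]
    exact Finset.sum_congr rfl fun j _ => (mul_assoc _ _ _).symm
  have hBN : ‖∑ j, (t j : ℂ) • A j‖ ≤ N ^ s := by
    calc ‖∑ j, (t j : ℂ) • A j‖ ≤ ∑ j, ‖(t j : ℂ) • A j‖ := norm_sum_le _ _
      _ ≤ ∑ j, t j * N := Finset.sum_le_sum fun j _ => by
          rw [norm_smul, Complex.norm_real, Real.norm_of_nonneg (ht0 j)]
          exact mul_le_mul_of_nonneg_left (hAN j) (ht0 j)
      _ = N ^ s := ht
  refine C.opNorm_le_bound (Real.rpow_nonneg hN _) fun g => ?_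
  calc ‖C g‖ ≤ ‖(∑ j, (t j : ℂ) • A j) (L.abs g)‖ := by
        refine L.norm_le_of_ae_le ?_
        filter_upwards [HasKernel.norm_apply_le (c := fun p => (c p : ℂ)) (f := g)
          (fun p => Finset.sum_nonneg fun j _ => mul_nonneg (ht0 j) (ha0 j p)) hB, hc.2 g]
          with x h1 h2
        rw [h2.2]
        exact enorm_le_iff_norm_le.1 (h1 (ae_of_all _ fun y => hle (x, y)))
    _ ≤ ‖∑ j, (t j : ℂ) • A j‖ * ‖L.abs g‖ := ContinuousLinearMap.le_opNorm _ _
    _ ≤ N ^ s * ‖g‖ := by rw [norm_abs]; gcongr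

lemma meanBounded_enorm_rpow (hL : L.HasUnitVectors) (hα : ∀ j, 0 ≤ α j) (hs : 1 ≤ ∑ j, α j) :
    L.MeanBounded α (∑ j, α j) 1 (fun A => ‖A‖ₑ) := by
  intro A C h hC hA t ht
  rw [one_mul]
  have hs0 : 0 < ∑ j, α j := by linarith
  rcases eq_or_ne t ∞ with rfl | htop
  · rw [ENNReal.top_rpow_of_pos hs0]
    exact le_top
  lift t to ℝ≥0 using htop
  have h1 := h.opNorm_le_rpow hL hα hs hC hA t.2 fun j => by
    have h2 : (‖A j‖₊ : ℝ≥0∞) ≤ t := ht j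
    exact_mod_cast h2
  change (‖C‖₊ : ℝ≥0∞) ≤ _
  rw [← ENNReal.coe_rpow_of_nonneg _ hs0.le]
  exact_mod_cast h1

omit [Countable X] [MeasurableSingletonClass X] in
/-- Domination of kernels is domination by a geometric mean with a single factor. -/
lemma HasKernel.geomDominated {C D : E →L[ℂ] E} {c : X × X → ℂ} {d : X × X → ℝ}
    (hd0 : ∀ p, 0 ≤ d p) (hd : L.HasKernel D (fun p => (d p : ℂ))) (hc : L.HasKernel C c)
    (hcd : ∀ p, ‖c p‖ ≤ d p) : L.GeomDominated (fun _ : Fin 1 => (1 : ℝ)) (fun _ => D) C where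
  pos _ := hd.pos hd0
  le g f hf hgf := by
    simp only [Fin.prod_univ_one, Real.rpow_one] at hgf ⊢
    have h1 : 0 ≤ L.ι (D (f 0 - L.abs g)) := by
      refine hd.pos hd0 _ ((L.nonneg_iff _).2 ?_)
      filter_upwards [hgf, L.ae_eq_norm (hf 0), L.ι_abs g, L.ι_sub (f 0) (L.abs g)]
        with x h1 h2 h3 h4
      rw [h4, h2, h3, ← Complex.ofReal_sub]
      exact_mod_cast sub_nonneg.2 h1
    rw [map_sub] at h1
    filter_upwards [HasKernel.norm_apply_le (c := c) (f := g) hd0 hd, hc.2 g,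
      (L.nonneg_iff _).1 h1, L.ι_sub (D (f 0)) (D (L.abs g)),
      (L.nonneg_iff _).1 (hd.pos hd0 _ (L.abs_nonneg g))] with x h2 h3 h4 h5 h6
    rw [h3.2]
    refine (enorm_le_iff_norm_le.1 (h2 (ae_of_all _ fun y => hcd (x, y)))).trans ?_
    rw [h5, sub_nonneg] at h4
    exact CStarAlgebra.norm_le_norm_of_nonneg_of_le h6 h4

/-- `r((Ψ^(α₁) ∘ ⋯ ∘ Ψ^(α_m)) ^ n) ≤ r((Ψ ^ n)^(α₁) ∘ ⋯ ∘ (Ψ ^ n)^(α_m))`, because the matrices on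
the left are entrywise dominated by those on the right. -/
lemma radiusOf_hadamard_pow_le (hL : L.HasUnitVectors) (hα : ∀ j, 0 ≤ α j) (hs : 1 ≤ ∑ j, α j)
    {q : (E →L[ℂ] E) → ℝ≥0∞} (hq : L.MeanBounded (fun _ : Fin 1 => (1 : ℝ)) 1 1 q)
    {Ψ : Set (E →L[ℂ] E)} (hΨ : ∀ A ∈ Ψ, L.IsPositiveKernelOperator A) {n : ℕ} (hn : 1 ≤ n) :
    radiusOf q (L.hadamard α (fun _ => Ψ) ^ n) ≤ radiusOf q (L.hadamard α (fun _ => Ψ ^ n)) := by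
  obtain ⟨n, rfl⟩ := Nat.exists_eq_succ_of_ne_zero (by omega : n ≠ 0)
  have hΨn := isPositiveKernelOperator_of_mem_pow hΨ n
  have h𝒞n := isPositiveKernelOperator_of_mem_pow
    (isPositiveKernelOperator_of_mem_hadamard (L := L) (α := α) (Ψ := fun _ => Ψ)) n
  refine (hq.radiusOf_le ENNReal.one_ne_top one_pos h𝒞n isPositiveKernelOperator_of_mem_hadamard
    fun C hC => ?_).trans_eq (ENNReal.rpow_one _)
  obtain ⟨A, hA, hAC⟩ := exists_geomDominated_of_mem_pow
    (exists_geomDominated_of_mem_hadamard hα (holderExponents_count hα hs)) _ C hC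
  obtain ⟨D, hD, -⟩ := hadamardDefined_of_one_le_sum hL hα hs (fun _ => hΨn) A hA
  refine ⟨fun _ => D, fun _ => ⟨A, hA, hD⟩, ?_⟩
  obtain ⟨a, ha0, ha, hd⟩ := hD
  obtain ⟨c, _, _, hc⟩ := (h𝒞n C hC).exists_kernel
  exact hd.geomDominated
    (fun p => Finset.prod_nonneg fun j _ => Real.rpow_nonneg (ha0 _ _) _) hc
    (hAC.kernel_le hL ha0 ha hc)

lemma isBounded_hadamard (hL : L.HasUnitVectors) (hα : ∀ j, 0 ≤ α j) (hs : 1 ≤ ∑ j, α j)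
    {Ψ : Set (E →L[ℂ] E)} (hb : Bornology.IsBounded Ψ)
    (hΨ : ∀ A ∈ Ψ, L.IsPositiveKernelOperator A) :
    Bornology.IsBounded (L.hadamard α (fun _ => Ψ)) := by
  obtain ⟨N, hN, hΨN⟩ := hb.exists_pos_norm_le
  refine isBounded_iff_forall_norm_le.2 ⟨N ^ ∑ j, α j, fun C hC => ?_⟩
  obtain ⟨A, hA, hAC⟩ := exists_geomDominated_of_mem_hadamard hα (holderExponents_count hα hs) C hC
  exact hAC.opNorm_le_rpow hL hα hs (isPositiveKernelOperator_of_mem_hadamard C hC)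
    (fun j => hΨ _ (hA j)) hN.le fun j => hΨN _ (hA j)

/-- The radius of the Hadamard product of powers, for the norm and for the spectral radius. -/
lemma radius_hadamard_le (hL : L.HasUnitVectors) (hα : ∀ j, 0 ≤ α j) (hs : 1 ≤ ∑ j, α j)
    {Ψ : Set (E →L[ℂ] E)} (hb : Bornology.IsBounded Ψ)
    (hΨ : ∀ A ∈ Ψ, L.IsPositiveKernelOperator A) {n : ℕ} (hn : 1 ≤ n)
    {r : Set (E →L[ℂ] E) → ℝ≥0∞} (hr : r = genRadius ∨ r = jointRadius) :
    r (L.hadamard α (fun _ => Ψ)) ≤ r (L.hadamard α (fun _ => Ψ ^ n)) ^ (1 / (n : ℝ)) ∧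
      r (L.hadamard α (fun _ => Ψ ^ n)) ^ (1 / (n : ℝ)) ≤ r Ψ ^ ∑ j, α j := by
  have hs0 : 0 < ∑ j, α j := by linarith
  have hn0 : (0 : ℝ) < n := by exact_mod_cast hn
  have hΨn : ∀ A ∈ Ψ ^ n, L.IsPositiveKernelOperator A := by
    obtain ⟨k, rfl⟩ := Nat.exists_eq_succ_of_ne_zero (by omega : n ≠ 0)
    exact isPositiveKernelOperator_of_mem_pow hΨ k
  have key : ∀ q : (E →L[ℂ] E) → ℝ≥0∞, L.MeanBounded (fun _ : Fin 1 => (1 : ℝ)) 1 1 q →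
      L.MeanBounded α (∑ j, α j) 1 q →
      radiusOf q (L.hadamard α (fun _ => Ψ)) ≤
        radiusOf q (L.hadamard α (fun _ => Ψ) ^ n) ^ (1 / (n : ℝ)) →
      radiusOf q (L.hadamard α (fun _ => Ψ)) ≤
        radiusOf q (L.hadamard α (fun _ => Ψ ^ n)) ^ (1 / (n : ℝ)) ∧
      radiusOf q (L.hadamard α (fun _ => Ψ ^ n)) ^ (1 / (n : ℝ)) ≤
        radiusOf q Ψ ^ ∑ j, α j := by
    intro q h1 h2 h3
    refine ⟨h3.trans ?_, ?_⟩
    · gcongr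
      exact radiusOf_hadamard_pow_le hL hα hs h1 hΨ hn
    · have h4 := h2.radiusOf_le ENNReal.one_ne_top hs0 isPositiveKernelOperator_of_mem_hadamard
        hΨn (exists_geomDominated_of_mem_hadamard hα (holderExponents_count hα hs))
      calc radiusOf q (L.hadamard α (fun _ => Ψ ^ n)) ^ (1 / (n : ℝ))
          ≤ ((radiusOf q Ψ ^ (n : ℝ)) ^ ∑ j, α j) ^ (1 / (n : ℝ)) := by
            gcongr
            refine h4.trans ?_
            gcongr
            exact radiusOf_pow_le q Ψ hn
        _ = radiusOf q Ψ ^ ∑ j, α j := by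
            rw [← ENNReal.rpow_mul, ← ENNReal.rpow_mul]
            congr 1
            field_simp
  have hone : L.MeanBounded (fun _ : Fin 1 => (1 : ℝ)) 1 1 (fun A => ‖A‖ₑ) :=
    meanBounded_enorm (fun _ => zero_le_one) (by simp)
  have hsum := meanBounded_enorm_rpow hL hα hs
  rcases hr with rfl | rfl
  · exact key _ (hone.spectralRadius one_pos) (hsum.spectralRadius hs0) (genRadius_le_pow hn)
  · exact key _ hone hsum (jointRadius_le_pow (isBounded_hadamard hL hα hs hb hΨ) hn)

end SequenceSpace

end BanachFunctionSpace

/-! ### The comparison theorem -/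

theorem theorem3p1 {X : Type*} [MeasurableSpace X] (μ : Measure X) [SigmaFinite μ]
    (E : Type*) [NormedAddCommGroup E] [NormedSpace ℂ E] [CompleteSpace E]
    (L : BanachFunctionSpace μ E) :
    -- part (i)
    (∀ Ψ Θ : Set (E →L[ℂ] E),
      Bornology.IsBounded Ψ → (∀ A ∈ Ψ, L.IsPositiveKernelOperator A) →
      Bornology.IsBounded Θ → (∀ A ∈ Θ, L.IsPositiveKernelOperator A) →
      ∀ (m : ℕ) (α : Fin m → ℝ), (∀ j, 0 ≤ α j) → ∑ j, α j = 1 →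
      ∀ β ∈ Set.Icc (0 : ℝ) 1,
        -- the Hadamard geometric means below are well defined
        (L.HadamardDefined α (fun _ => Ψ) ∧
          ∀ Ω ∈ ({Ψ, Θ, Ψ * Θ, Θ * Ψ} : Set (Set (E →L[ℂ] E))),
            L.HadamardDefined (fun _ : Fin 2 => (1 / 2 : ℝ)) (fun _ => Ω)) ∧
        ∀ r : Set (E →L[ℂ] E) → ℝ≥0∞,
          (r = genRadius ∨ r = jointRadius ∨
            (L.HasOrderContinuousNorm ∧ L.DualHasOrderContinuousNorm ∧
              (r = genEssRadius ∨ r = jointEssRadius))) →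
          r Ψ = r (L.hadamard α (fun _ => Ψ)) ∧
          r (Ψ * Θ) = r (L.hadamard (fun _ : Fin 2 => (1 / 2 : ℝ)) (fun _ => Ψ) *
            L.hadamard (fun _ : Fin 2 => (1 / 2 : ℝ)) (fun _ => Θ)) ∧
          r (Ψ * Θ) =
            r (L.hadamard (fun _ : Fin 2 => (1 / 2 : ℝ)) (fun _ => Ψ * Θ)) ^ β *
            r (L.hadamard (fun _ : Fin 2 => (1 / 2 : ℝ)) (fun _ => Θ * Ψ)) ^ (1 - β)) ∧
    -- part (ii)
    (L.IsNormalizedSequenceSpace →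
      ∀ Ψ : Set (E →L[ℂ] E),
      Bornology.IsBounded Ψ → (∀ A ∈ Ψ, L.IsNonnegMatrixOperator A) →
      ∀ m n : ℕ, 1 ≤ m → 1 ≤ n → ∀ α : ℝ, 1 ≤ α →
        -- the Hadamard powers and products below are well defined
        (L.HadamardDefined ![(m : ℝ)] ![Ψ] ∧ L.HadamardDefined ![α] ![Ψ] ∧
          ∀ Ω ∈ ({Ψ, Ψ ^ n} : Set (Set (E →L[ℂ] E))),
            L.HadamardDefined (fun _ : Fin m => (1 : ℝ)) (fun _ => Ω) ∧
            L.HadamardDefined ![α - 1, 1] ![Ω, Ω]) ∧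
        ∀ r : Set (E →L[ℂ] E) → ℝ≥0∞, (r = genRadius ∨ r = jointRadius) →
          (r (L.hadamard ![(m : ℝ)] ![Ψ]) ≤ r (L.hadamard (fun _ : Fin m => (1 : ℝ)) (fun _ => Ψ)) ∧
            r (L.hadamard (fun _ : Fin m => (1 : ℝ)) (fun _ => Ψ)) ≤
              r (L.hadamard (fun _ : Fin m => (1 : ℝ)) (fun _ => Ψ ^ n)) ^ (1 / (n : ℝ)) ∧
            r (L.hadamard (fun _ : Fin m => (1 : ℝ)) (fun _ => Ψ ^ n)) ^ (1 / (n : ℝ)) ≤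
              r Ψ ^ m) ∧
          (r (L.hadamard ![α] ![Ψ]) ≤ r (L.hadamard ![α - 1, 1] ![Ψ, Ψ]) ∧
            r (L.hadamard ![α - 1, 1] ![Ψ, Ψ]) ≤
              r (L.hadamard ![α - 1, 1] ![Ψ ^ n, Ψ ^ n]) ^ (1 / (n : ℝ)) ∧
            r (L.hadamard ![α - 1, 1] ![Ψ ^ n, Ψ ^ n]) ^ (1 / (n : ℝ)) ≤ r Ψ ^ α)) := by
  refine ⟨?_, ?_⟩
  · intro Ψ Θ hΨb hΨ hΘb hΘ m α hα hs β hβ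
    have hhalf : ∀ j : Fin 2, (0 : ℝ) ≤ (fun _ => 1 / 2 : Fin 2 → ℝ) j := fun _ => by norm_num
    have hhalf1 : ∑ j : Fin 2, (fun _ => 1 / 2 : Fin 2 → ℝ) j = 1 := by norm_num
    refine ⟨⟨BanachFunctionSpace.hadamardDefined_of_sum_eq_one hα hs fun _ => hΨ, ?_⟩, ?_⟩
    · intro Ω hΩ
      refine BanachFunctionSpace.hadamardDefined_of_sum_eq_one hhalf hhalf1 fun _ => ?_
      rcases hΩ with rfl | rfl | rfl | rfl
      · exact hΨ
      · exact hΘ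
      · exact BanachFunctionSpace.isPositiveKernelOperator_of_mem_mul hΨ hΘ
      · exact BanachFunctionSpace.isPositiveKernelOperator_of_mem_mul hΘ hΨ
    · have key : ∀ (q : (E →L[ℂ] E) → ℝ≥0∞) (K : ℝ≥0∞), K ≠ ∞ →
          (∀ (k : ℕ) (γ : Fin k → ℝ), (∀ j, 0 ≤ γ j) → ∑ j, γ j = 1 → L.MeanBounded γ 1 K q) →
          radiusOf q (Ψ * Θ) = radiusOf q (Θ * Ψ) →
          radiusOf q Ψ = radiusOf q (L.hadamard α (fun _ => Ψ)) ∧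
          radiusOf q (Ψ * Θ) = radiusOf q (L.hadamard (fun _ : Fin 2 => (1 / 2 : ℝ)) (fun _ => Ψ) *
            L.hadamard (fun _ : Fin 2 => (1 / 2 : ℝ)) (fun _ => Θ)) ∧
          radiusOf q (Ψ * Θ) =
            radiusOf q (L.hadamard (fun _ : Fin 2 => (1 / 2 : ℝ)) (fun _ => Ψ * Θ)) ^ β *
            radiusOf q (L.hadamard (fun _ : Fin 2 => (1 / 2 : ℝ)) (fun _ => Θ * Ψ)) ^ (1 - β) := by
        intro q K hK hq hcomm
        have hq2 := hq 2 _ hhalf hhalf1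
        exact ⟨((hq m α hα hs).radiusOf_hadamard hK hα hs hΨ).symm,
          (hq2.radiusOf_hadamard_mul_hadamard hK hhalf hhalf1 hΨ hΘ).symm,
          hq2.radiusOf_mul_eq hK hhalf hhalf1 hΨ hΘ hcomm hβ⟩
      -- `r(ΨΘ) = r(ΘΨ)`: the spectral radii satisfy `q(AB) = q(BA)`, whereas the norm and `γ` are
      -- only submultiplicative, which suffices since `Ψ` and `Θ` are bounded
      have cyclic : ∀ q : (E →L[ℂ] E) → ℝ≥0∞, (∀ A B, q (A * B) = q (B * A)) →
          radiusOf q (Ψ * Θ) = radiusOf q (Θ * Ψ) := fun q hq =>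
        le_antisymm (radiusOf_mul_comm_le_of_cyclic hq) (radiusOf_mul_comm_le_of_cyclic hq)
      have ideal : ∀ q : (E →L[ℂ] E) → ℝ≥0∞, (∀ A B C, q (A * B * C) ≤ ‖A‖ₑ * q B * ‖C‖ₑ) →
          radiusOf q (Ψ * Θ) = radiusOf q (Θ * Ψ) := fun q hq =>
        le_antisymm (radiusOf_mul_comm_le_of_ideal hq hΨb hΘb)
          (radiusOf_mul_comm_le_of_ideal hq hΘb hΨb)
      rintro r (rfl | rfl | ⟨hL, hL', rfl | rfl⟩)
      · exact key _ 1 ENNReal.one_ne_top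
          (fun _ _ h0 h1 => (BanachFunctionSpace.meanBounded_enorm h0 h1).spectralRadius one_pos)
          (cyclic _ spectralRadius_mul_comm)
      · exact key _ 1 ENNReal.one_ne_top
          (fun _ _ h0 h1 => BanachFunctionSpace.meanBounded_enorm h0 h1)
          (ideal _ fun A B C => (enorm_opMul_le _ _).trans (by gcongr; exact enorm_opMul_le _ _))
      · exact key _ 1 ENNReal.one_ne_top
          (fun _ _ h0 h1 => BanachFunctionSpace.meanBounded_essSpectralRadius hL hL' h0 h1)
          (cyclic _ fun A B => spectralRadius_mul_comm (A : CalkinAlgebra E) (B : CalkinAlgebra E))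
      · exact key _ 4 (by simp)
          (fun _ _ h0 h1 => BanachFunctionSpace.meanBounded_hausdorffNoncompactness hL hL' h0 h1)
          (ideal _ hausdorffNoncompactness_mul_mul_le)
  · rintro ⟨hX, hXm, rfl, hunit⟩ Ψ hΨb hΨmat m n hm hn α hα
    have hΨ : ∀ A ∈ Ψ, L.IsPositiveKernelOperator A := fun A hA =>
      (hΨmat A hA).isPositiveKernelOperator
    have hΨn : ∀ A ∈ Ψ ^ n, L.IsPositiveKernelOperator A := by
      obtain ⟨k, rfl⟩ := Nat.exists_eq_succ_of_ne_zero (by omega : n ≠ 0)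
      exact BanachFunctionSpace.isPositiveKernelOperator_of_mem_pow hΨ k
    have hm1 : (1 : ℝ) ≤ m := by exact_mod_cast hm
    have hL : L.HasUnitVectors := hunit
    have hone : ∀ j : Fin m, (0 : ℝ) ≤ (fun _ => 1 : Fin m → ℝ) j := fun _ => zero_le_one
    have hsone : ∑ j : Fin m, (fun _ => 1 : Fin m → ℝ) j = m := by simp
    have hpair : ∀ j : Fin 2, 0 ≤ (![α - 1, 1] : Fin 2 → ℝ) j := by
      intro j
      fin_cases j
      · exact sub_nonneg.2 hα
      · exact zero_le_one
    have hspair : ∑ j : Fin 2, (![α - 1, 1] : Fin 2 → ℝ) j = α := by simp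
    have hdup : ∀ Ω : Set (E →L[ℂ] E), ![Ω, Ω] = fun _ => Ω := fun Ω => by
      funext j
      fin_cases j <;> rfl
    have hsingle : ∀ {t : ℝ}, 1 ≤ t → L.HadamardDefined ![t] ![Ψ] := fun {t} ht => by
      refine BanachFunctionSpace.hadamardDefined_of_one_le_sum hL (fun j => ?_) (by simpa using ht)
        fun j => ?_
      · simpa using zero_le_one.trans ht
      · simpa using hΨ
    refine ⟨⟨hsingle hm1, hsingle hα, fun Ω hΩ => ?_⟩, fun r hr => ⟨?_, ?_⟩⟩
    · have hΩ' : ∀ A ∈ Ω, L.IsPositiveKernelOperator A := by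
        rcases hΩ with rfl | rfl
        · exact hΨ
        · exact hΨn
      rw [hdup]
      exact ⟨BanachFunctionSpace.hadamardDefined_of_one_le_sum hL hone (hsone ▸ hm1) fun _ => hΩ',
        BanachFunctionSpace.hadamardDefined_of_one_le_sum hL hpair (hspair.symm ▸ hα)
          fun _ => hΩ'⟩
    -- `A^(m) = A ∘ ⋯ ∘ A` and `A^(α) = A^(α - 1) ∘ A`, which gives the first links of the chains
    · have h := BanachFunctionSpace.radius_hadamard_le hL hone (hsone ▸ hm1) hΨb hΨ hn hr
      rw [hsone, ENNReal.rpow_natCast] at h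
      refine ⟨?_, h.1, h.2⟩
      have hsub : L.hadamard ![(m : ℝ)] ![Ψ] ⊆
          L.hadamard (fun _ : Fin m => (1 : ℝ)) (fun _ => Ψ) := by
        rintro C ⟨A, hA, a, ha0, ha, hC⟩
        refine ⟨fun _ => A 0, fun _ => hA 0, fun _ => a 0, fun _ => ha0 0, fun _ => ha 0, ?_⟩
        simpa using hC
      rcases hr with rfl | rfl
      · exact radiusOf_mono _ hsub
      · exact radiusOf_mono _ hsub
    · have h := BanachFunctionSpace.radius_hadamard_le hL hpair (hspair.symm ▸ hα) hΨb hΨ hn hr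
      rw [hspair] at h
      rw [hdup, hdup]
      refine ⟨?_, h.1, h.2⟩
      have hsub : L.hadamard ![α] ![Ψ] ⊆ L.hadamard ![α - 1, 1] (fun _ => Ψ) := by
        rintro C ⟨A, hA, a, ha0, ha, hC⟩
        refine ⟨fun _ => A 0, fun _ => hA 0, fun _ => a 0, fun _ => ha0 0, fun _ => ha 0, ?_⟩
        have h1 : ∀ p, a 0 p ^ (α - 1) * a 0 p = a 0 p ^ α := fun p => by
          conv_rhs => rw [← sub_add_cancel α 1]
          rw [Real.rpow_add_of_nonneg (ha0 0 p) (sub_nonneg.2 hα) zero_le_one, Real.rpow_one]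
        simpa [h1] using hC
      rcases hr with rfl | rfl
      · exact radiusOf_mono _ hsub
      · exact radiusOf_mono _ hsub
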